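/- Let $d\ge 1$ and let $U_d\subset\mathbb C^d$ be the set of all $z=(z_1,\dots,z_d)$ such that $z_iz_{i+1}\cdots z_j\notin[0,\infty)$ for all $1\le i\le j\le d$; write $z_{i,j}=z_iz_{i+1}\cdots z_j$ for $i\le j$. For a vector $n=(n_1,\dots,n_r)$ of positive integers, of weight $|n|=n_1+\cdots+n_r$ and depth $r$, and for $x\in\mathbb C^r$, let $$\mathrm{Li}_n(x)=\sum_{0<k_1<\cdots<k_r}\frac{x_1^{k_1}\cdots x_r^{k_r}}{k_1^{n_1}\cdots k_r^{n_r}}$$ near the origin, and in general let $\mathrm{Li}_n(x)$ be the value at $t=1$ of the analytic continuation of $t\mapsto \mathrm{Li}_n(tx)$ from $t=0$ along the segment $[0,1]$, whenever this continuation exists. For $k\ge 0$ and $y\in\mathbb C\setminus[0,\infty)$ let $$\beta_k(y)=\frac{(2\pi i)^k}{k!}\,B_k\!\left(\frac12+\frac{\log(-y)}{2\pi i}\right),$$ where $B_k$ is the $k$-th Bernoulli polynomial and $\log$ is the principal branch. For integers $D,w\ge 0$ let $\mathscr L^D_w$ be the $\mathbb Z$-module of functions on $U_d$ spanned by the products $$\prod_{i=1}^{d}\beta_{k_i}(z_{i,d})\;\prod_{p=1}^{s}\mathrm{Li}_{n^{(p)}}\big(z^{(p)}\big)$$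 that are defined at all points of $U_d$, where $k_1,\dots,k_d\ge 0$ and $s\ge 0$ are integers, each $n^{(p)}$ is a vector of $d_p\ge 1$ positive integers, the total depth $r=d_1+\cdots+d_s$ is at most $D$, the weights satisfy $k_1+\cdots+k_d+\sum_{p=1}^s|n^{(p)}|=w$, and the argument vectors $z^{(p)}$ of length $d_p$, read from left to right, form a list $(z^{(1)},\dots,z^{(s)})=(z_{i_1,j_1},\dots,z_{i_r,j_r})$ of disjoint, ordered consecutive products: $1\le i_1\le j_1<i_2\le j_2<\cdots<i_r\le j_r\le d$. **Theorem.** For every vector $n\in\mathbb Z_{>0}^d$, the values $\mathrm{Li}_n(z_1,\dots,z_d)$ and $\mathrm{Li}_n(1/z_1,\dots,1/z_d)$ are defined for all $z\in U_d$, and the function $$\mathrm{PLi}_n(z)=\mathrm{Li}_n(z_1,\dots,z_d)-(-1)^{|n|-d}\,\mathrm{Li}_n(1/z_1,\dots,1/z_d)$$ on $U_d$ belongs to $\mathscr L^{d-1}_{|n|}$. -/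

import Mathlib

namespace MPL

/-- The term `z_1^{k_1} ⋯ z_d^{k_d} / (k_1^{n_1} ⋯ k_d^{n_d})` of the series of `Li_n(z)`. -/
noncomputable def seriesTerm {d : ℕ} (n : Fin d → ℕ+) (z : Fin d → ℂ) (k : Fin d → ℕ+) : ℂ :=
  ∏ i, z i ^ (k i : ℕ) / ((k i : ℕ) : ℂ) ^ (n i : ℕ)

/-- `IsValue n z v`: the germ at `t = 0` of `t ↦ Li_n(t z_1, …, t z_d)`, given by the series over
`0 < k_1 < ⋯ < k_d`, continues analytically along the straight path `t ∈ [0, 1]`, and the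
continuation takes the value `v` at `t = 1`. -/
def IsValue {d : ℕ} (n : Fin d → ℕ+) (z : Fin d → ℂ) (v : ℂ) : Prop :=
  ∃ g : ℂ → ℂ,
    AnalyticOnNhd ℂ g (segment ℝ (0 : ℂ) 1) ∧
    (∀ᶠ t in nhds (0 : ℂ),
      HasSum (fun k : {k : Fin d → ℕ+ // StrictMono k} => seriesTerm n (fun i => t * z i) k)
        (g t)) ∧
    g 1 = v

/-- The multiple polylogarithm `Li_n` is defined at `z`: the continuation along the straight path
from the origin to `z` exists. -/
def IsDefinedAt {d : ℕ} (n : Fin d → ℕ+) (z : Fin d → ℂ) : Prop :=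
  ∃ v, IsValue n z v

open Classical in
/-- The multiple polylogarithm `Li_n(z)`, the value of the continuation along the straight path
(and `0` if there is no such continuation). -/
noncomputable def Li {d : ℕ} (n : Fin d → ℕ+) (z : Fin d → ℂ) : ℂ :=
  if h : IsDefinedAt n z then h.choose else 0

theorem IsValue.unique {d : ℕ} {n : Fin d → ℕ+} {z : Fin d → ℂ} {v w : ℂ}
    (hv : IsValue n z v) (hw : IsValue n z w) : v = w := by
  obtain ⟨g, hg, hgs, rfl⟩ := hv
  obtain ⟨f, hf, hfs, rfl⟩ := hw
  have h : g =ᶠ[nhds 0] f := by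
    filter_upwards [hgs, hfs] with t h1 h2 using h1.unique h2
  exact hg.eqOn_of_preconnected_of_eventuallyEq hf (convex_segment (0 : ℂ) 1).isPreconnected
    (left_mem_segment ℝ (0 : ℂ) 1) h (right_mem_segment ℝ (0 : ℂ) 1)

theorem IsValue.li_eq {d : ℕ} {n : Fin d → ℕ+} {z : Fin d → ℂ} {v : ℂ}
    (hv : IsValue n z v) : Li n z = v := by
  have h : IsDefinedAt n z := ⟨v, hv⟩
  rw [Li, dif_pos h]
  exact h.choose_spec.unique hv

/-- The consecutive product `z_{i,j} = z_i z_{i+1} ⋯ z_j`. -/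
def consecProd {N : ℕ} (z : Fin N → ℂ) (i j : Fin N) : ℂ :=
  ∏ k ∈ Finset.Icc i j, z k

/-- The set of all `z ∈ ℂ^N` such that no consecutive product `z_i ⋯ z_j` (with `i ≤ j`) lies in
`[0, ∞)`. -/
def domain (N : ℕ) : Set (Fin N → ℂ) :=
  {z | ∀ i j : Fin N, i ≤ j → ∀ x : ℝ, 0 ≤ x → consecProd z i j ≠ (x : ℂ)}

/-- `β_k(z) = (2πi)^k / k! · B_k(1/2 + log(-z) / (2πi))`, with the Bernoulli polynomial `B_k` and
the principal branch of the logarithm. -/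
noncomputable def beta (k : ℕ) (z : ℂ) : ℂ :=
  (2 * (Real.pi : ℂ) * Complex.I) ^ k / (Nat.factorial k : ℂ) *
    Polynomial.aeval (1 / 2 + Complex.log (-z) / (2 * (Real.pi : ℂ) * Complex.I))
      (Polynomial.bernoulli k)

/-- `PLi_n(z) = Li_n(z) - (-1)^{|n| - d} Li_n(1/z)`. -/
noncomputable def PLi {d : ℕ} (n : Fin d → ℕ+) (z : Fin d → ℂ) : ℂ :=
  Li n z - (-1) ^ ((∑ i, (n i : ℕ)) - d) * Li n (fun i => (z i)⁻¹)

/-- The combinatorial data of a product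
`∏_{i=1}^N β_{k_i}(z_{i,N}) · ∏_{p=1}^s Li_{n^{(p)}}(z^{(p)})`
of total depth at most `D` and total weight `w`. All the indices
`(n^{(1)}, …, n^{(s)}) = (n_1, …, n_r)` and all the arguments
`(z^{(1)}, …, z^{(s)}) = (z_{i_1,j_1}, …, z_{i_r,j_r})` are listed from left to right, and `blocks`
is the composition of `r` into the (positive) depths of the `s` factors. -/
structure Generator (N D w : ℕ) where
  /-- the indices of the Bernoulli functions -/
  k : Fin N → ℕ
  /-- the total depth -/
  r : ℕ
  r_le : r ≤ D
  /-- the indices of the polylogarithms -/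
  n : Fin r → ℕ+
  /-- the first variable in each argument -/
  lo : Fin r → Fin N
  /-- the last variable in each argument -/
  hi : Fin r → Fin N
  lo_le_hi : ∀ a, lo a ≤ hi a
  hi_lt_lo : ∀ a b, a < b → hi a < lo b
  /-- the division of the indices and the arguments among the factors -/
  blocks : Composition r
  weight : ∑ i, k i + ∑ a, (n a : ℕ) = w

namespace Generator

variable {N D w : ℕ} (G : Generator N D w)

/-- The index vector `n^{(p)}` of the `p`-th polylogarithm. -/
def index (p : Fin G.blocks.length) : Fin (G.blocks.blocksFun p) → ℕ+ :=
  fun a => G.n (G.blocks.embedding p a)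

/-- The argument vector `z^{(p)}` of the `p`-th polylogarithm. -/
def arg (z : Fin N → ℂ) (p : Fin G.blocks.length) : Fin (G.blocks.blocksFun p) → ℂ :=
  fun a => consecProd z (G.lo (G.blocks.embedding p a)) (G.hi (G.blocks.embedding p a))

/-- The product `∏_{i=1}^N β_{k_i}(z_{i,N}) · ∏_{p=1}^s Li_{n^{(p)}}(z^{(p)})`, where
`z_{i,N} = z_i ⋯ z_N`. -/
noncomputable def eval (z : Fin N → ℂ) : ℂ :=
  (∏ i, beta (G.k i) (∏ j ∈ Finset.Ici i, z j)) * ∏ p, Li (G.index p) (G.arg z p)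

/-- All polylogarithms in the product are defined at every point of the domain. -/
def IsDefined : Prop :=
  ∀ z ∈ domain N, ∀ p, IsDefinedAt (G.index p) (G.arg z p)

end Generator

/-- The `ℤ`-module `𝓛^D_w(z)` of functions on `domain N`, spanned by the products of total depth at
most `D` and weight `w` that are functions on all of `domain N`. (A factor such as
`Li_{a,b}(z_1, z_3)` has a branch cut `z_1 z_3 ∈ [1, ∞)` inside of `domain 3`.) -/
noncomputable def polylogModule (N D w : ℕ) : Submodule ℤ (domain N → ℂ) :=
  Submodule.span ℤ {f | ∃ G : Generator N D w, G.IsDefined ∧ f = fun z : domain N => G.eval z}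

end MPL

/-! Put x_i = z_i ⋯ z_d. The condition z ∈ U_d says that all x_i and all quotients x_i / x_j with i
≠ j avoid [0, ∞) (`Dom`). This set is stable under positive scaling of single coordinates, so
functions on it can be followed along scalings to 0 and to ∞, where differential equations and
limits determine them.

With the substitution x = e^{-u}, Li_n becomes an iterated integral (`flow`) built from `geom` (x_i
e^{-u}). In the lists, the head is the largest index and the outermost integration, and the last
element is the innermost one. Scaling all coordinates together differentiates the outermost
integral; scaling only the innermost coordinate also gives a closed formula, by partial fractions.
Every identity below is proved by comparing such derivatives and then a limit.

In depth one, Li_k(x) + β_k(x) = (-1)^{k-1} Li_k(1/x) (`flow_inversion`). In higher depth, let all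
x_i tend to ∞. Then Li_n has a logarithmic expansion (`expansion`): up to sign, the sum over i of an
iterated integral with entries x_a / x_i (a < i) times a function `lead` made of β_k(x_i) and
iterated integrals with entries x_i / x_j (j > i). The functions `lead` are defined so that the
expansion obeys the same equations in the innermost variable as Li_n, and, under common scaling,
those equations with the outermost `geom` replaced by its limit -1 (`asym_lowest`). The remainder
decays exponentially (`exists_norm_remainder_le`).

Li_n(1/x) decays at ∞ as well. Comparing the derivatives under common scaling, the remainder minus
the signed Li_n(1/x) is an integer combination of products of an expansion and an inverted
polylogarithm of smaller depth (`exists_remainder_sub_inverted_eq`); the primitives come from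
integration by parts, so no denominators appear. Induction on the depth replaces inverted
polylogarithms by ordinary ones (`block_sub_inverted_mem`). Every expansion spends one index on a
Bernoulli function, and this lowers the depth to d - 1.

Finally, the integrals with common numerator x_i are rewritten as products of blocks in the required
order (`exists_revBlock_eq`). Since x_i / x_e = z_i ⋯ z_{e-1}, these blocks are polylogarithms of
ordered consecutive products. -/

section

open MeasureTheory Set Filter Topology
open Complex (slitPlane)

/-! ### Iterated integrals in the logarithmic variable u = -log x. -/

namespace MPL

/-! ### Tail integrals of exponentially decaying functions -/

/-- The tail integral `v ↦ ∫_v^∞ h(u) du`. -/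
noncomputable def tailInt (h : ℝ → ℂ) (v : ℝ) : ℂ := ∫ u in Ioi v, h u

/-- `h` is continuous and bounded by `C e^{-u}`. -/
structure IsTame (C : ℝ) (h : ℝ → ℂ) : Prop where
  cont : Continuous h
  bound : ∀ u, ‖h u‖ ≤ C * Real.exp (-u)

theorem integrableOn_const_mul_exp_neg (C v : ℝ) :
    IntegrableOn (fun u => C * Real.exp (-u)) (Ioi v) :=
  (integrableOn_exp_neg_Ioi v).const_mul C

theorem norm_tailInt_le {C v : ℝ} {h : ℝ → ℂ} (hb : ∀ u, v < u → ‖h u‖ ≤ C * Real.exp (-u)) :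
    ‖tailInt h v‖ ≤ C * Real.exp (-v) := by
  have := norm_integral_le_of_norm_le (μ := volume.restrict (Ioi v)) (f := h)
    (integrableOn_const_mul_exp_neg C v)
    ((ae_restrict_iff' measurableSet_Ioi).2 (Eventually.of_forall fun u hu => hb u hu))
  rwa [integral_const_mul, integral_exp_neg_Ioi] at this

theorem IsTame.integrableOn {C : ℝ} {h : ℝ → ℂ} (hh : IsTame C h) (v : ℝ) :
    IntegrableOn h (Ioi v) :=
  (integrableOn_const_mul_exp_neg C v).mono' hh.cont.aestronglyMeasurable
    (Eventually.of_forall hh.bound)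

theorem IsTame.hasDerivAt_tailInt {C : ℝ} {h : ℝ → ℂ} (hh : IsTame C h) (v : ℝ) :
    HasDerivAt (tailInt h) (-(h v)) v := by
  have h1 : tailInt h = fun w => tailInt h v - ∫ u in v..w, h u := by
    funext w
    have := intervalIntegral.integral_Ioi_sub_Ioi' (hh.integrableOn v) (hh.integrableOn w)
    simp only [tailInt]
    rw [← this]; ring
  rw [h1]
  have h2 := intervalIntegral.integral_hasDerivAt_right (hh.cont.intervalIntegrable v v)
    (hh.cont.stronglyMeasurableAtFilter _ _) hh.cont.continuousAt
  simpa using h2.const_sub (tailInt h v)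

theorem IsTame.tailInt {C : ℝ} {h : ℝ → ℂ} (hh : IsTame C h) : IsTame C (tailInt h) where
  cont := continuous_iff_continuousAt.2 fun v => (hh.hasDerivAt_tailInt v).continuousAt
  bound _ := norm_tailInt_le fun u _ => hh.bound u

theorem IsTame.iterate_tailInt {C : ℝ} {h : ℝ → ℂ} (hh : IsTame C h) (n : ℕ) :
    IsTame C (MPL.tailInt^[n] h) := by
  induction n with
  | zero => exact hh
  | succ n ih => rw [Function.iterate_succ_apply']; exact ih.tailInt

theorem tailInt_comp_add (h : ℝ → ℂ) (s v : ℝ) :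
    tailInt (fun u => h (u + s)) v = tailInt h (v + s) := by
  unfold tailInt
  rw [← integral_indicator measurableSet_Ioi, ← integral_indicator measurableSet_Ioi,
    ← integral_add_right_eq_self (μ := volume) ((Ioi (v + s)).indicator h) s]
  congr 1
  funext u
  simp [indicator]

theorem iterate_tailInt_comp_add (h : ℝ → ℂ) (s v : ℝ) (n : ℕ) :
    tailInt^[n] (fun u => h (u + s)) v = tailInt^[n] h (v + s) := by
  induction n generalizing v with
  | zero => rfl
  | succ n ih =>
    rw [Function.iterate_succ_apply', Function.iterate_succ_apply', ← tailInt_comp_add]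
    congr 1
    funext u
    exact ih u

theorem tailInt_const_mul (c : ℂ) (h : ℝ → ℂ) :
    tailInt (fun u => c * h u) = fun v => c * tailInt h v := by
  funext v
  exact integral_const_mul c h

theorem iterate_tailInt_const_mul (c : ℂ) (h : ℝ → ℂ) (n : ℕ) :
    tailInt^[n] (fun u => c * h u) = fun v => c * tailInt^[n] h v := by
  induction n with
  | zero => rfl
  | succ n ih => rw [Function.iterate_succ_apply', ih, tailInt_const_mul,
      Function.iterate_succ_apply']

theorem IsTame.tailInt_add {C C' : ℝ} {h h' : ℝ → ℂ} (hh : IsTame C h) (hh' : IsTame C' h') :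
    MPL.tailInt (fun u => h u + h' u) = fun v => MPL.tailInt h v + MPL.tailInt h' v := by
  funext v
  exact integral_add (hh.integrableOn v) (hh'.integrableOn v)

theorem IsTame.iterate_tailInt_add {C C' : ℝ} {h h' : ℝ → ℂ} (hh : IsTame C h)
    (hh' : IsTame C' h') (n : ℕ) :
    MPL.tailInt^[n] (fun u => h u + h' u) =
      fun v => MPL.tailInt^[n] h v + MPL.tailInt^[n] h' v := by
  induction n with
  | zero => rfl
  | succ n ih =>
    rw [Function.iterate_succ_apply', ih,
      (hh.iterate_tailInt n).tailInt_add (hh'.iterate_tailInt n)]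
    simp only [Function.iterate_succ_apply']

/-- A tail integral depending on a parameter can be differentiated under the integral sign. -/
theorem hasDerivAt_tailInt_param {H H' : ℝ → ℝ → ℂ} {t₀ v C : ℝ} {U : Set ℝ} (hU : U ∈ 𝓝 t₀)
    (hc : ∀ t ∈ U, Continuous (H t)) (hc' : ∀ t ∈ U, Continuous (H' t))
    (hb : ∀ t ∈ U, ∀ u, ‖H t u‖ ≤ C * Real.exp (-u))
    (hb' : ∀ t ∈ U, ∀ u, ‖H' t u‖ ≤ C * Real.exp (-u))
    (hd : ∀ t ∈ U, ∀ u, HasDerivAt (fun t => H t u) (H' t u) t) :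
    HasDerivAt (fun t => tailInt (H t) v) (tailInt (H' t₀) v) t₀ := by
  have h0 := mem_of_mem_nhds hU
  refine (hasDerivAt_integral_of_dominated_loc_of_deriv_le (μ := volume.restrict (Ioi v))
    (F := H) (F' := H') (bound := fun u => C * Real.exp (-u)) hU ?_ ?_ ?_ ?_ ?_ ?_).2
  · filter_upwards [hU] with t ht using (hc t ht).aestronglyMeasurable
  · exact IsTame.integrableOn ⟨hc t₀ h0, hb t₀ h0⟩ v
  · exact (hc' t₀ h0).aestronglyMeasurable
  · exact Eventually.of_forall fun u t ht => hb' t ht u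
  · exact integrableOn_const_mul_exp_neg C v
  · exact Eventually.of_forall fun u t ht => hd t ht u

/-! ### The function `x / (1 - x)` -/

/-- The geometric series `x + x² + ⋯ = x / (1 - x)`. -/
noncomputable def geom (x : ℂ) : ℂ := x / (1 - x)

theorem neg_mem_slitPlane_iff {x : ℂ} : -x ∈ slitPlane ↔ ∀ r : ℝ, 0 ≤ r → x ≠ r := by
  rw [Complex.mem_slitPlane_iff]
  constructor
  · rintro h r hr rfl
    simp at h
    linarith
  · intro h
    by_contra! hc
    simp only [Complex.neg_re, Complex.neg_im, neg_eq_zero] at hc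
    exact h x.re (by linarith) (Complex.ext (by simp) (by simp [hc.2]))

theorem one_sub_ne_zero_of_neg_mem_slitPlane {x : ℂ} (hx : -x ∈ slitPlane) : 1 - x ≠ 0 := by
  intro h
  exact neg_mem_slitPlane_iff.1 hx 1 zero_le_one (by simp [sub_eq_zero.1 h])

theorem neg_mul_real_mem_slitPlane {x : ℂ} (hx : -x ∈ slitPlane) {r : ℝ} (hr : 0 < r) :
    -(x * r) ∈ slitPlane := by
  rw [neg_mem_slitPlane_iff] at *
  intro s hs h
  refine hx (s / r) (by positivity) ?_
  push_cast
  rw [← h]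
  field_simp [Complex.ofReal_ne_zero.2 hr.ne']

theorem neg_inv_mem_slitPlane {x : ℂ} (hx : -x ∈ slitPlane) : -x⁻¹ ∈ slitPlane := by
  rw [neg_mem_slitPlane_iff] at *
  intro s hs h
  exact hx s⁻¹ (by positivity) (by push_cast; rw [← h, inv_inv])

theorem ne_zero_of_neg_mem_slitPlane {x : ℂ} (hx : -x ∈ slitPlane) : x ≠ 0 := by
  simpa using neg_mem_slitPlane_iff.1 hx 0 le_rfl

/-- Writing r = θ / (1 - θ) compactifies the half-line: |(1 - θ) - xθ| is continuous and nonzero on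
[0, 1], hence bounded below, and homogeneity restores the factor 1 + r. -/
theorem exists_norm_one_sub_mul_ge {x : ℂ} (hx : -x ∈ slitPlane) :
    ∃ c : ℝ, 0 < c ∧ ∀ r : ℝ, 0 ≤ r → c * (1 + r) ≤ ‖1 - x * r‖ := by
  have hcont : Continuous fun θ : ℝ => ‖((1 - θ : ℝ) : ℂ) - x * (θ : ℝ)‖ := by fun_prop
  obtain ⟨θ, hθ, hmin⟩ := isCompact_Icc.exists_isMinOn (nonempty_Icc.2 (zero_le_one (α := ℝ)))
    hcont.continuousOn
  refine ⟨‖((1 - θ : ℝ) : ℂ) - x * (θ : ℝ)‖, ?_, ?_⟩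
  · rw [norm_pos_iff]
    intro h0
    rcases eq_or_lt_of_le hθ.1 with h | h
    · simp [← h] at h0
    · refine neg_mem_slitPlane_iff.1 hx ((1 - θ) / θ) (div_nonneg (by linarith [hθ.2]) h.le) ?_
      have : (θ : ℂ) ≠ 0 := Complex.ofReal_ne_zero.2 h.ne'
      rw [Complex.ofReal_div, eq_div_iff this, ← sub_eq_zero.1 h0]
  · intro r hr
    have h1 : 0 < 1 + r := by linarith
    have hm : r / (1 + r) ∈ Icc (0 : ℝ) 1 := ⟨by positivity, by rw [div_le_one h1]; linarith⟩
    have := hmin hm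
    simp only [Set.mem_ofPred_eq] at this
    calc _ ≤ ‖((1 - r / (1 + r) : ℝ) : ℂ) - x * (r / (1 + r) : ℝ)‖ * (1 + r) := by gcongr
      _ = ‖(((1 - r / (1 + r) : ℝ) : ℂ) - x * (r / (1 + r) : ℝ)) * ((1 + r : ℝ) : ℂ)‖ := by
        rw [norm_mul, Complex.norm_real, Real.norm_of_nonneg h1.le]
      _ = _ := by
        congr 1
        have : (1 + r : ℂ) ≠ 0 := by exact_mod_cast h1.ne'
        push_cast
        field_simp
        ring

/-- Two bounds for two roles: the constant one for outer entries, the linear one for the innermost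
entry, where r = e^{-u} makes the integrals converge. -/
theorem exists_norm_geom_le {x : ℂ} (hx : -x ∈ slitPlane) :
    ∃ A : ℝ, 0 ≤ A ∧ ∀ r : ℝ, 0 < r → ‖geom (x * r)‖ ≤ A ∧ ‖geom (x * r)‖ ≤ A * r := by
  obtain ⟨c, hc, h⟩ := exists_norm_one_sub_mul_ge hx
  refine ⟨‖x‖ / c, by positivity, fun r hr => ?_⟩
  have hle : ‖geom (x * r)‖ ≤ ‖x‖ * r / (c * (1 + r)) := by
    rw [geom, norm_div, norm_mul, Complex.norm_real, Real.norm_of_nonneg hr.le]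
    gcongr
    exact h r hr.le
  constructor
  · refine hle.trans ?_
    rw [div_le_div_iff₀ (by positivity) hc]
    nlinarith [mul_nonneg (norm_nonneg x) hc.le]
  · refine hle.trans ?_
    rw [div_mul_eq_mul_div, div_le_div_iff₀ (by positivity) hc]
    nlinarith [mul_nonneg (mul_nonneg (norm_nonneg x) hc.le) (mul_nonneg hr.le hr.le)]

theorem geom_inv {x : ℂ} (hx : -x ∈ slitPlane) : geom x⁻¹ = -(1 + geom x) := by
  have h0 := ne_zero_of_neg_mem_slitPlane hx
  have h1 := one_sub_ne_zero_of_neg_mem_slitPlane hx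
  have h2 : x - 1 ≠ 0 := fun h => h1 (by linear_combination -h)
  have h3 : 1 - x⁻¹ ≠ 0 := one_sub_ne_zero_of_neg_mem_slitPlane (neg_inv_mem_slitPlane hx)
  rw [geom, geom]
  field_simp
  ring

/-- Partial fractions in a common scaling parameter: the coefficients depend only on x / y. This is
how quotients of coordinates enter all the differential equations. -/
theorem geom_mul_geom {x y : ℂ} (hx : -x ∈ slitPlane) (hy : -y ∈ slitPlane)
    (hxy : -(x / y) ∈ slitPlane) :
    geom y * geom x = geom (x / y) * geom y - (1 + geom (x / y)) * geom x := by
  have h0 := ne_zero_of_neg_mem_slitPlane hy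
  have h1 := one_sub_ne_zero_of_neg_mem_slitPlane hx
  have h2 := one_sub_ne_zero_of_neg_mem_slitPlane hy
  have h3 := one_sub_ne_zero_of_neg_mem_slitPlane hxy
  have h4 : y - x ≠ 0 := by
    intro h
    apply h3
    rw [← sub_eq_zero.1 h, div_self h0, sub_self]
  rw [geom, geom, geom]
  field_simp
  ring

theorem continuous_geom_mul_exp {x : ℂ} (hx : -x ∈ slitPlane) :
    Continuous fun u : ℝ => geom (x * (Real.exp (-u) : ℝ)) := by
  unfold geom
  refine Continuous.div (by fun_prop) (by fun_prop) fun u => ?_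
  exact one_sub_ne_zero_of_neg_mem_slitPlane (neg_mul_real_mem_slitPlane hx (Real.exp_pos _))

/-! ### Multiple polylogarithms as iterated tail integrals -/

/-- For `L = [(n_d - 1, x_d), …, (n_1 - 1, x_1)]`, the value of `Li_n` at the point `z` with
`z_i ⋯ z_d = x_i e^{-v}`, as an iterated integral. -/
noncomputable def flow : List (ℕ × ℂ) → ℝ → ℂ
  | [] => fun _ => 1
  | p :: L => tailInt^[p.1 + 1] fun u => geom (p.2 * (Real.exp (-u) : ℝ)) * flow L u

@[simp] theorem flow_nil (v : ℝ) : flow [] v = 1 := rfl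

theorem flow_cons_zero (x : ℂ) (L : List (ℕ × ℂ)) :
    flow ((0, x) :: L) = tailInt fun u => geom (x * (Real.exp (-u) : ℝ)) * flow L u := rfl

theorem flow_cons_succ (m : ℕ) (x : ℂ) (L : List (ℕ × ℂ)) :
    flow ((m + 1, x) :: L) = tailInt (flow ((m, x) :: L)) := by
  simp only [flow]
  rw [Function.iterate_succ_apply']

/-- Every entry `x` of the list lies outside of `[0, ∞)`. -/
def Slit (L : List (ℕ × ℂ)) : Prop := ∀ p ∈ L, -p.2 ∈ slitPlane

theorem slit_cons {p : ℕ × ℂ} {L : List (ℕ × ℂ)} : Slit (p :: L) ↔ -p.2 ∈ slitPlane ∧ Slit L := by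
  simp [Slit]

theorem slit_append {L L' : List (ℕ × ℂ)} : Slit (L ++ L') ↔ Slit L ∧ Slit L' := by
  simp [Slit, or_imp, forall_and]

theorem exists_common_bound (L : List (ℕ × ℂ)) (hL : Slit L) :
    ∃ A : ℝ, 1 ≤ A ∧ ∀ p ∈ L, ∀ r : ℝ, 0 < r → ‖geom (p.2 * r)‖ ≤ A := by
  induction L with
  | nil => exact ⟨1, le_rfl, by simp⟩
  | cons p L ih =>
    obtain ⟨hp, hL'⟩ := slit_cons.1 hL
    obtain ⟨A, hA, h⟩ := ih hL'
    obtain ⟨B, hB, h'⟩ := exists_norm_geom_le hp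
    refine ⟨max A B, le_max_of_le_left hA, ?_⟩
    intro q hq r hr
    rcases List.mem_cons.1 hq with rfl | hq
    · exact (h' r hr).1.trans (le_max_right _ _)
    · exact (h q hq r hr).trans (le_max_left _ _)

/-- Bound of `flow` by `e^{-v}`, uniform under scaling of the entries other than the last one. -/
theorem isTame_flow_append {L : List (ℕ × ℂ)} {m : ℕ} {x : ℂ} {A B : ℝ} (hA0 : 0 ≤ A)
    (hL : Slit L) (hx : -x ∈ slitPlane) (hA : ∀ p ∈ L, ∀ r : ℝ, 0 < r → ‖geom (p.2 * r)‖ ≤ A)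
    (hB : ∀ r : ℝ, 0 < r → ‖geom (x * r)‖ ≤ B * r) :
    IsTame (A ^ L.length * B) (flow (L ++ [(m, x)])) := by
  induction L with
  | nil =>
    refine IsTame.iterate_tailInt ⟨?_, ?_⟩ _
    · simpa [flow] using continuous_geom_mul_exp hx
    · intro u
      simpa [flow] using hB _ (Real.exp_pos (-u))
  | cons p L ih =>
    obtain ⟨hp, hL'⟩ := slit_cons.1 hL
    have ih' := ih hL' fun q hq => hA q (List.mem_cons_of_mem _ hq)
    refine IsTame.iterate_tailInt ⟨(continuous_geom_mul_exp hp).mul ih'.cont, ?_⟩ _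
    intro u
    rw [Pi.mul_apply, norm_mul, List.length_cons, pow_succ']
    calc _ ≤ A * (A ^ L.length * B * Real.exp (-u)) :=
          mul_le_mul (hA p (by simp) _ (Real.exp_pos _)) (ih'.bound u) (norm_nonneg _) hA0
      _ = _ := by ring

theorem exists_isTame_flow {L : List (ℕ × ℂ)} (hL : Slit L) (h0 : L ≠ []) :
    ∃ C, 0 ≤ C ∧ IsTame C (flow L) := by
  obtain ⟨L', p, rfl⟩ := (List.eq_nil_or_concat L).resolve_left h0
  rw [List.concat_eq_append] at *
  obtain ⟨hL', hp⟩ := slit_append.1 hL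
  obtain ⟨A, hA, h⟩ := exists_common_bound L' hL'
  obtain ⟨B, hB, h'⟩ := exists_norm_geom_le (hp p (by simp))
  exact ⟨_, by positivity, isTame_flow_append (by linarith) hL' (hp p (by simp)) h
    fun r hr => (h' r hr).2⟩

theorem exists_isTame_geom_mul_flow {x : ℂ} {L : List (ℕ × ℂ)} (hx : -x ∈ slitPlane)
    (hL : Slit L) :
    ∃ C, 0 ≤ C ∧ IsTame C fun u => geom (x * (Real.exp (-u) : ℝ)) * flow L u := by
  obtain ⟨B, hB, h'⟩ := exists_norm_geom_le hx
  rcases eq_or_ne L [] with rfl | h0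
  · refine ⟨B, hB, ?_, ?_⟩
    · simpa [flow] using continuous_geom_mul_exp hx
    · intro u
      simpa [flow] using (h' _ (Real.exp_pos (-u))).2
  · obtain ⟨C, hC, ht⟩ := exists_isTame_flow hL h0
    refine ⟨B * C, by positivity, (continuous_geom_mul_exp hx).mul ht.cont, ?_⟩
    intro u
    rw [norm_mul]
    calc _ ≤ B * (C * Real.exp (-u)) :=
          mul_le_mul (h' _ (Real.exp_pos (-u))).1 (ht.bound u) (norm_nonneg _) hB
      _ = _ := by ring

theorem hasDerivAt_flow_zero {x : ℂ} {L : List (ℕ × ℂ)} (hL : Slit ((0, x) :: L)) (v : ℝ) :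
    HasDerivAt (flow ((0, x) :: L)) (-(geom (x * (Real.exp (-v) : ℝ)) * flow L v)) v := by
  obtain ⟨hx, hL'⟩ := slit_cons.1 hL
  obtain ⟨C, -, hC⟩ := exists_isTame_geom_mul_flow hx hL'
  exact hC.hasDerivAt_tailInt v

theorem hasDerivAt_flow_succ {m : ℕ} {x : ℂ} {L : List (ℕ × ℂ)} (hL : Slit ((m + 1, x) :: L))
    (v : ℝ) : HasDerivAt (flow ((m + 1, x) :: L)) (-(flow ((m, x) :: L) v)) v := by
  have hL' : Slit ((m, x) :: L) := by simpa [slit_cons] using hL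
  obtain ⟨C, -, hC⟩ := exists_isTame_flow hL' (by simp)
  rw [flow_cons_succ]
  exact hC.hasDerivAt_tailInt v

/-- Multiplication of all entries by `e^{-s}`. -/
noncomputable def scaleList (s : ℝ) (L : List (ℕ × ℂ)) : List (ℕ × ℂ) :=
  L.map fun p => (p.1, p.2 * (Real.exp (-s) : ℝ))

/-- Scaling all entries by e^{-s} is translation of the integration variable by s, so the derivative
under common scaling is the derivative in the outermost integration limit. -/
theorem flow_scaleList (s : ℝ) (L : List (ℕ × ℂ)) (v : ℝ) :
    flow (scaleList s L) v = flow L (v + s) := by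
  induction L generalizing v with
  | nil => rfl
  | cons p L ih =>
    simp only [scaleList, List.map_cons, flow] at *
    rw [← iterate_tailInt_comp_add]
    refine congrFun (congrArg _ (funext fun u => ?_)) v
    rw [ih, mul_assoc, ← Complex.ofReal_mul, ← Real.exp_add]
    congr 5
    ring

end MPL

/-! ### Dependence of the iterated integral on its innermost entry. -/

namespace MPL

/-! ### Differentiation with respect to the last entry -/

theorem IsTame.mono {C C' : ℝ} {h : ℝ → ℂ} (hh : IsTame C h) (hC : C ≤ C') : IsTame C' h :=
  ⟨hh.cont, fun u => (hh.bound u).trans (by gcongr)⟩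

theorem IsTame.const_mul {C : ℝ} {h : ℝ → ℂ} (hh : IsTame C h) (c : ℂ) :
    IsTame (‖c‖ * C) fun u => c * h u :=
  ⟨hh.cont.const_mul c, fun u => by
    rw [norm_mul, mul_assoc]
    exact mul_le_mul_of_nonneg_left (hh.bound u) (norm_nonneg c)⟩

theorem IsTame.add {C C' : ℝ} {h h' : ℝ → ℂ} (hh : IsTame C h) (hh' : IsTame C' h') :
    IsTame (C + C') fun u => h u + h' u :=
  ⟨hh.cont.add hh'.cont, fun u => by
    rw [add_mul]
    exact (norm_add_le _ _).trans (add_le_add (hh.bound u) (hh'.bound u))⟩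

theorem IsTame.geom_mul {C A : ℝ} {h : ℝ → ℂ} (hh : IsTame C h) {x : ℂ} (hx : -x ∈ slitPlane)
    (hA : ∀ r : ℝ, 0 < r → ‖geom (x * r)‖ ≤ A) :
    IsTame (A * C) fun u => geom (x * (Real.exp (-u) : ℝ)) * h u :=
  ⟨(continuous_geom_mul_exp hx).mul hh.cont, fun u => by
    rw [norm_mul, mul_assoc]
    exact mul_le_mul (hA _ (Real.exp_pos _)) (hh.bound u) (norm_nonneg _)
      ((norm_nonneg _).trans (hA _ (Real.exp_pos (-u))))⟩

theorem hasDerivAt_iterate_tailInt_param {H H' : ℝ → ℝ → ℂ} {C : ℝ} {U : Set ℝ} (hU : IsOpen U)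
    (ht : ∀ t ∈ U, IsTame C (H t)) (ht' : ∀ t ∈ U, IsTame C (H' t))
    (hd : ∀ t ∈ U, ∀ u, HasDerivAt (fun t => H t u) (H' t u) t) (n : ℕ) :
    ∀ t ∈ U, ∀ v, HasDerivAt (fun t => tailInt^[n] (H t) v) (tailInt^[n] (H' t) v) t := by
  induction n with
  | zero => exact hd
  | succ n ih =>
    intro t htU v
    simp only [Function.iterate_succ_apply']
    exact hasDerivAt_tailInt_param (hU.mem_nhds htU)
      (fun t h => ((ht t h).iterate_tailInt n).cont)
      (fun t h => ((ht' t h).iterate_tailInt n).cont)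
      (fun t h => ((ht t h).iterate_tailInt n).bound)
      (fun t h => ((ht' t h).iterate_tailInt n).bound) ih

/-- Bound for the scaling of the last entry. -/
theorem exists_isTame_flow_last {L : List (ℕ × ℂ)} {x : ℂ} (hL : Slit L) (hx : -x ∈ slitPlane)
    (t₀ : ℝ) : ∃ C, 0 ≤ C ∧ ∀ m, ∀ t, t₀ < t →
      IsTame C (flow (L ++ [(m, x * (Real.exp (-t) : ℝ))])) := by
  obtain ⟨A, hA, h⟩ := exists_common_bound L hL
  obtain ⟨B, hB, h'⟩ := exists_norm_geom_le hx
  refine ⟨A ^ L.length * (B * Real.exp (-t₀)), by positivity, fun m t ht => ?_⟩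
  refine isTame_flow_append (by linarith) hL
    (neg_mul_real_mem_slitPlane hx (Real.exp_pos _)) h fun r hr => ?_
  have := (h' (Real.exp (-t) * r) (by positivity)).2
  rw [mul_assoc, ← Complex.ofReal_mul]
  refine this.trans ?_
  rw [mul_assoc]
  gcongr

theorem flow_singleton_scale (m : ℕ) (x : ℂ) (t v : ℝ) :
    flow [(m, x * (Real.exp (-t) : ℝ))] v = flow [(m, x)] (v + t) :=
  flow_scaleList t [(m, x)] v

/-- Induction step for differentiating in the innermost entry: the outer entry is fixed, so the
derivative passes under its integrals. Dominating functions are available only on half-lines in s,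
since the bound grows like e^{-s}; hence the restriction to t - 1 < s. -/
theorem hasDerivAt_flow_cons_param {L : List (ℕ × ℂ)} {x : ℂ} {p : ℕ × ℂ} {m : ℕ}
    {H' : ℝ → ℝ → ℂ} (hp : -p.2 ∈ slitPlane) (hL : Slit L) (hx : -x ∈ slitPlane) (t v : ℝ)
    (hH' : ∃ C, ∀ s, t - 1 < s → IsTame C (H' s))
    (hd : ∀ s u, HasDerivAt (fun s => flow (L ++ [(m, x * (Real.exp (-s) : ℝ))]) u) (H' s u) s) :
    HasDerivAt (fun t => flow ((p :: L) ++ [(m, x * (Real.exp (-t) : ℝ))]) v)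
      (tailInt^[p.1 + 1] (fun u => geom (p.2 * (Real.exp (-u) : ℝ)) * H' t u) v) t := by
  obtain ⟨C₀, hC₀, hC⟩ := exists_isTame_flow_last hL hx (t - 1)
  obtain ⟨C', hC'⟩ := hH'
  obtain ⟨A, hA, hA'⟩ := exists_norm_geom_le hp
  refine hasDerivAt_iterate_tailInt_param (U := Ioi (t - 1)) (C := A * max C₀ C')
    (H := fun s u => geom (p.2 * (Real.exp (-u) : ℝ)) *
      flow (L ++ [(m, x * (Real.exp (-s) : ℝ))]) u)
    (H' := fun s u => geom (p.2 * (Real.exp (-u) : ℝ)) * H' s u)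
    isOpen_Ioi ?_ ?_ ?_ _ t (by simp) v
  · intro s hs
    exact ((hC m s hs).mono (le_max_left _ _)).geom_mul hp fun r hr => (hA' r hr).1
  · intro s hs
    exact ((hC' s hs).mono (le_max_right _ _)).geom_mul hp fun r hr => (hA' r hr).1
  · intro s _ u
    exact (hd s u).const_mul _

theorem hasDerivAt_flow_last_succ {L : List (ℕ × ℂ)} {m : ℕ} {x : ℂ} (hL : Slit L)
    (hx : -x ∈ slitPlane) (t v : ℝ) :
    HasDerivAt (fun t => flow (L ++ [(m + 1, x * (Real.exp (-t) : ℝ))]) v)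
      (-(flow (L ++ [(m, x * (Real.exp (-t) : ℝ))]) v)) t := by
  induction L generalizing t v with
  | nil =>
    simp only [List.nil_append, flow_singleton_scale]
    exact (hasDerivAt_flow_succ (m := m) (L := []) (by simpa [slit_cons, Slit] using hx)
      (v + t)).comp_const_add v t
  | cons p L ih =>
    obtain ⟨hp, hL'⟩ := slit_cons.1 hL
    have := hasDerivAt_flow_cons_param (m := m + 1)
      (H' := fun t u => -(flow (L ++ [(m, x * (Real.exp (-t) : ℝ))]) u)) hp hL' hx t v ?_ (ih hL')
    · convert! this using 1
      have h2 := iterate_tailInt_const_mul (-1) (fun u => geom (p.2 * (Real.exp (-u) : ℝ)) *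
        flow (L ++ [(m, x * (Real.exp (-t) : ℝ))]) u) (p.1 + 1)
      have h3 := congrFun h2 v
      simp only [neg_one_mul] at h3
      simp only [List.cons_append, flow, mul_neg]
      exact h3.symm
    · obtain ⟨C, hC, h⟩ := exists_isTame_flow_last hL' hx (t - 1)
      exact ⟨_, fun s hs => by simpa using (h m s hs).const_mul (-1)⟩

theorem hasDerivAt_flow_singleton_zero {x : ℂ} (hx : -x ∈ slitPlane) (t v : ℝ) :
    HasDerivAt (fun t => flow [(0, x * (Real.exp (-t) : ℝ))] v)
      (-(geom (x * (Real.exp (-t) : ℝ) * (Real.exp (-v) : ℝ)))) t := by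
  simp only [flow_singleton_scale]
  have := (hasDerivAt_flow_zero (x := x) (L := []) (by simpa [slit_cons, Slit] using hx)
      (v + t)).comp_const_add v t
  convert! this using 1
  rw [flow_nil, mul_one, mul_assoc, ← Complex.ofReal_mul, ← Real.exp_add]
  congr 5
  ring

/-- Differentiation removes the innermost integral and leaves a product of two `geom` factors, for x
and for y, under the next one. `geom_mul_geom` splits it into one term with y and one with x in the
place of y; the coefficients do not involve u and come out of all outer integrals. -/
theorem hasDerivAt_flow_last_zero {L : List (ℕ × ℂ)} {m : ℕ} {x y : ℂ} (hL : Slit L)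
    (hx : -x ∈ slitPlane) (hy : -y ∈ slitPlane) (hxy : -(x / y) ∈ slitPlane) (t v : ℝ) :
    HasDerivAt (fun t => flow (L ++ [(m, y), (0, x * (Real.exp (-t) : ℝ))]) v)
      (-(geom (x * (Real.exp (-t) : ℝ) / y)) * flow (L ++ [(m, y)]) v +
        (1 + geom (x * (Real.exp (-t) : ℝ) / y)) *
          flow (L ++ [(m, x * (Real.exp (-t) : ℝ))]) v) t := by
  have hslit : ∀ s : ℝ, -(x * (Real.exp (-s) : ℝ)) ∈ slitPlane := fun s =>
    neg_mul_real_mem_slitPlane hx (Real.exp_pos _)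
  have hslit' : ∀ s : ℝ, -(x * (Real.exp (-s) : ℝ) / y) ∈ slitPlane := fun s => by
    rw [mul_div_right_comm]
    exact neg_mul_real_mem_slitPlane hxy (Real.exp_pos _)
  obtain ⟨A, hA, hA'⟩ := exists_norm_geom_le hxy
  have hg : ∀ s : ℝ, ‖geom (x * (Real.exp (-s) : ℝ) / y)‖ ≤ A := fun s => by
    rw [mul_div_right_comm]
    exact (hA' _ (Real.exp_pos _)).1
  induction L generalizing t v with
  | nil =>
    obtain ⟨A₁, hA₁, hA₁'⟩ := exists_norm_geom_le hx
    have := hasDerivAt_flow_cons_param (m := 0) (p := (m, y)) (L := [])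
      (H' := fun t u => -(geom (x * (Real.exp (-t) : ℝ) * (Real.exp (-u) : ℝ)))) hy
      (by simp [Slit]) hx t v ?_ (hasDerivAt_flow_singleton_zero hx)
    · convert! this using 1
      obtain ⟨C₁, -, h₁⟩ := exists_isTame_geom_mul_flow (L := []) hy (by simp [Slit])
      obtain ⟨C₂, -, h₂⟩ := exists_isTame_geom_mul_flow (L := []) (hslit t) (by simp [Slit])
      have h3 := congrFun ((h₁.const_mul (-(geom (x * (Real.exp (-t) : ℝ) / y)))).iterate_tailInt_add
        (h₂.const_mul (1 + (geom (x * (Real.exp (-t) : ℝ) / y)))) (m + 1)) v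
      simp only [iterate_tailInt_const_mul, flow] at h3
      simp only [List.nil_append, flow]
      rw [← h3]
      refine congrFun (congrArg _ (funext fun u => ?_)) v
      have h4 := geom_mul_geom (neg_mul_real_mem_slitPlane (hslit t) (Real.exp_pos (-u)))
        (neg_mul_real_mem_slitPlane hy (Real.exp_pos (-u))) (by
          rw [mul_div_mul_right _ _ (Complex.ofReal_ne_zero.2 (Real.exp_pos (-u)).ne')]
          exact hslit' t)
      rw [mul_div_mul_right _ _ (Complex.ofReal_ne_zero.2 (Real.exp_pos (-u)).ne')] at h4
      simp only [mul_one]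
      linear_combination h4
    · refine ⟨A₁ * Real.exp (-(t - 1)), fun s hs => ⟨(continuous_geom_mul_exp (hslit s)).neg, ?_⟩⟩
      intro u
      rw [norm_neg, mul_assoc, ← Complex.ofReal_mul]
      refine (hA₁' _ (by positivity)).2.trans ?_
      rw [mul_assoc]
      gcongr
  | cons p L ih =>
    obtain ⟨hp, hL'⟩ := slit_cons.1 hL
    obtain ⟨C, hC, h⟩ := exists_isTame_flow_last hL' hx (t - 1)
    obtain ⟨C₁, hC₁, h₁⟩ := exists_isTame_flow (L := L ++ [(m, y)])
      (slit_append.2 ⟨hL', by simpa [slit_cons, Slit] using hy⟩) (by simp)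
    have hL2 : Slit (L ++ [(m, y)]) := slit_append.2 ⟨hL', by simpa [slit_cons, Slit] using hy⟩
    have := hasDerivAt_flow_cons_param (m := 0) (L := L ++ [(m, y)])
      (H' := fun t v => -(geom (x * (Real.exp (-t) : ℝ) / y)) * flow (L ++ [(m, y)]) v +
        (1 + geom (x * (Real.exp (-t) : ℝ) / y)) *
          flow (L ++ [(m, x * (Real.exp (-t) : ℝ))]) v) hp hL2 hx t v ?_
      (by simpa only [List.append_assoc, List.cons_append, List.nil_append] using ih hL')
    · simp only [List.append_assoc, List.cons_append, List.nil_append] at this ⊢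
      convert! this using 1
      obtain ⟨B, -, hB⟩ := exists_norm_geom_le hp
      have t₁ := h₁.geom_mul hp fun r hr => (hB r hr).1
      have t₂ := (h m t (by linarith)).geom_mul hp fun r hr => (hB r hr).1
      have h3 := congrFun ((t₁.const_mul (-(geom (x * (Real.exp (-t) : ℝ) / y)))).iterate_tailInt_add
        (t₂.const_mul (1 + (geom (x * (Real.exp (-t) : ℝ) / y)))) (p.1 + 1)) v
      simp only [iterate_tailInt_const_mul] at h3
      simp only [flow]
      rw [← h3]
      refine congrFun (congrArg _ (funext fun u => ?_)) v
      ring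
    · refine ⟨A * C₁ + (1 + A) * C, fun s hs => ?_⟩
      refine ((h₁.const_mul _).add ((h m s hs).const_mul _)).mono ?_
      gcongr
      · simpa using hg s
      · exact (norm_add_le _ _).trans (by simpa using hg s)

/-! ### Limit for large arguments -/

theorem tendsto_iterate_tailInt {H : ℝ → ℝ → ℂ} {h : ℝ → ℂ} {C : ℝ} {l : Filter ℝ}
    [l.IsCountablyGenerated] (hH : ∀ s, IsTame C (H s))
    (hl : ∀ u, Tendsto (fun s => H s u) l (𝓝 (h u))) (n : ℕ) (v : ℝ) :
    Tendsto (fun s => tailInt^[n] (H s) v) l (𝓝 (tailInt^[n] h v)) := by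
  induction n generalizing v with
  | zero => exact hl v
  | succ n ih =>
    simp only [Function.iterate_succ_apply']
    exact tendsto_integral_filter_of_dominated_convergence (fun u => C * Real.exp (-u))
      (Eventually.of_forall fun s => ((hH s).iterate_tailInt n).cont.aestronglyMeasurable)
      (Eventually.of_forall fun s => Eventually.of_forall ((hH s).iterate_tailInt n).bound)
      (integrableOn_const_mul_exp_neg C v) (Eventually.of_forall fun u => ih u)

theorem tendsto_geom_mul_exp_atTop {x : ℂ} (hx : -x ∈ slitPlane) :
    Tendsto (fun s : ℝ => geom (x * (Real.exp s : ℝ))) atTop (𝓝 (-1)) := by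
  obtain ⟨A, hA, h⟩ := exists_norm_geom_le (neg_inv_mem_slitPlane hx)
  have h1 : ∀ s : ℝ, geom (x * (Real.exp s : ℝ)) = -1 - geom (x⁻¹ * (Real.exp (-s) : ℝ)) := by
    intro s
    have := geom_inv (neg_mul_real_mem_slitPlane hx (Real.exp_pos s))
    rw [mul_inv, ← Complex.ofReal_inv, ← Real.exp_neg] at this
    rw [this]; ring
  have h2 : Tendsto (fun s : ℝ => geom (x⁻¹ * (Real.exp (-s) : ℝ))) atTop (𝓝 0) := by
    refine squeeze_zero_norm (fun s => (h _ (Real.exp_pos (-s))).2) ?_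
    simpa using (Real.tendsto_exp_neg_atTop_nhds_zero).const_mul A
  simp only [h1]
  simpa using h2.const_sub (-1)

/-- The sum of the indices `n_i = m_i + 1`. -/
def wt {α : Type*} (L : List (ℕ × α)) : ℕ := (L.map fun p => p.1 + 1).sum

@[simp] theorem wt_nil {α : Type*} : wt ([] : List (ℕ × α)) = 0 := rfl

@[simp] theorem wt_cons {α : Type*} (p : ℕ × α) (L : List (ℕ × α)) :
    wt (p :: L) = p.1 + 1 + wt L := by simp [wt]

@[simp] theorem wt_append {α : Type*} (L L' : List (ℕ × α)) :
    wt (L ++ L') = wt L + wt L' := by simp [wt]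

theorem iterate_tailInt_flow_singleton (m n : ℕ) (x : ℂ) :
    tailInt^[n] (flow [(m, x)]) = flow [(m + n, x)] := by
  simp only [flow]
  rw [← Function.iterate_add_apply, show n + (m + 1) = m + n + 1 by ring]

theorem slit_scaleList {L : List (ℕ × ℂ)} (hL : Slit L) (s : ℝ) : Slit (scaleList s L) := by
  intro p hp
  obtain ⟨q, hq, rfl⟩ := List.mem_map.1 hp
  exact neg_mul_real_mem_slitPlane (hL q hq) (Real.exp_pos _)

theorem length_scaleList (s : ℝ) (L : List (ℕ × ℂ)) : (scaleList s L).length = L.length := by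
  simp [scaleList]

/-- When the outer entries tend to ∞, each of their `geom` factors tends to -1 and only the
integrations remain; these pile up on the innermost entry and add their weights. The bounds are
unaffected by the scaling, so convergence is dominated. -/
theorem tendsto_flow_scale {L : List (ℕ × ℂ)} (hL : Slit L) {m : ℕ} {x : ℂ}
    (hx : -x ∈ slitPlane) (v : ℝ) :
    Tendsto (fun s => flow (scaleList (-s) L ++ [(m, x)]) v) atTop
      (𝓝 ((-1) ^ L.length * flow [(m + wt L, x)] v)) := by
  obtain ⟨A, hA, h⟩ := exists_common_bound L hL
  obtain ⟨B, hB, h'⟩ := exists_norm_geom_le hx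
  induction L generalizing v with
  | nil => simp [scaleList]
  | cons p L ih =>
    obtain ⟨hp, hL'⟩ := slit_cons.1 hL
    have ih' := ih hL' (h := fun q hq => h q (List.mem_cons_of_mem _ hq))
    have hscale : ∀ s, ∀ q ∈ scaleList s L, ∀ r : ℝ, 0 < r → ‖geom (q.2 * r)‖ ≤ A := by
      intro s q hq r hr
      obtain ⟨q', hq', rfl⟩ := List.mem_map.1 hq
      rw [mul_assoc, ← Complex.ofReal_mul]
      exact h q' (List.mem_cons_of_mem _ hq') _ (by positivity)
    have ht : ∀ s, IsTame (A * (A ^ L.length * B))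
        fun u => geom (p.2 * (Real.exp s : ℝ) * (Real.exp (-u) : ℝ)) *
          flow (scaleList (-s) L ++ [(m, x)]) u := by
      intro s
      have := isTame_flow_append (m := m) (by linarith) (slit_scaleList hL' (-s)) hx (hscale (-s))
        fun r hr => (h' r hr).2
      rw [length_scaleList] at this
      refine this.geom_mul (neg_mul_real_mem_slitPlane hp (Real.exp_pos _)) fun r hr => ?_
      rw [mul_assoc, ← Complex.ofReal_mul]
      exact h p (by simp) _ (by positivity)
    have hlim : ∀ u, Tendsto (fun s => geom (p.2 * (Real.exp s : ℝ) * (Real.exp (-u) : ℝ)) *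
          flow (scaleList (-s) L ++ [(m, x)]) u) atTop
        (𝓝 (-1 * ((-1) ^ L.length * flow [(m + wt L, x)] u))) := by
      intro u
      refine Tendsto.mul ?_ (ih' u)
      have := (tendsto_geom_mul_exp_atTop hp).comp (tendsto_atTop_add_const_right atTop (-u)
        tendsto_id)
      refine this.congr fun s => ?_
      simp only [Function.comp, id, Real.exp_add, Complex.ofReal_mul, mul_assoc]
    have := tendsto_iterate_tailInt ht hlim (p.1 + 1) v
    convert this using 2
    · simp [scaleList, flow]
    · rw [iterate_tailInt_const_mul, iterate_tailInt_const_mul, iterate_tailInt_flow_singleton,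
        List.length_cons, wt_cons, pow_succ',
        show m + wt L + (p.1 + 1) = m + (p.1 + 1 + wt L) by ring]
      ring

end MPL

/-! ### Depth one: power series, Bernoulli functions and inversion. -/

namespace MPL

/-! ### Series expansions -/

theorem integral_norm_exp_Ioi (c : ℂ) {e : ℕ} (he : 0 < e) (v : ℝ) :
    ∫ u in Ioi v, ‖c * (Real.exp (-(e * u)) : ℝ)‖ = ‖c‖ / e * Real.exp (-(e * v)) := by
  have he' : (-(e : ℝ)) < 0 := by simpa using he
  have := integral_exp_mul_Ioi he' v
  simp only [norm_mul, Complex.norm_real, Real.norm_of_nonneg (Real.exp_pos _).le,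
    integral_const_mul, ← neg_mul]
  rw [this]
  have : (e : ℝ) ≠ 0 := by positivity
  field_simp

theorem integrableOn_exp_Ioi (c : ℂ) {e : ℕ} (he : 0 < e) (v : ℝ) :
    IntegrableOn (fun u : ℝ => c * (Real.exp (-(e * u)) : ℝ)) (Ioi v) := by
  have he' : (-(e : ℝ)) < 0 := by simpa using he
  have := integrableOn_exp_mul_Ioi he' v
  refine Integrable.const_mul ?_ c
  simp only [neg_mul] at this
  exact this.ofReal

theorem tailInt_exp (c : ℂ) {e : ℕ} (he : 0 < e) (v : ℝ) :
    tailInt (fun u => c * (Real.exp (-(e * u)) : ℝ)) v = c / e * (Real.exp (-(e * v)) : ℝ) := by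
  have he' : (-(e : ℝ)) < 0 := by simpa using he
  have := integral_exp_mul_Ioi he' v
  simp only [neg_mul] at this
  rw [tailInt, integral_const_mul, integral_complex_ofReal, this]
  have : (e : ℂ) ≠ 0 := by exact_mod_cast he.ne'
  push_cast
  field_simp

theorem hasSum_tailInt {ι : Type*} [Countable ι] {c : ι → ℂ} {e : ι → ℕ} {h : ℝ → ℂ} {v : ℝ}
    (he : ∀ i, 0 < e i) (hs : Summable fun i => ‖c i‖ / e i * Real.exp (-(e i * v)))
    (hh : ∀ u, v < u → HasSum (fun i => c i * (Real.exp (-(e i * u)) : ℝ)) (h u)) :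
    HasSum (fun i => c i / e i * (Real.exp (-(e i * v)) : ℝ)) (tailInt h v) := by
  have := hasSum_integral_of_summable_integral_norm (μ := volume.restrict (Ioi v))
    (F := fun i u => c i * (Real.exp (-(e i * u)) : ℝ))
    (fun i => integrableOn_exp_Ioi (c i) (he i) v)
    (by simpa only [integral_norm_exp_Ioi _ (he _)] using hs)
  have h2 : ∫ u in Ioi v, ∑' i, c i * (Real.exp (-(e i * u)) : ℝ) = tailInt h v :=
    setIntegral_congr_fun measurableSet_Ioi fun u hu => (hh u hu).tsum_eq
  rw [h2] at this
  convert! this using 1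
  funext i
  exact (tailInt_exp (c i) (he i) v).symm

theorem hasSum_geom {x : ℂ} (hx : ‖x‖ < 1) : HasSum (fun k : ℕ => x ^ (k + 1)) (geom x) := by
  have := (hasSum_geometric_of_norm_lt_one hx).mul_left x
  simpa [pow_succ', geom, div_eq_mul_inv] using this

/-- For v > 0 the exponential gives absolute convergence. At v = 0 and |x| = 1, the case needed for
Fourier series, the weight must be at least 2. -/
theorem hasSum_flow_singleton {x : ℂ} (hx : ‖x‖ ≤ 1) (m : ℕ) (v : ℝ)
    (hv : 0 < v ∨ 0 ≤ v ∧ 1 ≤ m) :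
    HasSum (fun k : ℕ => x ^ (k + 1) / ((k + 1 : ℕ) : ℂ) ^ (m + 1) *
      (Real.exp (-((k + 1 : ℕ) * v)) : ℝ)) (flow [(m, x)] v) := by
  have hpow : ∀ k : ℕ, ‖x ^ k‖ ≤ 1 := fun k => by
    rw [norm_pow]; exact pow_le_one₀ (norm_nonneg x) hx
  induction m generalizing v with
  | zero =>
    have hv : 0 < v := by simpa using hv
    rw [flow_cons_zero]
    have := hasSum_tailInt (c := fun k : ℕ => x ^ (k + 1)) (e := fun k => k + 1)
      (h := fun u => geom (x * (Real.exp (-u) : ℝ)) * flow [] u) (v := v) (by simp) ?_ ?_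
    · simpa using this
    · refine Summable.of_nonneg_of_le (fun k => by positivity) (fun k => ?_)
        (f := fun k : ℕ => Real.exp (-v) ^ (k + 1)) ?_
      · rw [← Real.exp_nat_mul]
        calc ‖x ^ (k + 1)‖ / ((k + 1 : ℕ) : ℝ) * Real.exp (-((k + 1 : ℕ) * v))
            ≤ 1 / 1 * Real.exp (-((k + 1 : ℕ) * v)) := by
              gcongr
              · exact hpow _
              · simp
          _ = _ := by rw [div_one, one_mul, mul_neg]
      · exact (summable_nat_add_iff 1).2 (summable_geometric_of_lt_one (Real.exp_pos _).le
          ((by rw [← Real.exp_zero]; exact Real.exp_lt_exp.2 (by linarith))))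
    · intro u hu
      have h1 : ‖x * (Real.exp (-u) : ℝ)‖ < 1 := by
        rw [norm_mul, Complex.norm_real, Real.norm_of_nonneg (Real.exp_pos _).le]
        have : Real.exp (-u) < 1 := (by rw [← Real.exp_zero]; exact Real.exp_lt_exp.2 (by linarith))
        nlinarith [Real.exp_pos (-u), norm_nonneg x]
      have := hasSum_geom h1
      simp only [flow_nil, mul_one]
      convert! this using 2 with k
      rw [mul_pow, ← Complex.ofReal_pow, ← Real.exp_nat_mul, mul_neg]
  | succ m ih =>
    have hv : 0 ≤ v := hv.elim le_of_lt And.left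
    rw [flow_cons_succ]
    have := hasSum_tailInt (c := fun k : ℕ => x ^ (k + 1) / ((k + 1 : ℕ) : ℂ) ^ (m + 1))
      (e := fun k => k + 1) (h := flow [(m, x)]) (v := v) (by simp) ?_ ?_
    · convert! this using 2 with k
      rw [div_div, ← pow_succ]
    · refine Summable.of_nonneg_of_le (fun k => by positivity) (fun k => ?_)
        (f := fun k : ℕ => 1 / ((k + 1 : ℕ) : ℝ) ^ 2) ?_
      · rw [norm_div, norm_pow _ (m + 1), Complex.norm_natCast, div_div, ← pow_succ]
        have h1 : (1 : ℝ) ≤ ((k + 1 : ℕ) : ℝ) := by simp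
        calc _ ≤ 1 / ((k + 1 : ℕ) : ℝ) ^ 2 * 1 := by
              gcongr
              · exact hpow _
              · omega
              · exact Real.exp_le_one_iff.2 (by nlinarith)
          _ = _ := mul_one _
      · exact (summable_nat_add_iff (f := fun k : ℕ => 1 / (k : ℝ) ^ 2) 1).2
          (Real.summable_one_div_nat_pow.2 one_lt_two)
    · intro u hu
      exact ih u (Or.inl (by linarith))

/-! ### The Bernoulli functions -/

@[simp] theorem beta_zero (z : ℂ) : beta 0 z = 1 := by simp [beta]

theorem log_neg_mul_exp {x : ℂ} (hx : -x ∈ slitPlane) (v : ℝ) :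
    Complex.log (-(x * (Real.exp (-v) : ℝ))) = Complex.log (-x) - v := by
  rw [← neg_mul, mul_comm, Complex.log_ofReal_mul (Real.exp_pos _)
    (neg_ne_zero.2 (ne_zero_of_neg_mem_slitPlane hx)), Real.log_exp]
  push_cast
  ring

/-- Along the scaling, log(-x) moves linearly without meeting the cut, and B_{k+1}' = (k+1) B_k.
Thus β_{k+1} ↦ β_k matches the lowering of the weight of polylogarithms. -/
theorem hasDerivAt_beta {x : ℂ} (hx : -x ∈ slitPlane) (k : ℕ) (v : ℝ) :
    HasDerivAt (fun v : ℝ => beta (k + 1) (x * (Real.exp (-v) : ℝ)))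
      (-(beta k (x * (Real.exp (-v) : ℝ)))) v := by
  simp only [beta, log_neg_mul_exp hx]
  have hpi : (2 * (Real.pi : ℂ) * Complex.I) ≠ 0 := Complex.two_pi_I_ne_zero
  set c := 2 * (Real.pi : ℂ) * Complex.I
  have h1 : HasDerivAt (fun v : ℝ => 1 / 2 + (Complex.log (-x) - v) / c) (-1 / c) v := by
    have := (((hasDerivAt_id v).ofReal_comp.const_sub (Complex.log (-x))).div_const c).const_add
      (1 / 2)
    simpa using this
  have h2 := ((Polynomial.bernoulli (k + 1)).hasDerivAt_aeval
    (1 / 2 + (Complex.log (-x) - v) / c)).comp v h1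
  have h3 := h2.const_mul (c ^ (k + 1) / ((k + 1).factorial : ℂ))
  convert! h3 using 1
  rw [Polynomial.derivative_bernoulli_add_one, Nat.factorial_succ]
  have : ((k.factorial : ℕ) : ℂ) ≠ 0 := by exact_mod_cast k.factorial_ne_zero
  have h4 : ((k : ℂ) + 1) ≠ 0 := by exact_mod_cast k.succ_ne_zero
  simp only [map_mul, map_add, map_natCast, map_one]
  push_cast
  rw [pow_succ]
  field_simp

/-- Polynomial growth is weakened to e^{|v|/4}. The exponent is small enough for later products with
e^{-s} or e^v to keep half of their decay. -/
theorem exists_norm_polynomial_le (p : Polynomial ℂ) (c : ℂ) :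
    ∃ C, 0 ≤ C ∧ ∀ v : ℝ, ‖p.eval (c * v)‖ ≤ C * Real.exp (|v| / 4) := by
  induction p using Polynomial.induction_on' with
  | add p q hp hq =>
    obtain ⟨C, hC, h⟩ := hp
    obtain ⟨C', hC', h'⟩ := hq
    refine ⟨C + C', by positivity, fun v => ?_⟩
    rw [Polynomial.eval_add, add_mul]
    exact (norm_add_le _ _).trans (add_le_add (h v) (h' v))
  | monomial n a =>
    refine ⟨‖a‖ * (‖c‖ ^ n * (4 ^ n * n.factorial)), by positivity, fun v => ?_⟩
    rw [Polynomial.eval_monomial, norm_mul, norm_pow, norm_mul, Complex.norm_real,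
      Real.norm_eq_abs, mul_pow]
    have := Real.pow_div_factorial_le_exp (|v| / 4) (by positivity) n
    rw [div_pow, div_div, div_le_iff₀ (by positivity)] at this
    calc _ ≤ ‖a‖ * (‖c‖ ^ n * (Real.exp (|v| / 4) * (4 ^ n * n.factorial))) := by gcongr
      _ = _ := by ring

theorem exists_norm_beta_le {x : ℂ} (hx : -x ∈ slitPlane) (k : ℕ) :
    ∃ C, 0 ≤ C ∧ ∀ v : ℝ, ‖beta k (x * (Real.exp (-v) : ℝ))‖ ≤ C * Real.exp (|v| / 4) := by
  simp only [beta, log_neg_mul_exp hx]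
  set c := 2 * (Real.pi : ℂ) * Complex.I
  obtain ⟨C, hC, h⟩ := exists_norm_polynomial_le
    (((Polynomial.bernoulli k).map (algebraMap ℚ ℂ)).comp
      (Polynomial.C (1 / 2 + Complex.log (-x) / c) + Polynomial.X)) (-1 / c)
  refine ⟨‖c ^ k / (k.factorial : ℂ)‖ * C, by positivity, fun v => ?_⟩
  rw [norm_mul, mul_assoc]
  gcongr
  have h1 := h v
  rw [Polynomial.eval_comp, Polynomial.eval_map_algebraMap] at h1
  simp only [Polynomial.eval_add, Polynomial.eval_C, Polynomial.eval_X] at h1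
  rw [show 1 / 2 + (Complex.log (-x) - v) / c = 1 / 2 + Complex.log (-x) / c + -1 / c * v by ring]
  exact h1

/-! ### The inversion relation in depth one -/

theorem one_sub_mem_slitPlane {x : ℂ} (hx : -x ∈ slitPlane) : 1 - x ∈ slitPlane := by
  rw [Complex.mem_slitPlane_iff] at *
  simp at hx ⊢
  rcases hx with h | h
  · left; linarith
  · right; exact h

theorem flow_zero_eq_log {x : ℂ} (hx : -x ∈ slitPlane) : flow [(0, x)] 0 = -Complex.log (1 - x) := by
  have hs : ∀ u : ℝ, 1 - x * (Real.exp (-u) : ℝ) ∈ slitPlane := fun u =>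
    one_sub_mem_slitPlane (neg_mul_real_mem_slitPlane hx (Real.exp_pos _))
  obtain ⟨C, -, hC⟩ := exists_isTame_geom_mul_flow (L := []) hx (by simp [Slit])
  have h1 := integral_Ioi_of_hasDerivAt_of_tendsto' (a := 0)
    (f := fun u : ℝ => Complex.log (1 - x * (Real.exp (-u) : ℝ)))
    (f' := fun u : ℝ => geom (x * (Real.exp (-u) : ℝ)) * flow [] u) (m := 0) ?_
    (hC.integrableOn 0) ?_
  · rw [flow_cons_zero, tailInt, h1]
    simp
  · intro u _
    have h2 : HasDerivAt (fun u : ℝ => 1 - x * ((Real.exp (-u) : ℝ) : ℂ))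
        (x * (Real.exp (-u) : ℝ)) u := by
      have := (((hasDerivAt_neg u).exp.ofReal_comp).const_mul x).const_sub 1
      convert! this using 1
      push_cast
      ring
    convert! h2.clog_real (hs u) using 1
    simp [geom]
  · have h3 : Tendsto (fun u : ℝ => 1 - x * ((Real.exp (-u) : ℝ) : ℂ)) atTop (𝓝 (1 - x * (0 : ℝ))) :=
      (((Complex.continuous_ofReal.tendsto 0).comp
        Real.tendsto_exp_neg_atTop_nhds_zero).const_mul x).const_sub 1
    have := h3.clog (by simp)
    simpa using this

/-- The imaginary part of 1 - 1/x has the sign of Im x and that of -x the opposite sign, so the two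
arguments add up within (-π, π] and the principal logarithms add. For real x both arguments vanish,
as x < 0. -/
theorem log_inversion {x : ℂ} (hx : -x ∈ slitPlane) :
    Complex.log (1 - x) = Complex.log (1 - x⁻¹) + Complex.log (-x) := by
  have h0 := ne_zero_of_neg_mem_slitPlane hx
  have h1 := one_sub_ne_zero_of_neg_mem_slitPlane (neg_inv_mem_slitPlane hx)
  have h2 : 1 - x = (1 - x⁻¹) * (-x) := by field_simp; ring
  rw [h2, Complex.log_mul_eq_add_log_iff h1 (neg_ne_zero.2 h0)]
  have hsq : 0 < Complex.normSq x := Complex.normSq_pos.2 h0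
  have him : (1 - x⁻¹).im = x.im / Complex.normSq x := by simp [Complex.inv_im, neg_div]
  have b1 := Complex.neg_pi_lt_arg (1 - x⁻¹)
  have b2 := Complex.arg_le_pi (1 - x⁻¹)
  have b3 := Complex.neg_pi_lt_arg (-x)
  have b4 := Complex.arg_le_pi (-x)
  rcases lt_trichotomy x.im 0 with h | h | h
  · have c1 : Complex.arg (1 - x⁻¹) < 0 := Complex.arg_neg_iff.2 (by
      rw [him]; exact div_neg_of_neg_of_pos h hsq)
    have c2 : 0 ≤ Complex.arg (-x) := Complex.arg_nonneg_iff.2 (by simp; exact h.le)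
    constructor <;> linarith
  · have hre : x.re < 0 := by
      rw [Complex.mem_slitPlane_iff] at hx
      simpa [h] using hx
    have c1 : Complex.arg (-x) = 0 := Complex.arg_eq_zero_iff.2 (by simp [h, hre.le])
    have c2 : Complex.arg (1 - x⁻¹) = 0 := by
      refine Complex.arg_eq_zero_iff.2 ⟨?_, by rw [him, h]; simp⟩
      simp only [Complex.sub_re, Complex.one_re, Complex.inv_re]
      have : x.re / Complex.normSq x < 0 := div_neg_of_neg_of_pos hre hsq
      linarith
    rw [c1, c2]
    constructor <;> linarith [Real.pi_pos]
  · have c1 : 0 ≤ Complex.arg (1 - x⁻¹) := Complex.arg_nonneg_iff.2 (by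
      rw [him]; positivity)
    have c2 : Complex.arg (-x) < 0 := Complex.arg_neg_iff.2 (by simpa using h)
    constructor <;> linarith

theorem flow_inversion_zero {x : ℂ} (hx : -x ∈ slitPlane) :
    flow [(0, x)] 0 + beta 1 x = flow [(0, x⁻¹)] 0 := by
  rw [flow_zero_eq_log hx, flow_zero_eq_log (neg_inv_mem_slitPlane hx), log_inversion hx]
  have hpi : (2 * (Real.pi : ℂ) * Complex.I) ≠ 0 := Complex.two_pi_I_ne_zero
  simp only [beta, Polynomial.bernoulli_one]
  simp
  field_simp
  ring

/-- On the unit circle this is the Fourier expansion of the Bernoulli polynomial: x = e^{2πiθ} with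
θ = 1/2 + arg(-x)/(2π) in [0, 1], which is the argument of B in β. The index m + 2 ≥ 2 ensures
absolute convergence. -/
theorem flow_inversion_of_norm_eq_one {x : ℂ} (hx : -x ∈ slitPlane) (h1 : ‖x‖ = 1) (m : ℕ) :
    flow [(m + 1, x)] 0 + beta (m + 2) x = (-1) ^ (m + 1) * flow [(m + 1, x⁻¹)] 0 := by
  have hpi : (2 * (Real.pi : ℂ) * Complex.I) ≠ 0 := Complex.two_pi_I_ne_zero
  have h1' : ‖x⁻¹‖ = 1 := by rw [norm_inv, h1, inv_one]
  have s1 := hasSum_flow_singleton h1.le (m + 1) 0 (Or.inr ⟨le_rfl, by omega⟩)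
  have s2 := hasSum_flow_singleton h1'.le (m + 1) 0 (Or.inr ⟨le_rfl, by omega⟩)
  have h0 : -x ≠ 0 := neg_ne_zero.2 (ne_zero_of_neg_mem_slitPlane hx)
  set θ : ℝ := 1 / 2 + (-x).arg / (2 * Real.pi) with hθ
  have hπ := Real.pi_pos
  have hθ' : θ ∈ Icc (0 : ℝ) 1 := by
    have b1 := Complex.neg_pi_lt_arg (-x)
    have b2 := Complex.arg_le_pi (-x)
    rw [hθ]
    constructor
    · have : -(1 / 2) ≤ (-x).arg / (2 * Real.pi) := by
        rw [le_div_iff₀ (by positivity)]; linarith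
      linarith
    · have : (-x).arg / (2 * Real.pi) ≤ 1 / 2 := by
        rw [div_le_iff₀ (by positivity)]; linarith
      linarith
  have hlog : Complex.log (-x) = (-x).arg * Complex.I := by
    rw [Complex.log, norm_neg, h1]; simp
  have hθx : 1 / 2 + Complex.log (-x) / (2 * (Real.pi : ℂ) * Complex.I) = (θ : ℂ) := by
    rw [hlog, hθ]
    push_cast
    have : (Real.pi : ℂ) ≠ 0 := by exact_mod_cast hπ.ne'
    have := Complex.I_ne_zero
    field_simp
  have hexp : Complex.exp (2 * Real.pi * Complex.I * θ) = x := by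
    rw [← hθx, mul_add, mul_div_cancel₀ _ hpi, Complex.exp_add, Complex.exp_log h0]
    have : Complex.exp (2 * Real.pi * Complex.I * (1 / 2)) = -1 := by
      rw [← Complex.exp_pi_mul_I]; congr 1; ring
    rw [this]; ring
  have hf := hasSum_one_div_nat_pow_mul_fourier (k := m + 2) (by omega) hθ'
  rw [← hasSum_nat_add_iff' 1] at hf
  have hsum := s1.add (s2.mul_left ((-1) ^ m))
  have hfour : ∀ k : ℕ, (fourier ((k : ℕ) : ℤ) (θ : UnitAddCircle) : ℂ) = x ^ k := by
    intro k
    rw [fourier_coe_apply, ← hexp, ← Complex.exp_nat_mul]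
    congr 1
    push_cast
    ring
  have hfour' : ∀ k : ℕ, (fourier (-((k : ℕ) : ℤ)) (θ : UnitAddCircle) : ℂ) = x⁻¹ ^ k := by
    intro k
    rw [fourier_coe_apply, ← hexp, ← Complex.exp_neg, ← Complex.exp_nat_mul]
    congr 1
    push_cast
    ring
  have hval := hsum.unique (by
    convert! hf using 1
    funext k
    rw [hfour, hfour', pow_add (-1 : ℂ) m 2]
    simp only [mul_zero, neg_zero, Real.exp_zero, Complex.ofReal_one, mul_one]
    ring)
  have hb : beta (m + 2) x = (2 * (Real.pi : ℂ) * Complex.I) ^ (m + 2) / ((m + 2).factorial : ℂ) *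
      (bernoulliFun (m + 2) θ : ℂ) := by
    rw [beta, hθx, bernoulliFun, Polynomial.eval_map_algebraMap]
    congr 1
    exact Polynomial.aeval_algebraMap_apply ℂ θ (Polynomial.bernoulli (m + 2))
  simp at hval
  rw [hb]
  linear_combination hval

/-- The functional equation of the polylogarithm under inversion. -/
theorem flow_inversion (m : ℕ) {x : ℂ} (hx : -x ∈ slitPlane) :
    flow [(m, x)] 0 + beta (m + 1) x = (-1) ^ m * flow [(m, x⁻¹)] 0 := by
  induction m generalizing x with
  | zero => simpa using flow_inversion_zero hx
  | succ m ih =>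
    have hsl : ∀ v : ℝ, -(x * (Real.exp (-v) : ℝ)) ∈ slitPlane := fun v =>
      neg_mul_real_mem_slitPlane hx (Real.exp_pos _)
    have hinv : ∀ v : ℝ, (x * (Real.exp (-v) : ℝ))⁻¹ = x⁻¹ * (Real.exp (-(-v)) : ℝ) := by
      intro v
      rw [mul_inv, ← Complex.ofReal_inv, ← Real.exp_neg]
    -- The defect of the relation at x e^{-v}. Its derivative vanishes by the relation of lower
    -- weight, so it equals its value at v = log |x|, where the argument lies on the unit circle.
    set Q : ℝ → ℂ := fun v => flow [(m + 1, x)] v + beta (m + 2) (x * (Real.exp (-v) : ℝ)) -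
      (-1) ^ (m + 1) * flow [(m + 1, x⁻¹)] (-v) with hQ
    have hd : ∀ v, HasDerivAt Q 0 v := by
      intro v
      have h1 := hasDerivAt_flow_succ (m := m) (x := x) (L := []) (by simpa [Slit] using hx) v
      have h2 := hasDerivAt_beta hx (m + 1) v
      have h3 := (hasDerivAt_flow_succ (m := m) (x := x⁻¹) (L := [])
        (by simpa [Slit] using neg_inv_mem_slitPlane hx) (-v)).scomp v (hasDerivAt_neg v)
      convert! (h1.add h2).sub (h3.const_mul ((-1) ^ (m + 1))) using 1
      have h4 := ih (hsl v)
      rw [hinv, flow_singleton_scale, flow_singleton_scale] at h4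
      simp only [zero_add] at h4
      simp only [neg_smul, one_smul, neg_neg]
      linear_combination h4
    have hconst : ∀ v w, Q v = Q w := is_const_of_deriv_eq_zero
      (fun v => (hd v).differentiableAt) fun v => (hd v).deriv
    have hval : ∀ v, Q v = flow [(m + 1, x * (Real.exp (-v) : ℝ))] 0 +
        beta (m + 2) (x * (Real.exp (-v) : ℝ)) -
        (-1) ^ (m + 1) * flow [(m + 1, (x * (Real.exp (-v) : ℝ))⁻¹)] 0 := by
      intro v
      rw [hinv, flow_singleton_scale, flow_singleton_scale, zero_add, zero_add]
    have hx0 : 0 < ‖x‖ := norm_pos_iff.2 (ne_zero_of_neg_mem_slitPlane hx)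
    have h1 := hval (Real.log ‖x‖)
    rw [flow_inversion_of_norm_eq_one (hsl _) ?_, sub_self, hconst _ 0, hval] at h1
    · simpa [sub_eq_zero] using h1
    · rw [norm_mul, Complex.norm_real, Real.norm_of_nonneg (Real.exp_pos _).le, Real.exp_neg,
        Real.exp_log hx0, mul_inv_cancel₀ hx0.ne']

end MPL

/-! ### Derivations attached to scalings, and their action on polylogarithms of quotients. -/

namespace MPL

variable {ι : Type*}

/-! ### Scalings of the variables and the corresponding derivations -/

/-- Points whose coordinates and quotients of coordinates lie outside of `[0, ∞)`. -/
def Dom (ι : Type*) : Set (ι → ℂ) :=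
  {x | (∀ a, -x a ∈ slitPlane) ∧ ∀ a b, a ≠ b → -(x a / x b) ∈ slitPlane}

/-- Scaling of the coordinates by `e^{-s δ}`. -/
noncomputable def scl (δ : ι → ℝ) (s : ℝ) (x : ι → ℂ) : ι → ℂ :=
  fun a => x a * (Real.exp (-(s * δ a)) : ℝ)

theorem scl_mem_dom {x : ι → ℂ} (hx : x ∈ Dom ι) (δ : ι → ℝ) (s : ℝ) : scl δ s x ∈ Dom ι := by
  refine ⟨fun a => neg_mul_real_mem_slitPlane (hx.1 a) (Real.exp_pos _), fun a b hab => ?_⟩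
  have := neg_mul_real_mem_slitPlane (hx.2 a b hab)
    (div_pos (Real.exp_pos (-(s * δ a))) (Real.exp_pos (-(s * δ b))))
  rwa [Complex.ofReal_div, div_mul_div_comm] at this

theorem scl_scl (δ : ι → ℝ) (s t : ℝ) (x : ι → ℂ) : scl δ s (scl δ t x) = scl δ (s + t) x := by
  funext a
  simp only [scl]
  rw [mul_assoc, ← Complex.ofReal_mul, ← Real.exp_add]
  congr 3
  ring

@[simp] theorem scl_zero (δ : ι → ℝ) (x : ι → ℂ) : scl δ 0 x = x := by
  funext a
  simp [scl]

theorem scl_one_apply (s : ℝ) (x : ι → ℂ) (a : ι) : scl 1 s x a = x a * (Real.exp (-s) : ℝ) := by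
  simp [scl]

/-- The direction in which only the coordinate `i` is scaled. -/
noncomputable def dir (i : ι) : ι → ℝ := Set.indicator {i} 1

theorem scl_dir_self (i : ι) (s : ℝ) (x : ι → ℂ) :
    scl (dir i) s x i = x i * (Real.exp (-s) : ℝ) := by
  simp [scl, dir]

theorem scl_dir_of_ne {i a : ι} (h : a ≠ i) (s : ℝ) (x : ι → ℂ) : scl (dir i) s x a = x a := by
  simp [scl, dir, h]

/-- `g` is the derivative of `f` with respect to the derivation `∑ δ_a x_a ∂/∂x_a`. -/
def IsD (δ : ι → ℝ) (f g : (ι → ℂ) → ℂ) : Prop :=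
  ∀ x ∈ Dom ι, HasDerivAt (fun s : ℝ => f (scl δ s x)) (-(g x)) 0

section IsD

variable {δ : ι → ℝ} {f g f' g' : (ι → ℂ) → ℂ}

theorem IsD.hasDerivAt (h : IsD δ f g) {x : ι → ℂ} (hx : x ∈ Dom ι) (s : ℝ) :
    HasDerivAt (fun s : ℝ => f (scl δ s x)) (-(g (scl δ s x))) s := by
  have := h _ (scl_mem_dom hx δ s)
  have h2 : HasDerivAt (fun r : ℝ => f (scl δ r (scl δ s x))) (-(g (scl δ s x))) (s - s) := by
    simpa using this
  have h3 := h2.comp_sub_const s s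
  simpa [scl_scl] using h3

theorem IsD.congr_right (h : IsD δ f g) (hg : ∀ x ∈ Dom ι, g x = g' x) : IsD δ f g' :=
  fun x hx => by rw [← hg x hx]; exact h x hx

theorem IsD.congr_left (h : IsD δ f g) (hf : ∀ x ∈ Dom ι, f x = f' x) : IsD δ f' g :=
  fun x hx => (h x hx).congr_of_eventuallyEq
    (Eventually.of_forall fun s => (hf _ (scl_mem_dom hx δ s)).symm)

theorem IsD.add (h : IsD δ f g) (h' : IsD δ f' g') :
    IsD δ (fun x => f x + f' x) (fun x => g x + g' x) :=
  fun x hx => by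
    convert! (h x hx).add (h' x hx) using 1
    ring

theorem IsD.sub (h : IsD δ f g) (h' : IsD δ f' g') :
    IsD δ (fun x => f x - f' x) (fun x => g x - g' x) :=
  fun x hx => by
    convert! (h x hx).sub (h' x hx) using 1
    ring

theorem IsD.mul (h : IsD δ f g) (h' : IsD δ f' g') :
    IsD δ (fun x => f x * f' x) (fun x => g x * f' x + f x * g' x) :=
  fun x hx => by
    convert! (h x hx).mul (h' x hx) using 1
    simp only [scl_zero]
    ring

theorem IsD.const_mul (h : IsD δ f g) (c : ℂ) : IsD δ (fun x => c * f x) (fun x => c * g x) :=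
  fun x hx => by
    convert! (h x hx).const_mul c using 1
    ring

theorem IsD.neg (h : IsD δ f g) : IsD δ (fun x => -f x) (fun x => -g x) :=
  fun x hx => (h x hx).neg

theorem isD_of_invariant (h : ∀ x s, f (scl δ s x) = f x) : IsD δ f 0 := fun x hx => by
  simp only [h, Pi.zero_apply, neg_zero]
  exact hasDerivAt_const _ _

theorem IsD.eq_of_zero (h : IsD δ f 0) {x : ι → ℂ} (hx : x ∈ Dom ι) (s t : ℝ) :
    f (scl δ s x) = f (scl δ t x) :=
  is_const_of_deriv_eq_zero (fun s => (h.hasDerivAt hx s).differentiableAt)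
    (fun s => by simpa using (h.hasDerivAt hx s).deriv) s t

/-- A function with vanishing derivative that tends to `0` vanishes. -/
theorem IsD.eq_zero_of_tendsto (h : IsD δ f 0) {x : ι → ℂ} (hx : x ∈ Dom ι) {l : Filter ℝ}
    [l.NeBot] (hl : Tendsto (fun s => f (scl δ s x)) l (𝓝 0)) : f x = 0 := by
  have h1 : (fun s => f (scl δ s x)) = fun _ => f x := by
    funext s
    rw [h.eq_of_zero hx s 0, scl_zero]
  rw [h1] at hl
  exact tendsto_nhds_unique tendsto_const_nhds hl

end IsD

theorem isD_beta_one (k : ℕ) (i : ι) :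
    IsD 1 (fun x : ι → ℂ => beta (k + 1) (x i)) (fun x => beta k (x i)) := fun x hx => by
  simpa [scl_one_apply] using hasDerivAt_beta (hx.1 i) k 0

theorem isD_beta_dir (k : ℕ) (i : ι) :
    IsD (dir i) (fun x : ι → ℂ => beta (k + 1) (x i)) (fun x => beta k (x i)) := fun x hx => by
  simpa [scl_dir_self] using hasDerivAt_beta (hx.1 i) k 0

/-! ### Polylogarithms of quotients -/

/-- `x_e`, and `1` if `e = ⊤`. -/
def den (e : WithTop ι) (x : ι → ℂ) : ℂ := e.recTopCoe 1 x

/-- For `L = [(n_r - 1, i_r), …, (n_1 - 1, i_1)]`, the multiple polylogarithm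
`Li_n(x_{i_1} / x_{i_2}, …, x_{i_r} / x_e)`. -/
noncomputable def block (e : WithTop ι) (L : List (ℕ × ι)) (x : ι → ℂ) : ℂ :=
  flow (L.map fun p => (p.1, x p.2 / den e x)) 0

/-- The iterated integral with arguments `x_i / x_j`, for the indices `j` in the list. -/
noncomputable def revBlock (i : ι) (L : List (ℕ × ι)) (x : ι → ℂ) : ℂ :=
  flow (L.map fun p => (p.1, x i / x p.2)) 0

@[simp] theorem block_nil (e : WithTop ι) (x : ι → ℂ) : block e [] x = 1 := rfl

@[simp] theorem revBlock_nil (i : ι) (x : ι → ℂ) : revBlock i [] x = 1 := rfl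

@[simp] theorem den_top (x : ι → ℂ) : den ⊤ x = 1 := rfl

@[simp] theorem den_coe (e : ι) (x : ι → ℂ) : den (e : WithTop ι) x = x e := rfl

theorem den_scl_dir {e : WithTop ι} {i : ι} (h : (i : WithTop ι) ≠ e) (s : ℝ) (x : ι → ℂ) :
    den e (scl (dir i) s x) = den e x := by
  induction e using WithTop.recTopCoe with
  | top => rfl
  | coe e => exact scl_dir_of_ne (fun h' => h (by rw [h'])) s x

theorem neg_div_den_mem {x : ι → ℂ} (hx : x ∈ Dom ι) {e : WithTop ι} {i : ι}
    (h : (i : WithTop ι) ≠ e) : -(x i / den e x) ∈ slitPlane := by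
  induction e using WithTop.recTopCoe with
  | top => simpa using hx.1 i
  | coe e => exact hx.2 i e fun h' => h (by rw [h'])

theorem den_ne_zero {x : ι → ℂ} (hx : x ∈ Dom ι) (e : WithTop ι) : den e x ≠ 0 := by
  induction e using WithTop.recTopCoe with
  | top => simp
  | coe e => exact ne_zero_of_neg_mem_slitPlane (hx.1 e)

theorem slit_map_div_den {x : ι → ℂ} (hx : x ∈ Dom ι) {e : WithTop ι} {L : List (ℕ × ι)}
    (h : ∀ p ∈ L, (p.2 : WithTop ι) ≠ e) : Slit (L.map fun p => (p.1, x p.2 / den e x)) := by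
  intro q hq
  obtain ⟨p, hp, rfl⟩ := List.mem_map.1 hq
  exact neg_div_den_mem hx (h p hp)

theorem slit_map_div {x : ι → ℂ} (hx : x ∈ Dom ι) {i : ι} {L : List (ℕ × ι)}
    (h : ∀ p ∈ L, p.2 ≠ i) : Slit (L.map fun p => (p.1, x i / x p.2)) := by
  intro q hq
  obtain ⟨p, hp, rfl⟩ := List.mem_map.1 hq
  exact hx.2 i p.2 (h p hp).symm

theorem mul_div_mul_exp (a b : ℂ) (s : ℝ) :
    a * (Real.exp s : ℝ) / (b * (Real.exp s : ℝ)) = a / b :=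
  mul_div_mul_right _ _ (Complex.ofReal_ne_zero.2 (Real.exp_pos s).ne')

/-- Quotients of coordinates are unchanged by a common scaling, so these blocks are constants for
the derivation in direction `1` and can serve as coefficients of an expansion at infinity. -/
theorem block_coe_scl_one (e : ι) (L : List (ℕ × ι)) (s : ℝ) (x : ι → ℂ) :
    block (e : WithTop ι) L (scl 1 s x) = block (e : WithTop ι) L x := by
  simp only [block, den_coe, scl_one_apply, mul_div_mul_exp]

theorem revBlock_scl_one (i : ι) (L : List (ℕ × ι)) (s : ℝ) (x : ι → ℂ) :
    revBlock i L (scl 1 s x) = revBlock i L x := by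
  simp only [revBlock, scl_one_apply, mul_div_mul_exp]

theorem block_top_scl_one (L : List (ℕ × ι)) (s : ℝ) (x : ι → ℂ) :
    block ⊤ L (scl 1 s x) = flow (L.map fun p => (p.1, x p.2)) s := by
  have := flow_scaleList s (L.map fun p => (p.1, x p.2)) 0
  rw [zero_add] at this
  rw [← this, block, scaleList, List.map_map]
  simp only [den_top, div_one, scl_one_apply]
  rfl

theorem isD_one_block_succ (m : ℕ) (a : ι) (L : List (ℕ × ι)) :
    IsD 1 (block ⊤ ((m + 1, a) :: L)) (block ⊤ ((m, a) :: L)) := fun x hx => by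
  simp only [block_top_scl_one, List.map_cons]
  convert! hasDerivAt_flow_succ (m := m) (x := x a) (L := L.map fun p => (p.1, x p.2)) ?_ 0 using 1
  · simp [block]
  · simpa using slit_map_div_den hx (e := ⊤) (L := (m + 1, a) :: L) (by simp)

theorem isD_one_block_zero (a : ι) (L : List (ℕ × ι)) :
    IsD 1 (block ⊤ ((0, a) :: L)) (fun x => geom (x a) * block ⊤ L x) := fun x hx => by
  simp only [block_top_scl_one, List.map_cons]
  convert! hasDerivAt_flow_zero (x := x a) (L := L.map fun p => (p.1, x p.2)) ?_ 0 using 1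
  · simp [block]
  · simpa using slit_map_div_den hx (e := ⊤) (L := (0, a) :: L) (by simp)

theorem map_scl_dir {β : Type*} {i : ι} {L : List (ℕ × ι)} (h : ∀ p ∈ L, p.2 ≠ i) (s : ℝ)
    (x : ι → ℂ) (f : ℂ → β) :
    (L.map fun p => (p.1, f (scl (dir i) s x p.2))) = L.map fun p => (p.1, f (x p.2)) :=
  List.map_congr_left fun p hp => by rw [scl_dir_of_ne (h p hp)]

theorem revBlock_scl_dir {i : ι} {L : List (ℕ × ι)} (h : ∀ p ∈ L, p.2 ≠ i) (s : ℝ)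
    (x : ι → ℂ) :
    revBlock i L (scl (dir i) s x) = flow (L.map fun p => (p.1, x i / x p.2)) s := by
  have := flow_scaleList s (L.map fun p => (p.1, x i / x p.2)) 0
  rw [zero_add] at this
  rw [← this, revBlock, scaleList, List.map_map, scl_dir_self,
    map_scl_dir h s x fun y => x i * (Real.exp (-s) : ℝ) / y]
  simp only [mul_div_right_comm]
  rfl

theorem revBlock_scl_dir_of_ne {i j : ι} {L : List (ℕ × ι)} (h : ∀ p ∈ L, p.2 ≠ i) (hj : j ≠ i)
    (s : ℝ) (x : ι → ℂ) : revBlock j L (scl (dir i) s x) = revBlock j L x := by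
  rw [revBlock, scl_dir_of_ne hj, map_scl_dir h s x fun y => x j / y]
  rfl

theorem block_scl_dir_of_ne {i : ι} {e : WithTop ι} {L : List (ℕ × ι)} (h : ∀ p ∈ L, p.2 ≠ i)
    (he : (i : WithTop ι) ≠ e) (s : ℝ) (x : ι → ℂ) :
    block e L (scl (dir i) s x) = block e L x := by
  rw [block, den_scl_dir he, map_scl_dir h s x fun y => y / den e x]
  rfl

theorem block_append_scl_dir {i : ι} {e : WithTop ι} {L : List (ℕ × ι)} (h : ∀ p ∈ L, p.2 ≠ i)
    (he : (i : WithTop ι) ≠ e) (m : ℕ) (s : ℝ) (x : ι → ℂ) :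
    block e (L ++ [(m, i)]) (scl (dir i) s x) =
      flow ((L.map fun p => (p.1, x p.2 / den e x)) ++
        [(m, x i / den e x * (Real.exp (-s) : ℝ))]) 0 := by
  rw [block, den_scl_dir he, List.map_append, map_scl_dir h s x fun y => y / den e x]
  simp only [List.map_cons, List.map_nil, scl_dir_self, mul_div_right_comm]

theorem isD_dir_revBlock_succ {i j : ι} {L : List (ℕ × ι)} (h : ∀ p ∈ L, p.2 ≠ i) (hj : j ≠ i)
    (m : ℕ) : IsD (dir i) (revBlock i ((m + 1, j) :: L)) (revBlock i ((m, j) :: L)) :=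
  fun x hx => by
    have h' : ∀ m, ∀ p ∈ (m, j) :: L, p.2 ≠ i := fun m => List.forall_mem_cons.2 ⟨hj, h⟩
    simp only [revBlock_scl_dir (h' (m + 1)), List.map_cons]
    exact hasDerivAt_flow_succ (by simpa using slit_map_div hx (h' (m + 1))) 0

theorem isD_dir_revBlock_zero {i j : ι} {L : List (ℕ × ι)} (h : ∀ p ∈ L, p.2 ≠ i) (hj : j ≠ i) :
    IsD (dir i) (revBlock i ((0, j) :: L)) (fun x => geom (x i / x j) * revBlock i L x) :=
  fun x hx => by
    have h' : ∀ m, ∀ p ∈ (m, j) :: L, p.2 ≠ i := fun m => List.forall_mem_cons.2 ⟨hj, h⟩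
    simp only [revBlock_scl_dir (h' 0), List.map_cons]
    convert! hasDerivAt_flow_zero (by simpa using slit_map_div hx (h' 0)) 0 using 1
    simp [revBlock]

theorem isD_dir_block_succ {i : ι} {e : WithTop ι} {L : List (ℕ × ι)} (h : ∀ p ∈ L, p.2 ≠ i)
    (hL : ∀ p ∈ L, (p.2 : WithTop ι) ≠ e) (he : (i : WithTop ι) ≠ e) (m : ℕ) :
    IsD (dir i) (block e (L ++ [(m + 1, i)])) (block e (L ++ [(m, i)])) := fun x hx => by
  simp only [block_append_scl_dir h he]
  convert! hasDerivAt_flow_last_succ (slit_map_div_den hx hL) (neg_div_den_mem hx he) 0 0 using 1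
  have := block_append_scl_dir h he m 0 x
  rw [scl_zero] at this
  rw [this]

theorem isD_dir_block_singleton_zero {i : ι} {e : WithTop ι} (he : (i : WithTop ι) ≠ e) :
    IsD (dir i) (block e [(0, i)]) (fun x => geom (x i / den e x)) := fun x hx => by
  have := fun s => block_append_scl_dir (L := []) (i := i) (by simp) he 0 s x
  simp only [List.nil_append, List.map_nil] at this
  simp only [this]
  convert! hasDerivAt_flow_singleton_zero (neg_div_den_mem hx he) 0 0 using 1
  simp

theorem isD_dir_block_zero {i j : ι} {e : WithTop ι} {L : List (ℕ × ι)}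
    (h : ∀ p ∈ L, p.2 ≠ i) (hL : ∀ p ∈ L, (p.2 : WithTop ι) ≠ e) (he : (i : WithTop ι) ≠ e)
    (hj : j ≠ i) (hje : (j : WithTop ι) ≠ e) (m : ℕ) :
    IsD (dir i) (block e (L ++ [(m, j), (0, i)])) (fun x =>
      geom (x i / x j) * (block e (L ++ [(m, j)]) x - block e (L ++ [(m, i)]) x) -
        block e (L ++ [(m, i)]) x) := fun x hx => by
  have h' : ∀ p ∈ L ++ [(m, j)], p.2 ≠ i := by
    simpa [or_imp, forall_and] using ⟨fun a b => h (a, b), hj⟩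
  have hd := den_ne_zero hx e
  have hq : x i / den e x / (x j / den e x) = x i / x j := div_div_div_cancel_right₀ hd _ _
  have h1 := fun s => block_append_scl_dir h' he 0 s x
  simp only [List.append_assoc, List.cons_append, List.nil_append, List.map_append, List.map_cons,
    List.map_nil] at h1
  simp only [h1]
  convert! hasDerivAt_flow_last_zero (m := m) (slit_map_div_den hx hL) (neg_div_den_mem hx he)
    (neg_div_den_mem hx hje) (by rw [hq]; exact hx.2 i j hj.symm) 0 0 using 1
  have h2 := block_append_scl_dir h he m 0 x
  rw [scl_zero] at h2
  have h3 : block e (L ++ [(m, j)]) x =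
      flow ((L.map fun p => (p.1, x p.2 / den e x)) ++ [(m, x j / den e x)]) 0 := by
    simp [block]
  rw [h2, h3]
  simp only [neg_zero, Real.exp_zero, Complex.ofReal_one, mul_one, hq]
  ring

end MPL

/-! ### Construction of the logarithmic factors of the expansion. -/

namespace MPL

variable {ι : Type*}

/-! ### Integer combinations of `β_k(x_i)` times iterated integrals -/

/-- A term `c β_k(x_i) · revBlock i L`. -/
abbrev Term (ι : Type*) := ℤ × ℕ × List (ℕ × ι)

/-- The value of a sum of terms. -/
noncomputable def evalTerms (i : ι) (T : List (Term ι)) (x : ι → ℂ) : ℂ :=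
  (T.map fun t => (t.1 : ℂ) * beta t.2.1 (x i) * revBlock i t.2.2 x).sum

@[simp] theorem evalTerms_nil (i : ι) (x : ι → ℂ) : evalTerms i [] x = 0 := rfl

@[simp] theorem evalTerms_cons (i : ι) (t : Term ι) (T : List (Term ι)) (x : ι → ℂ) :
    evalTerms i (t :: T) x =
      (t.1 : ℂ) * beta t.2.1 (x i) * revBlock i t.2.2 x + evalTerms i T x := by
  simp [evalTerms]

@[simp] theorem evalTerms_append (i : ι) (T T' : List (Term ι)) (x : ι → ℂ) :
    evalTerms i (T ++ T') x = evalTerms i T x + evalTerms i T' x := by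
  simp [evalTerms]

/-- Integration by parts: `∑_{a ≤ k} (-1)^a c β_{k-a}(x_i) · revBlock i ((m + a, j) :: L)`. -/
def primTerm (j : ι) (L : List (ℕ × ι)) : ℕ → ℕ → ℤ → List (Term ι)
  | 0, m, c => [(c, 0, (m, j) :: L)]
  | k + 1, m, c => (c, k + 1, (m, j) :: L) :: primTerm j L k (m + 1) (-c)

/-- A primitive of a sum of terms. -/
def raiseTerms (T : List (Term ι)) : List (Term ι) :=
  T.flatMap fun
    | (_, _, []) => []
    | (c, k, (m, j) :: L) => primTerm j L k (m + 1) c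

/-- A primitive of `geom (x_i / x_j)` times a sum of terms. -/
def geomTerms (j : ι) (T : List (Term ι)) : List (Term ι) :=
  T.flatMap fun t => primTerm j t.2.2 t.2.1 0 t.1

/-- The negative of a sum of terms. -/
def negTerms (T : List (Term ι)) : List (Term ι) := T.map fun t => (-t.1, t.2)

theorem evalTerms_negTerms (i : ι) (T : List (Term ι)) (x : ι → ℂ) :
    evalTerms i (negTerms T) x = -evalTerms i T x := by
  induction T with
  | nil => simp [negTerms]
  | cons t T ih =>
    simp only [negTerms, List.map_cons, evalTerms_cons] at *
    rw [ih]
    push_cast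
    ring

/-- All terms have non-empty lists not involving the index `i`. -/
def GoodTerms (i : ι) (T : List (Term ι)) : Prop :=
  ∀ t ∈ T, t.2.2 ≠ [] ∧ ∀ p ∈ t.2.2, p.2 ≠ i

/-- In the alternating sum, differentiating the Bernoulli function of one term cancels
differentiating the integral of the next; only the derivative of the first integral survives.
Keeping the derivative `h m` abstract treats the exponent 0, where a `geom` factor appears, together
with the others. -/
theorem isD_primTerm_aux {i j : ι} {L : List (ℕ × ι)} {h : ℕ → (ι → ℂ) → ℂ}
    (hd : ∀ m, IsD (dir i) (revBlock i ((m, j) :: L)) (h m))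
    (hh : ∀ m, h (m + 1) = revBlock i ((m, j) :: L)) (k m : ℕ) (c : ℤ) :
    IsD (dir i) (evalTerms i (primTerm j L k m c)) (fun x => c * beta k (x i) * h m x) := by
  induction k generalizing m c with
  | zero =>
    have := (hd m).const_mul c
    refine (this.congr_left fun x _ => ?_).congr_right fun x _ => ?_ <;> simp [primTerm]
  | succ k ih =>
    have h1 := (((isD_beta_dir k i).const_mul c).mul (hd m)).add (ih (m + 1) (-c))
    have h2 : evalTerms i (primTerm j L (k + 1) m c) = fun x =>
        (c : ℂ) * beta (k + 1) (x i) * revBlock i ((m, j) :: L) x +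
          evalTerms i (primTerm j L k (m + 1) (-c)) x := by
      funext x
      simp [primTerm]
    rw [h2]
    refine h1.congr_right fun x _ => ?_
    rw [hh m]
    push_cast
    ring

theorem isD_primTerm_succ {i j : ι} {L : List (ℕ × ι)} (h : ∀ p ∈ L, p.2 ≠ i) (hj : j ≠ i)
    (k m : ℕ) (c : ℤ) :
    IsD (dir i) (evalTerms i (primTerm j L k (m + 1) c))
      (fun x => c * beta k (x i) * revBlock i ((m, j) :: L) x) :=
  isD_primTerm_aux (h := fun m x => m.casesOn (geom (x i / x j) * revBlock i L x)
      fun m => revBlock i ((m, j) :: L) x)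
    (fun m => by
      cases m with
      | zero => exact isD_dir_revBlock_zero h hj
      | succ m => exact isD_dir_revBlock_succ h hj m)
    (fun _ => rfl) k (m + 1) c

theorem isD_primTerm_zero {i j : ι} {L : List (ℕ × ι)} (h : ∀ p ∈ L, p.2 ≠ i) (hj : j ≠ i)
    (k : ℕ) (c : ℤ) :
    IsD (dir i) (evalTerms i (primTerm j L k 0 c))
      (fun x => c * beta k (x i) * (geom (x i / x j) * revBlock i L x)) :=
  isD_primTerm_aux (h := fun m x => m.casesOn (geom (x i / x j) * revBlock i L x)
      fun m => revBlock i ((m, j) :: L) x)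
    (fun m => by
      cases m with
      | zero => exact isD_dir_revBlock_zero h hj
      | succ m => exact isD_dir_revBlock_succ h hj m)
    (fun _ => rfl) k 0 c

theorem isD_zero (δ : ι → ℝ) : IsD δ (fun _ => 0) 0 := isD_of_invariant fun _ _ => rfl

theorem isD_raiseTerms {i : ι} {T : List (Term ι)} (hT : GoodTerms i T) :
    IsD (dir i) (evalTerms i (raiseTerms T)) (evalTerms i T) := by
  induction T with
  | nil => exact isD_zero _
  | cons t T ih =>
    obtain ⟨c, k, L⟩ := t
    obtain ⟨h1, h2⟩ := List.forall_mem_cons.1 hT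
    cases L with
    | nil => exact absurd rfl h1.1
    | cons p L =>
      obtain ⟨m, j⟩ := p
      have hp := List.forall_mem_cons.1 h1.2
      have := (isD_primTerm_succ hp.2 hp.1 k m c).add (ih h2)
      have h3 : evalTerms i (raiseTerms ((c, k, (m, j) :: L) :: T)) = fun x =>
          evalTerms i (primTerm j L k (m + 1) c) x + evalTerms i (raiseTerms T) x := by
        funext x
        simp [raiseTerms]
      rw [h3]
      refine this.congr_right fun x _ => ?_
      simp

theorem isD_geomTerms {i j : ι} (hj : j ≠ i) {T : List (Term ι)}
    (hT : ∀ t ∈ T, ∀ p ∈ t.2.2, p.2 ≠ i) :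
    IsD (dir i) (evalTerms i (geomTerms j T)) (fun x => geom (x i / x j) * evalTerms i T x) := by
  induction T with
  | nil => exact (isD_zero _).congr_right (by simp)
  | cons t T ih =>
    obtain ⟨h1, h2⟩ := List.forall_mem_cons.1 hT
    have := (isD_primTerm_zero h1 hj t.2.1 t.1).add (ih h2)
    have h3 : evalTerms i (geomTerms j (t :: T)) = fun x =>
        evalTerms i (primTerm j t.2.2 t.2.1 0 t.1) x + evalTerms i (geomTerms j T) x := by
      funext x
      simp [geomTerms]
    rw [h3]
    refine this.congr_right fun x _ => ?_
    simp only [evalTerms_cons]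
    ring

/-! ### Well-formedness -/

/-- The lists of the terms are non-empty, have indices forming a sublist of `J`, and the weights
are `w`. -/
def WfTerms (J : List ι) (w : ℕ) (T : List (Term ι)) : Prop :=
  ∀ t ∈ T, t.2.2 ≠ [] ∧ (t.2.2.map Prod.snd).Sublist J ∧ t.2.1 + wt t.2.2 = w

theorem wf_primTerm {j : ι} {L : List (ℕ × ι)} {J : List ι} {w : ℕ} (k m : ℕ) (c : ℤ)
    (hs : (j :: L.map Prod.snd).Sublist J) (hw : k + (m + 1 + wt L) = w) :
    WfTerms J w (primTerm j L k m c) := by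
  induction k generalizing m c with
  | zero => simpa [WfTerms, primTerm] using ⟨hs, by omega⟩
  | succ k ih =>
    refine List.forall_mem_cons.2 ⟨⟨by simp, hs, by simpa using hw⟩, ih (m + 1) (-c) (by omega)⟩

theorem wf_raiseTerms {J : List ι} {w : ℕ} {T : List (Term ι)} (hT : WfTerms J w T) :
    WfTerms J (w + 1) (raiseTerms T) := by
  intro t ht
  obtain ⟨⟨c, k, L⟩, hs, ht⟩ := List.mem_flatMap.1 ht
  have hT' := hT _ hs
  cases L with
  | nil => simp at ht
  | cons p L =>
    refine wf_primTerm k (p.1 + 1) c hT'.2.1 ?_ t ht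
    have := hT'.2.2
    simp at this
    omega

theorem wf_geomTerms {J : List ι} {w : ℕ} {T : List (Term ι)} (j : ι)
    (hT : ∀ t ∈ T, (t.2.2.map Prod.snd).Sublist J ∧ t.2.1 + wt t.2.2 = w) :
    WfTerms (j :: J) (w + 1) (geomTerms j T) := by
  intro t ht
  obtain ⟨s, hs, ht⟩ := List.mem_flatMap.1 ht
  refine wf_primTerm s.2.1 0 s.1 ((hT s hs).1.cons_cons j) ?_ t ht
  have := (hT s hs).2
  omega

theorem wf_negTerms {J : List ι} {w : ℕ} {T : List (Term ι)} (hT : WfTerms J w T) :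
    WfTerms J w (negTerms T) := by
  intro t ht
  obtain ⟨s, hs, rfl⟩ := List.mem_map.1 ht
  exact hT s hs

theorem WfTerms.good {J : List ι} {w : ℕ} {T : List (Term ι)} (hT : WfTerms J w T) {i : ι}
    (hi : i ∉ J) : GoodTerms i T := fun t ht =>
  ⟨(hT t ht).1, fun _ hp h => hi (h ▸ (hT t ht).2.1.subset (List.mem_map_of_mem hp))⟩

/-! ### The functions `V` -/

/-- The decaying part of `lead`. -/
def decTerms : List (ℕ × ι) → ℕ → List (Term ι)
  | [], _ => []
  -- For m = 0 this integrates -(1 + geom(x_i / x_j)) · `lead i t k`, except for the contribution of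
  -- 1 times the leading Bernoulli term, which becomes the leading term of the new `lead`. The
  -- summands come from 1 times the decaying part, `geom` times the leading term, and `geom` times
  -- the decaying part. The iteration supplies the m further integrations.
  | (m, j) :: t, k => raiseTerms^[m] (negTerms (raiseTerms (decTerms t k) ++
      (primTerm j [] (k + wt t) 0 ((-1) ^ t.length) ++ geomTerms j (decTerms t k))))

theorem wf_iterate_raiseTerms {J : List ι} {w : ℕ} {T : List (Term ι)} (hT : WfTerms J w T)
    (n : ℕ) : WfTerms J (w + n) (raiseTerms^[n] T) := by
  induction n with
  | zero => exact hT
  | succ n ih => rw [Function.iterate_succ_apply']; exact wf_raiseTerms ih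

theorem wf_append {J : List ι} {w : ℕ} {T T' : List (Term ι)} (hT : WfTerms J w T)
    (hT' : WfTerms J w T') : WfTerms J w (T ++ T') := fun t ht =>
  (List.mem_append.1 ht).elim (hT t) (hT' t)

theorem wf_mono {J J' : List ι} {w : ℕ} {T : List (Term ι)} (hT : WfTerms J w T)
    (h : J.Sublist J') : WfTerms J' w T :=
  fun t ht => ⟨(hT t ht).1, (hT t ht).2.1.trans h, (hT t ht).2.2⟩

theorem wf_decTerms_base (m : ℕ) (j : ι) {t : List (ℕ × ι)} {k : ℕ}
    (ih : WfTerms (t.map Prod.snd) (k + wt t) (decTerms t k)) :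
    WfTerms (((m, j) :: t).map Prod.snd) (k + wt t + 1) (negTerms (raiseTerms (decTerms t k) ++
      (primTerm j [] (k + wt t) 0 ((-1) ^ t.length) ++ geomTerms j (decTerms t k)))) := by
  refine wf_negTerms (wf_append (wf_mono (wf_raiseTerms ih) (List.sublist_cons_self _ _))
    (wf_append (wf_primTerm _ _ _ ?_ (by simp)) (wf_geomTerms j fun t ht => (ih t ht).2)))
  simp

theorem wf_decTerms (t : List (ℕ × ι)) (k : ℕ) :
    WfTerms (t.map Prod.snd) (k + wt t) (decTerms t k) := by
  induction t with
  | nil => simp [WfTerms, decTerms]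
  | cons p t ih =>
    obtain ⟨m, j⟩ := p
    have := wf_iterate_raiseTerms (wf_decTerms_base m j ih) m
    rwa [show k + wt t + 1 + m = k + wt ((m, j) :: t) by simp; ring] at this

/-- The function `V` determined by `V = β_k(x_i)` if the list is empty, and by the differential
equations `isD_lead_succ` and `isD_lead_zero` in `x_i`. -/
noncomputable def lead (i : ι) (t : List (ℕ × ι)) (k : ℕ) (x : ι → ℂ) : ℂ :=
  (-1) ^ t.length * beta (k + wt t) (x i) + evalTerms i (decTerms t k) x

theorem lead_nil (i : ι) (k : ℕ) (x : ι → ℂ) : lead i [] k x = beta k (x i) := by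
  simp [lead, decTerms]

theorem isD_lead_succ {i j : ι} {t : List (ℕ × ι)} (m k : ℕ)
    (hi : i ∉ ((m, j) :: t).map Prod.snd) :
    IsD (dir i) (lead i ((m + 1, j) :: t) k) (lead i ((m, j) :: t) k) := by
  have h1 := (isD_beta_dir (k + wt ((m, j) :: t)) i).const_mul ((-1) ^ (t.length + 1))
  have h2 := isD_raiseTerms ((wf_decTerms ((m, j) :: t) k).good hi)
  refine (h1.add h2).congr_left fun x _ => ?_
  have h3 : decTerms ((m + 1, j) :: t) k = raiseTerms (decTerms ((m, j) :: t) k) := by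
    simp only [decTerms, Function.iterate_succ_apply']
  rw [lead, h3]
  have h4 : k + wt ((m, j) :: t) + 1 = k + wt ((m + 1, j) :: t) := by simp; ring
  rw [h4, List.length_cons]

/-- The right-hand side is chosen to complement the derivative of `block j [(0, i)]` times `lead j t
k`: the sum of both has the shape found in `isD_dir_block_zero`. -/
theorem isD_lead_zero {i j : ι} {t : List (ℕ × ι)} (k : ℕ) (hi : i ∉ j :: t.map Prod.snd) :
    IsD (dir i) (lead i ((0, j) :: t) k)
      (fun x => -((1 + geom (x i / x j)) * lead i t k x)) := by
  have hij : j ≠ i := fun h => hi (by simp [h])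
  have hit : i ∉ t.map Prod.snd := fun h => hi (List.mem_cons_of_mem _ h)
  have hg := (wf_decTerms t k).good hit
  have h1 := (isD_beta_dir (k + wt t) i).const_mul ((-1) ^ (t.length + 1))
  have h2 := isD_raiseTerms hg
  have h3 := isD_primTerm_zero (L := []) (by simp) hij (k + wt t) ((-1) ^ t.length)
  have h4 := isD_geomTerms hij fun t ht => (hg t ht).2
  refine ((h1.add ((h2.add (h3.add h4)).neg)).congr_left fun x _ => ?_).congr_right fun x _ => ?_
  · simp only [lead, decTerms, Function.iterate_zero, id, evalTerms_negTerms, evalTerms_append,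
      wt_cons, List.length_cons]
    rw [show k + (0 + 1 + wt t) = k + wt t + 1 by ring]
  · simp only [lead, revBlock_nil]
    push_cast
    ring

/-- The lowering of the index of the Bernoulli functions. -/
def lowerTerms (T : List (Term ι)) : List (Term ι) :=
  T.flatMap fun
    | (_, 0, _) => []
    | (c, k + 1, L) => [(c, k, L)]

theorem lowerTerms_append (T T' : List (Term ι)) :
    lowerTerms (T ++ T') = lowerTerms T ++ lowerTerms T' := by simp [lowerTerms]

theorem lowerTerms_primTerm (j : ι) (L : List (ℕ × ι)) (k m : ℕ) (c : ℤ) :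
    lowerTerms (primTerm j L (k + 1) m c) = primTerm j L k m c := by
  induction k generalizing m c with
  | zero => simp [lowerTerms, primTerm]
  | succ k ih =>
    change (c, k + 1, (m, j) :: L) :: lowerTerms (primTerm j L (k + 1) (m + 1) (-c)) =
      (c, k + 1, (m, j) :: L) :: primTerm j L k (m + 1) (-c)
    rw [ih]

theorem lowerTerms_raiseTerms (T : List (Term ι)) :
    lowerTerms (raiseTerms T) = raiseTerms (lowerTerms T) := by
  induction T with
  | nil => rfl
  | cons t T ih =>
    have h1 : raiseTerms (t :: T) = raiseTerms [t] ++ raiseTerms T := by simp [raiseTerms]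
    have h2 : lowerTerms (t :: T) = lowerTerms [t] ++ lowerTerms T := by simp [lowerTerms]
    have h3 : raiseTerms (lowerTerms [t] ++ lowerTerms T) =
        raiseTerms (lowerTerms [t]) ++ raiseTerms (lowerTerms T) := by simp [raiseTerms]
    rw [h1, lowerTerms_append, h2, h3, ih]
    congr 1
    obtain ⟨c, k, L⟩ := t
    rcases L with _ | ⟨⟨m, j⟩, L⟩ <;> rcases k with _ | k
    · rfl
    · rfl
    · simp [raiseTerms, lowerTerms, primTerm]
    · have := lowerTerms_primTerm j L k (m + 1) c
      simpa [raiseTerms, lowerTerms] using this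

theorem lowerTerms_geomTerms (j : ι) (T : List (Term ι)) :
    lowerTerms (geomTerms j T) = geomTerms j (lowerTerms T) := by
  induction T with
  | nil => rfl
  | cons t T ih =>
    have h1 : geomTerms j (t :: T) = geomTerms j [t] ++ geomTerms j T := by simp [geomTerms]
    have h2 : lowerTerms (t :: T) = lowerTerms [t] ++ lowerTerms T := by simp [lowerTerms]
    have h3 : geomTerms j (lowerTerms [t] ++ lowerTerms T) =
        geomTerms j (lowerTerms [t]) ++ geomTerms j (lowerTerms T) := by simp [geomTerms]
    rw [h1, lowerTerms_append, h2, h3, ih]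
    congr 1
    obtain ⟨c, k, L⟩ := t
    rcases k with _ | k
    · simp [geomTerms, lowerTerms, primTerm]
    · have := lowerTerms_primTerm j L k 0 c
      simpa [geomTerms, lowerTerms] using this

theorem lowerTerms_negTerms (T : List (Term ι)) :
    lowerTerms (negTerms T) = negTerms (lowerTerms T) := by
  induction T with
  | nil => rfl
  | cons t T ih =>
    obtain ⟨c, k, L⟩ := t
    rcases k with _ | k
    · simpa [negTerms, lowerTerms] using ih
    · simpa [negTerms, lowerTerms] using ih

/-- Under common scaling only the Bernoulli functions are differentiated. Lowering their index
commutes with every operation in the recursion, so it only lowers the initial parameter k. -/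
theorem lowerTerms_decTerms (t : List (ℕ × ι)) (k : ℕ) :
    lowerTerms (decTerms t (k + 1)) = decTerms t k := by
  induction t with
  | nil => rfl
  | cons p t ih =>
    obtain ⟨m, j⟩ := p
    have hit : ∀ T : List (Term ι), lowerTerms (raiseTerms^[m] T) = raiseTerms^[m] (lowerTerms T) :=
      fun T => (Function.Semiconj.iterate_right lowerTerms_raiseTerms m) T
    rw [decTerms, decTerms, hit, lowerTerms_negTerms, lowerTerms_append, lowerTerms_append,
      lowerTerms_raiseTerms, lowerTerms_geomTerms, ih, show k + 1 + wt t = k + wt t + 1 by ring,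
      lowerTerms_primTerm]

theorem isD_one_evalTerms (i : ι) (T : List (Term ι)) :
    IsD 1 (evalTerms i T) (evalTerms i (lowerTerms T)) := by
  induction T with
  | nil => exact isD_zero _
  | cons t T ih =>
    obtain ⟨c, k, L⟩ := t
    have h1 : evalTerms i ((c, k, L) :: T) = fun x =>
        (c : ℂ) * beta k (x i) * revBlock i L x + evalTerms i T x := by
      funext x; simp
    have h2 : IsD 1 (revBlock i L) 0 := isD_of_invariant fun x s => revBlock_scl_one i L s x
    rw [h1]
    rcases k with _ | k
    · simp only [beta_zero, mul_one]
      refine ((h2.const_mul c).add ih).congr_right fun x _ => ?_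
      simp [lowerTerms]
    · refine ((((isD_beta_one k i).const_mul c).mul h2).add ih).congr_right fun x _ => ?_
      simp [lowerTerms]

theorem isD_one_lead (i : ι) (t : List (ℕ × ι)) (k : ℕ) :
    IsD 1 (lead i t (k + 1)) (lead i t k) := by
  have h1 := (isD_beta_one (k + wt t) i).const_mul ((-1) ^ t.length)
  have h2 := isD_one_evalTerms i (decTerms t (k + 1))
  rw [lowerTerms_decTerms] at h2
  refine (h1.add h2).congr_left fun x _ => ?_
  rw [lead, show k + wt t + 1 = k + 1 + wt t by ring]

theorem lead_scl_dir_of_ne {i j : ι} {t : List (ℕ × ι)} (hj : j ≠ i) (hi : i ∉ t.map Prod.snd)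
    (k : ℕ) (s : ℝ) (x : ι → ℂ) : lead j t k (scl (dir i) s x) = lead j t k x := by
  have hg := (wf_decTerms t k).good hi
  rw [lead, lead, scl_dir_of_ne hj, evalTerms, evalTerms]
  congr 2
  refine List.map_congr_left fun t ht => ?_
  rw [scl_dir_of_ne hj, revBlock_scl_dir_of_ne (hg t ht).2 hj]

end MPL

/-! ### The expansion at infinity: differential equations, growth, and collapse at k = 0. -/

namespace MPL

variable {ι : Type*}

/-! ### The asymptotic expansion for large arguments -/

/-- `-asym j L [] (m + 1)` is the logarithmic asymptotic expansion of `block ⊤ ((m, j) :: L)` for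
large arguments. -/
noncomputable def asym : ι → List (ℕ × ι) → List (ℕ × ι) → ℕ → (ι → ℂ) → ℂ
  | j, [], t, k => lead j t k
  | j, p :: L, t, k => fun x => block j (p :: L) x * lead j t k x + asym p.2 L ((p.1, j) :: t) k x

/-- All indices are distinct. -/
def Distinct (j : ι) (L t : List (ℕ × ι)) : Prop :=
  (L.map Prod.snd ++ j :: t.map Prod.snd).Nodup

theorem Distinct.cons {j : ι} {p : ℕ × ι} {L t : List (ℕ × ι)} (h : Distinct j (p :: L) t) :
    Distinct p.2 L ((p.1, j) :: t) := by
  unfold Distinct at *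
  exact (List.perm_middle.nodup_iff).2 h

theorem Distinct.ne {j : ι} {L t : List (ℕ × ι)} (h : Distinct j L t) :
    ∀ p ∈ L, (p.2 : WithTop ι) ≠ j := by
  intro p hp hpj
  have := (List.perm_middle.nodup_iff).1 h
  rw [List.nodup_cons] at this
  exact this.1 (List.mem_append_left _ (List.mem_map.2 ⟨p, hp, WithTop.coe_injective hpj⟩))

theorem Distinct.last {j i : ι} {m : ℕ} {L t : List (ℕ × ι)} (h : Distinct j (L ++ [(m, i)]) t) :
    i ≠ j ∧ i ∉ t.map Prod.snd ∧ ∀ p ∈ L, p.2 ≠ i := by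
  unfold Distinct at h
  rw [List.map_append, List.map_singleton, List.append_assoc, List.singleton_append] at h
  have := (List.perm_middle.nodup_iff).1 h
  rw [List.nodup_cons] at this
  refine ⟨fun h => this.1 (by simp [h]), fun h => this.1 ?_, fun p hp h => this.1 ?_⟩
  · exact List.mem_append_right _ (List.mem_cons_of_mem _ h)
  · exact List.mem_append_left _ (List.mem_map.2 ⟨p, hp, h⟩)

theorem isD_one_asym (j : ι) (L t : List (ℕ × ι)) (k : ℕ) :
    IsD 1 (asym j L t (k + 1)) (asym j L t k) := by
  induction L generalizing j t with
  | nil => exact isD_one_lead j t k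
  | cons p L ih =>
    have h1 : IsD 1 (block (j : WithTop ι) (p :: L)) 0 :=
      isD_of_invariant fun x s => block_coe_scl_one j _ s x
    refine ((h1.mul (isD_one_lead j t k)).add (ih p.2 ((p.1, j) :: t))).congr_right fun x _ => ?_
    simp [asym]

theorem isD_lead_of_ne {i j : ι} {t : List (ℕ × ι)} (hj : j ≠ i) (hi : i ∉ t.map Prod.snd)
    (k : ℕ) : IsD (dir i) (lead j t k) 0 :=
  isD_of_invariant fun x s => lead_scl_dir_of_ne hj hi k s x

theorem isD_dir_asym_succ {j i : ι} {L t : List (ℕ × ι)} {m : ℕ}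
    (h : Distinct j (L ++ [(m, i)]) t) (k : ℕ) :
    IsD (dir i) (asym j (L ++ [(m + 1, i)]) t k) (asym j (L ++ [(m, i)]) t k) := by
  induction L generalizing j t with
  | nil =>
    obtain ⟨h1, h2, -⟩ := h.last
    have a1 := isD_dir_block_succ (L := []) (i := i) (e := (j : WithTop ι)) (by simp) (by simp)
      (by simpa using h1) m
    have a2 := isD_lead_succ (j := j) (t := t) m k (i := i) (by simpa using ⟨h1, by simpa using h2⟩)
    refine ((a1.mul (isD_lead_of_ne h1.symm h2 k)).add a2).congr_right fun x _ => ?_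
    simp [asym]
  | cons p L ih =>
    obtain ⟨h1, h2, h3⟩ := h.last
    have h4 : ∀ q ∈ p :: L, (q.2 : WithTop ι) ≠ j := fun q hq =>
      h.ne q (List.mem_append_left _ hq)
    have a1 := isD_dir_block_succ (L := p :: L) (e := (j : WithTop ι)) h3 h4
      (by simpa using h1) m
    refine ((a1.mul (isD_lead_of_ne h1.symm h2 k)).add (ih (h.cons))).congr_right fun x _ => ?_
    simp [asym]

theorem isD_dir_asym_singleton_zero {j i : ι} {t : List (ℕ × ι)}
    (h : Distinct j [(0, i)] t) (k : ℕ) :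
    IsD (dir i) (asym j [(0, i)] t k) (fun x =>
      geom (x i / x j) * (asym j [] t k x - asym i [] t k x) - asym i [] t k x) := by
  obtain ⟨h1, h2, -⟩ := Distinct.last (L := []) h
  have a1 := isD_dir_block_singleton_zero (i := i) (e := (j : WithTop ι)) (by simpa using h1)
  have a2 := isD_lead_zero (j := j) (t := t) k (i := i) (by simpa using ⟨h1, by simpa using h2⟩)
  refine ((a1.mul (isD_lead_of_ne h1.symm h2 k)).add a2).congr_right fun x _ => ?_
  simp only [asym, den_coe, Pi.zero_apply]
  ring

/-- In each summand whose block retains both innermost entries, `isD_dir_block_zero` applies and the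
factor `lead` is constant in x_i. The summands where the list is cut at or below j' combine by
`isD_dir_asym_singleton_zero`. Thus the whole sum obeys the equation of a single block. -/
theorem isD_dir_asym_zero {j j' i : ι} {L t : List (ℕ × ι)} {m : ℕ}
    (h : Distinct j (L ++ [(m, j'), (0, i)]) t) (k : ℕ) :
    IsD (dir i) (asym j (L ++ [(m, j'), (0, i)]) t k) (fun x =>
      geom (x i / x j') * (asym j (L ++ [(m, j')]) t k x - asym j (L ++ [(m, i)]) t k x) -
        asym j (L ++ [(m, i)]) t k x) := by
  induction L generalizing j t with
  | nil =>
    obtain ⟨h1, h2, h3⟩ := Distinct.last (L := [(m, j')]) h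
    have h4 := h.ne
    have a1 := isD_dir_block_zero (L := []) (i := i) (j := j') (e := (j : WithTop ι)) (by simp)
      (by simp) (by simpa using h1) (by simpa using h3) (by simpa using h4 (m, j') (by simp)) m
    have a2 := isD_dir_asym_singleton_zero h.cons k
    refine ((a1.mul (isD_lead_of_ne h1.symm h2 k)).add a2).congr_right fun x _ => ?_
    simp [asym]
    ring
  | cons p L ih =>
    have h' : Distinct j ((p :: L ++ [(m, j')]) ++ [(0, i)]) t := by simpa using h
    obtain ⟨h1, h2, h3⟩ := h'.last
    have h4 := h.ne
    have a1 := isD_dir_block_zero (L := p :: L) (i := i) (j := j') (m := m) (e := (j : WithTop ι))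
      (fun q hq => h3 q (List.mem_append_left _ hq)) (fun q hq => h4 q (List.mem_append_left _ hq))
      (by simpa using h1) (h3 (m, j') (by simp)) (h4 (m, j') (by simp))
    refine ((a1.mul (isD_lead_of_ne h1.symm h2 k)).add (ih h.cons)).congr_right fun x _ => ?_
    simp [asym]
    ring

/-! ### Bounds -/

theorem exists_norm_beta_scl_le {x : ι → ℂ} (hx : x ∈ Dom ι) (i : ι) (k : ℕ) :
    ∃ C, 0 ≤ C ∧ ∀ v : ℝ, ‖beta k (scl 1 v x i)‖ ≤ C * Real.exp (|v| / 4) := by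
  simpa only [scl_one_apply] using exists_norm_beta_le (hx.1 i) k

theorem scl_dir_scl_one_self (i : ι) (s v : ℝ) (x : ι → ℂ) :
    scl (dir i) s (scl 1 v x) i = x i * (Real.exp (-(s + v)) : ℝ) := by
  rw [scl_dir_self, scl_one_apply, mul_assoc, ← Complex.ofReal_mul, ← Real.exp_add]
  congr 3
  ring

theorem exists_norm_evalTerms_self_le {x : ι → ℂ} (hx : x ∈ Dom ι) {i : ι} {T : List (Term ι)}
    (hT : GoodTerms i T) : ∃ C, 0 ≤ C ∧ ∀ s v : ℝ,
      ‖evalTerms i T (scl (dir i) s (scl 1 v x))‖ ≤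
        C * (Real.exp (-s) * Real.exp (|s + v| / 4)) := by
  induction T with
  | nil => exact ⟨0, le_rfl, by simp⟩
  | cons t T ih =>
    obtain ⟨h1, h2⟩ := List.forall_mem_cons.1 hT
    obtain ⟨C, hC, h⟩ := ih h2
    obtain ⟨B, hB, hb⟩ := exists_norm_beta_le (hx.1 i) t.2.1
    obtain ⟨A, hA, ha⟩ := exists_isTame_flow (slit_map_div hx h1.2) (by simpa using h1.1)
    refine ⟨‖(t.1 : ℂ)‖ * B * A + C, by positivity, fun s v => ?_⟩
    rw [evalTerms_cons, add_mul]
    refine (norm_add_le _ _).trans (add_le_add ?_ (h s v))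
    rw [norm_mul, norm_mul, scl_dir_scl_one_self, revBlock_scl_dir h1.2]
    simp only [scl_one_apply, mul_div_mul_exp]
    calc _ ≤ ‖(t.1 : ℂ)‖ * (B * Real.exp (|s + v| / 4)) * (A * Real.exp (-s)) := by
          gcongr
          · exact hb _
          · exact ha.bound s
      _ = _ := by ring

theorem exists_norm_lead_self_sub_le {x : ι → ℂ} (hx : x ∈ Dom ι) {i : ι} {t : List (ℕ × ι)}
    (hi : i ∉ t.map Prod.snd) (k : ℕ) : ∃ C, 0 ≤ C ∧ ∀ s v : ℝ,
      ‖lead i t k (scl (dir i) s (scl 1 v x)) -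
        (-1) ^ t.length * beta (k + wt t) (x i * (Real.exp (-(s + v)) : ℝ))‖ ≤
        C * (Real.exp (-s) * Real.exp (|s + v| / 4)) := by
  obtain ⟨C, hC, h⟩ := exists_norm_evalTerms_self_le hx ((wf_decTerms t k).good hi)
  refine ⟨C, hC, fun s v => ?_⟩
  rw [lead, scl_dir_scl_one_self, add_sub_cancel_left]
  exact h s v

theorem exists_norm_evalTerms_le {x : ι → ℂ} (hx : x ∈ Dom ι) (i : ι) (T : List (Term ι)) :
    ∃ C, 0 ≤ C ∧ ∀ v : ℝ, ‖evalTerms i T (scl 1 v x)‖ ≤ C * Real.exp (|v| / 4) := by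
  induction T with
  | nil => exact ⟨0, le_rfl, by simp⟩
  | cons t T ih =>
    obtain ⟨C, hC, h⟩ := ih
    obtain ⟨B, hB, hb⟩ := exists_norm_beta_scl_le hx i t.2.1
    refine ⟨‖(t.1 : ℂ)‖ * B * ‖revBlock i t.2.2 x‖ + C, by positivity, fun v => ?_⟩
    rw [evalTerms_cons, add_mul]
    refine (norm_add_le _ _).trans (add_le_add ?_ (h v))
    rw [norm_mul, norm_mul, revBlock_scl_one]
    calc _ ≤ ‖(t.1 : ℂ)‖ * (B * Real.exp (|v| / 4)) * ‖revBlock i t.2.2 x‖ := by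
          gcongr
          exact hb _
      _ = _ := by ring

theorem exists_norm_lead_le {x : ι → ℂ} (hx : x ∈ Dom ι) (i : ι) (t : List (ℕ × ι)) (k : ℕ) :
    ∃ C, 0 ≤ C ∧ ∀ v : ℝ, ‖lead i t k (scl 1 v x)‖ ≤ C * Real.exp (|v| / 4) := by
  obtain ⟨C, hC, h⟩ := exists_norm_evalTerms_le hx i (decTerms t k)
  obtain ⟨B, hB, hb⟩ := exists_norm_beta_scl_le hx i (k + wt t)
  refine ⟨B + C, by positivity, fun v => ?_⟩
  rw [lead, add_mul]
  refine (norm_add_le _ _).trans (add_le_add ?_ (h v))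
  simpa using hb v

theorem exists_norm_asym_le {x : ι → ℂ} (hx : x ∈ Dom ι) (j : ι) (L t : List (ℕ × ι)) (k : ℕ) :
    ∃ C, 0 ≤ C ∧ ∀ v : ℝ, ‖asym j L t k (scl 1 v x)‖ ≤ C * Real.exp (|v| / 4) := by
  induction L generalizing j t with
  | nil => exact exists_norm_lead_le hx j t k
  | cons p L ih =>
    obtain ⟨C, hC, h⟩ := exists_norm_lead_le hx j t k
    obtain ⟨B, hB, hb⟩ := ih p.2 ((p.1, j) :: t)
    refine ⟨‖block (j : WithTop ι) (p :: L) x‖ * C + B, by positivity, fun v => ?_⟩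
    simp only [asym]
    rw [add_mul]
    refine (norm_add_le _ _).trans (add_le_add ?_ (hb v))
    rw [norm_mul, block_coe_scl_one, mul_assoc]
    gcongr
    exact h v

theorem exists_norm_block_last_le {x : ι → ℂ} (hx : x ∈ Dom ι) {i j : ι} {L : List (ℕ × ι)}
    (h : ∀ p ∈ L, p.2 ≠ i) (hL : ∀ p ∈ L, (p.2 : WithTop ι) ≠ j) (hij : i ≠ j) (m : ℕ) :
    ∃ C, 0 ≤ C ∧ ∀ s v : ℝ,
      ‖block (j : WithTop ι) (L ++ [(m, i)]) (scl (dir i) s (scl 1 v x))‖ ≤ C * Real.exp (-s) := by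
  have hij' : (i : WithTop ι) ≠ j := by simpa using hij
  have hs := slit_map_div_den hx hL
  obtain ⟨A, hA, ha⟩ := exists_common_bound _ hs
  obtain ⟨B, hB, hb⟩ := exists_norm_geom_le (neg_div_den_mem hx hij')
  refine ⟨A ^ (L.map fun p => (p.1, x p.2 / den (j : WithTop ι) x)).length * B, by positivity,
    fun s v => ?_⟩
  rw [block_append_scl_dir h hij']
  simp only [den_coe, scl_one_apply, mul_div_mul_exp] at *
  have := isTame_flow_append (m := m) (B := B * Real.exp (-s)) (by linarith) hs
    (neg_mul_real_mem_slitPlane (hx.2 i j hij) (Real.exp_pos (-s))) ha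
    (fun r hr => by
      rw [mul_assoc, ← Complex.ofReal_mul, mul_assoc]
      exact (hb _ (by positivity)).2)
  refine (this.bound 0).trans (le_of_eq ?_)
  simp
  ring

/-- As the innermost coordinate x_i tends to 0 relative to the others, all blocks ending in i vanish
like e^{-s}. Only the last summand `lead i` survives, through its Bernoulli term. The common scaling
v is kept because the remainder estimate moves both parameters. -/
theorem exists_norm_asym_sub_le {x : ι → ℂ} (hx : x ∈ Dom ι) {j i : ι} {L t : List (ℕ × ι)}
    {m : ℕ} (h : Distinct j (L ++ [(m, i)]) t) (k : ℕ) : ∃ C, 0 ≤ C ∧ ∀ s v : ℝ,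
      ‖asym j (L ++ [(m, i)]) t k (scl (dir i) s (scl 1 v x)) -
        (-1) ^ (t.length + L.length + 1) *
          beta (k + wt t + wt L + m + 1) (x i * (Real.exp (-(s + v)) : ℝ))‖ ≤
        C * (Real.exp (-s) * Real.exp ((|v| + |s + v|) / 4)) := by
  have key : ∀ s v : ℝ, Real.exp (|v| / 4) ≤ Real.exp ((|v| + |s + v|) / 4) := fun s v =>
    Real.exp_le_exp.2 (by have := abs_nonneg (s + v); linarith)
  have key' : ∀ s v : ℝ, Real.exp (|s + v| / 4) ≤ Real.exp ((|v| + |s + v|) / 4) := fun s v =>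
    Real.exp_le_exp.2 (by have := abs_nonneg v; linarith)
  have hprod : ∀ {j : ι} {L t : List (ℕ × ι)}, Distinct j (L ++ [(m, i)]) t →
      ∃ C, 0 ≤ C ∧ ∀ s v : ℝ, ‖block (j : WithTop ι) (L ++ [(m, i)]) (scl (dir i) s (scl 1 v x)) *
        lead j t k (scl (dir i) s (scl 1 v x))‖ ≤
          C * (Real.exp (-s) * Real.exp ((|v| + |s + v|) / 4)) := by
    intro j L t h
    obtain ⟨h1, h2, h3⟩ := h.last
    obtain ⟨A, hA, ha⟩ := exists_norm_block_last_le hx h3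
      (fun q hq => h.ne q (List.mem_append_left _ hq)) h1 m
    obtain ⟨B, hB, hb⟩ := exists_norm_lead_le hx j t k
    refine ⟨A * B, by positivity, fun s v => ?_⟩
    rw [norm_mul, lead_scl_dir_of_ne h1.symm h2]
    calc _ ≤ (A * Real.exp (-s)) * (B * Real.exp ((|v| + |s + v|) / 4)) := by
          gcongr
          · exact ha s v
          · exact (hb v).trans (mul_le_mul_of_nonneg_left (key s v) hB)
      _ = _ := by ring
  induction L generalizing j t with
  | nil =>
    obtain ⟨h1, h2, -⟩ := h.last
    obtain ⟨C, hC, hc⟩ := hprod h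
    obtain ⟨B, hB, hb⟩ := exists_norm_lead_self_sub_le hx (i := i) (t := (m, j) :: t)
      (by simpa using ⟨h1, by simpa using h2⟩) k
    refine ⟨C + B, by positivity, fun s v => ?_⟩
    simp only [asym, List.nil_append] at *
    rw [add_sub_assoc, add_mul]
    refine (norm_add_le _ _).trans (add_le_add (hc s v) ?_)
    have := (hb s v).trans (mul_le_mul_of_nonneg_left
      (mul_le_mul_of_nonneg_left (key' s v) (Real.exp_pos (-s)).le) hB)
    rw [show k + wt t + wt ([] : List (ℕ × ι)) + m + 1 = k + wt ((m, j) :: t) by simp; omega]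
    exact this
  | cons p L ih =>
    obtain ⟨C, hC, hc⟩ := hprod h
    obtain ⟨B, hB, hb⟩ := ih h.cons
    refine ⟨C + B, by positivity, fun s v => ?_⟩
    simp only [asym, List.cons_append] at *
    rw [add_sub_assoc, add_mul]
    refine (norm_add_le _ _).trans (add_le_add (hc s v) ?_)
    rw [show k + wt t + wt (p :: L) + m + 1 = k + wt ((p.1, j) :: t) + wt L + m + 1 by
        simp; omega,
      show t.length + (p :: L).length + 1 = ((p.1, j) :: t).length + L.length + 1 by
        simp; omega]
    exact hb s v

/-! ### The lowest index -/

theorem raiseTerms_iterate_single (m n : ℕ) (j : ι) (c : ℤ) :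
    raiseTerms^[n] [(c, 0, [(m, j)])] = [(c, 0, [(m + n, j)])] := by
  induction n with
  | zero => rfl
  | succ n ih =>
    rw [Function.iterate_succ_apply', ih]
    simp [raiseTerms, primTerm]
    ring

/-- The decaying part of the second `lead` is minus the depth one polylogarithm at x_i / x_j, and
cancels the block; the Bernoulli term remains. -/
theorem asym_singleton_zero (j i : ι) (m : ℕ) (x : ι → ℂ) :
    asym j [(m, i)] [] 0 x = -asym i [] [] (m + 1) x := by
  have h1 : decTerms [(m, j)] 0 = [(-1, 0, [(m, j)])] := by
    have h2 : raiseTerms^[m] [((-1 : ℤ), 0, [(0, j)])] = [(-1, 0, [(m, j)])] := by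
      rw [raiseTerms_iterate_single, zero_add]
    rw [← h2]
    simp [decTerms, raiseTerms, geomTerms, primTerm, negTerms]
  simp only [asym, lead_nil, beta_zero]
  simp only [lead, h1, evalTerms_cons, evalTerms_nil]
  simp [block, revBlock]

theorem Distinct.tail {j : ι} {p : ℕ × ι} {L : List (ℕ × ι)} (h : Distinct j (p :: L) []) :
    Distinct p.2 L [] := by
  have := h.cons
  unfold Distinct at *
  exact this.sublist (by simp)

theorem Distinct.congr_last {j i : ι} {L t : List (ℕ × ι)} {m : ℕ}
    (h : Distinct j (L ++ [(m, i)]) t) (m' : ℕ) : Distinct j (L ++ [(m', i)]) t := by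
  unfold Distinct at *
  simpa using h

/-- Induction on the weight by differentiating in the innermost coordinate. Both expressions obey
equations of the same form, so the derivative of their sum consists of sums of the same kind and of
smaller weight, which vanish. -/
theorem asym_lowest_aux (w : ℕ) : ∀ (L : List (ℕ × ι)) (j i : ι) (m : ℕ),
    wt ((m, i) :: L) ≤ w → Distinct j ((m, i) :: L) [] → ∀ x ∈ Dom ι,
    asym j ((m, i) :: L) [] 0 x + asym i L [] (m + 1) x = 0 := by
  induction w with
  | zero => intro L j i m h; simp at h
  | succ w ih =>
    intro L j i m hw hd x hx
    rcases List.eq_nil_or_concat L with rfl | ⟨L', ⟨m₁, i₁⟩, rfl⟩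
    · rw [asym_singleton_zero]; simp
    rw [List.concat_eq_append] at *
    have hd' : Distinct i (L' ++ [(m₁, i₁)]) [] := hd.tail
    have key : IsD (dir i₁) (fun x => asym j ((m, i) :: (L' ++ [(m₁, i₁)])) [] 0 x +
        asym i (L' ++ [(m₁, i₁)]) [] (m + 1) x) 0 := by
      rcases m₁ with _ | m₁
      · rcases List.eq_nil_or_concat L' with rfl | ⟨L'', ⟨m₂, i₂⟩, rfl⟩
        · have h1 := isD_dir_asym_zero (L := []) hd 0
          have h2 := isD_dir_asym_singleton_zero hd' (m + 1)
          have b1 := ih [] j i m (by simp at hw ⊢; omega) (by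
            unfold Distinct at *; exact hd.sublist (by simp))
          have b2 := ih [] j i₁ m (by simp at hw ⊢; omega) (by
            unfold Distinct at *; exact hd.sublist (by simp))
          refine (h1.add h2).congr_right fun x hx => ?_
          have c1 := b1 x hx
          have c2 := b2 x hx
          simp only [List.nil_append, Pi.zero_apply] at *
          linear_combination geom (x i₁ / x i) * (c1 - c2) - c2
        · rw [List.concat_eq_append, List.append_assoc, List.singleton_append] at *
          have h1 := isD_dir_asym_zero (L := (m, i) :: L'') hd 0
          have h2 := isD_dir_asym_zero hd' (m + 1)
          have b1 := ih (L'' ++ [(m₂, i₂)]) j i m (by simp at hw ⊢; omega) (by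
            unfold Distinct at *; exact hd.sublist (by simp))
          have b2 := ih (L'' ++ [(m₂, i₁)]) j i m (by simp at hw ⊢; omega) (by
            unfold Distinct at *; exact hd.sublist (by simp))
          refine (h1.add h2).congr_right fun x hx => ?_
          have c1 := b1 x hx
          have c2 := b2 x hx
          simp only [List.cons_append, Pi.zero_apply] at *
          linear_combination geom (x i₁ / x i₂) * (c1 - c2) - c2
      · have h1 := isD_dir_asym_succ (L := (m, i) :: L') (m := m₁) (hd.congr_last (L := (m, i) :: L') m₁) 0
        have h2 := isD_dir_asym_succ (m := m₁) (hd'.congr_last m₁) (m + 1)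
        have b := ih (L' ++ [(m₁, i₁)]) j i m (by simp at hw ⊢; omega)
          (hd.congr_last (L := (m, i) :: L') m₁)
        refine (h1.add h2).congr_right fun x hx => ?_
        exact b x hx
    -- As x_{i₁} tends to 0, both expressions approach the same Bernoulli function, with opposite
    -- signs since the two lists differ in length by one.
    refine key.eq_zero_of_tendsto hx (l := atTop) ?_
    obtain ⟨A, hA, ha⟩ := exists_norm_asym_sub_le (L := (m, i) :: L') hx hd 0
    obtain ⟨B, hB, hb⟩ := exists_norm_asym_sub_le hx hd' (m + 1)
    have hlim : Tendsto (fun s : ℝ => (A + B) * Real.exp (-(s / 2))) atTop (𝓝 0) := by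
      have := (Real.tendsto_exp_neg_atTop_nhds_zero.comp
        (tendsto_id.atTop_div_const (two_pos (α := ℝ)))).const_mul (A + B)
      simpa using this
    refine squeeze_zero_norm' ?_ hlim
    filter_upwards [eventually_ge_atTop 0] with s hs
    have a1 := ha s 0
    have b1 := hb s 0
    have he : Real.exp (-s) * Real.exp ((|(0 : ℝ)| + |s + 0|) / 4) ≤ Real.exp (-(s / 2)) := by
      rw [← Real.exp_add, abs_zero, add_zero, abs_of_nonneg hs]
      exact Real.exp_le_exp.2 (by linarith)
    rw [scl_zero] at a1 b1
    have e1 : 0 + wt ([] : List (ℕ × ι)) + wt ((m, i) :: L') + m₁ + 1 =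
        m + 1 + wt ([] : List (ℕ × ι)) + wt L' + m₁ + 1 := by simp
    rw [e1] at a1
    set b := beta (m + 1 + wt ([] : List (ℕ × ι)) + wt L' + m₁ + 1)
      (x i₁ * (Real.exp (-(s + 0)) : ℝ))
    calc _ = ‖(asym j ((m, i) :: L' ++ [(m₁, i₁)]) [] 0 (scl (dir i₁) s x) -
          (-1) ^ (([] : List (ℕ × ι)).length + ((m, i) :: L').length + 1) * b) +
          (asym i (L' ++ [(m₁, i₁)]) [] (m + 1) (scl (dir i₁) s x) -
          (-1) ^ (([] : List (ℕ × ι)).length + L'.length + 1) * b)‖ := by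
            congr 1
            simp only [List.length_cons, List.cons_append]
            ring
      _ ≤ A * Real.exp (-(s / 2)) + B * Real.exp (-(s / 2)) := by
            refine (norm_add_le _ _).trans (add_le_add ?_ ?_)
            · exact a1.trans (mul_le_mul_of_nonneg_left he hA)
            · exact b1.trans (mul_le_mul_of_nonneg_left he hB)
      _ = _ := by ring

theorem asym_lowest {L : List (ℕ × ι)} {j i : ι} {m : ℕ} (h : Distinct j ((m, i) :: L) [])
    {x : ι → ℂ} (hx : x ∈ Dom ι) :
    asym j ((m, i) :: L) [] 0 x = -asym i L [] (m + 1) x :=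
  eq_neg_of_add_eq_zero_left (asym_lowest_aux _ L j i m le_rfl h x hx)

end MPL

/-! ### Exponential smallness of polylogarithm minus expansion. -/

namespace MPL

variable {ι : Type*}

/-! ### Decay of the remainder -/

/-- The logarithmic asymptotic expansion of `block ⊤ L` for large arguments. -/
noncomputable def expansion : List (ℕ × ι) → (ι → ℂ) → ℂ
  | [] => 1
  | (m, j) :: L => fun x => -asym j L [] (m + 1) x

/-- The remainder of the asymptotic expansion. -/
noncomputable def remainder (L : List (ℕ × ι)) (x : ι → ℂ) : ℂ := block ⊤ L x - expansion L x

@[simp] theorem remainder_nil (x : ι → ℂ) : remainder [] x = 0 := by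
  simp [remainder, expansion]

theorem distinct_of_nodup {p : ℕ × ι} {L : List (ℕ × ι)} (h : ((p :: L).map Prod.snd).Nodup) :
    Distinct p.2 L [] := by
  rw [Distinct, List.map_nil, List.nodup_append_comm]
  exact h

theorem isD_one_expansion_succ (m : ℕ) (j : ι) (L : List (ℕ × ι)) :
    IsD 1 (expansion ((m + 1, j) :: L)) (expansion ((m, j) :: L)) :=
  (isD_one_asym j L [] (m + 1)).neg

/-- This is the equation of `block ⊤` with geom(x_j) replaced by its limit -1 at infinity.
Differentiation leads to `asym` with k = 0, which `asym_lowest` identifies with the expansion of the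
shorter list. -/
theorem isD_one_expansion_zero {j : ι} {L : List (ℕ × ι)}
    (h : (((0, j) :: L).map Prod.snd).Nodup) :
    IsD 1 (expansion ((0, j) :: L)) (fun x => -expansion L x) := by
  refine (isD_one_asym j L [] 0).neg.congr_right fun x hx => ?_
  cases L with
  | nil => simp [asym, expansion, lead_nil]
  | cons p L =>
    rw [asym_lowest (distinct_of_nodup h) hx]
    simp [expansion]

theorem isD_one_remainder_succ (m : ℕ) (j : ι) (L : List (ℕ × ι)) :
    IsD 1 (remainder ((m + 1, j) :: L)) (remainder ((m, j) :: L)) :=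
  (isD_one_block_succ m j L).sub (isD_one_expansion_succ m j L)

theorem isD_one_remainder_zero {j : ι} {L : List (ℕ × ι)}
    (h : (((0, j) :: L).map Prod.snd).Nodup) :
    IsD 1 (remainder ((0, j) :: L))
      (fun x => geom (x j) * remainder L x + (1 + geom (x j)) * expansion L x) :=
  ((isD_one_block_zero j L).sub (isD_one_expansion_zero h)).congr_right fun x _ => by
    simp only [remainder]
    ring

theorem isD_dir_remainder_succ {i : ι} {p : ℕ × ι} {L : List (ℕ × ι)} {m : ℕ}
    (h : ((p :: L ++ [(m, i)]).map Prod.snd).Nodup) :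
    IsD (dir i) (remainder (p :: L ++ [(m + 1, i)])) (remainder (p :: L ++ [(m, i)])) := by
  have hd : Distinct p.2 (L ++ [(m, i)]) [] := distinct_of_nodup h
  have h1 : ∀ q ∈ p :: L, q.2 ≠ i := by
    obtain ⟨a, -, b⟩ := hd.last
    exact List.forall_mem_cons.2 ⟨a.symm, b⟩
  exact (isD_dir_block_succ h1 (by simp) (by simp) m).sub (isD_dir_asym_succ hd _).neg

theorem isD_dir_remainder_zero {i j : ι} {L : List (ℕ × ι)} {m : ℕ}
    (h : ((L ++ [(m, j), (0, i)]).map Prod.snd).Nodup) :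
    IsD (dir i) (remainder (L ++ [(m, j), (0, i)])) (fun x =>
      geom (x i / x j) * (remainder (L ++ [(m, j)]) x - remainder (L ++ [(m, i)]) x) -
        remainder (L ++ [(m, i)]) x) := by
  rcases L with _ | ⟨p, L⟩
  · have hd : Distinct j [(0, i)] [] := distinct_of_nodup h
    have h1 : j ≠ i := (Distinct.last (L := []) hd).1.symm
    have a1 := isD_dir_block_zero (L := []) (i := i) (j := j) (e := ⊤) (by simp)
      (by simp) (by simp) h1 (by simp) m
    have a2 := (isD_dir_asym_singleton_zero hd (m + 1)).neg
    refine (a1.sub a2).congr_right fun x _ => ?_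
    simp only [remainder, expansion, List.nil_append]
    ring
  · have hd : Distinct p.2 (L ++ [(m, j), (0, i)]) [] := distinct_of_nodup h
    have hd' : Distinct p.2 ((L ++ [(m, j)]) ++ [(0, i)]) [] := by simpa using hd
    obtain ⟨h1, -, h2⟩ := hd'.last
    have h3 : ∀ q ∈ p :: L, q.2 ≠ i := List.forall_mem_cons.2
      ⟨h1.symm, fun q hq => h2 q (List.mem_append_left _ hq)⟩
    have a1 := isD_dir_block_zero (L := p :: L) (i := i) (j := j) (e := ⊤) h3
      (by simp) (by simp) (h2 (m, j) (by simp)) (by simp) m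
    have a2 := (isD_dir_asym_zero hd (p.1 + 1)).neg
    refine (a1.sub a2).congr_right fun x _ => ?_
    simp only [remainder, expansion, List.cons_append]
    ring

theorem exists_norm_expansion_add_le {x : ι → ℂ} (hx : x ∈ Dom ι) {i : ι} {L : List (ℕ × ι)}
    {m : ℕ} (h : ((L ++ [(m, i)]).map Prod.snd).Nodup) : ∃ C, 0 ≤ C ∧ ∀ s v : ℝ,
      ‖expansion (L ++ [(m, i)]) (scl (dir i) s (scl 1 v x)) + (-1) ^ L.length *
          beta (m + wt L + 1) (x i * (Real.exp (-(s + v)) : ℝ))‖ ≤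
        C * (Real.exp (-s) * Real.exp ((|v| + |s + v|) / 4)) := by
  rcases L with _ | ⟨p, L⟩
  · refine ⟨0, le_rfl, fun s v => ?_⟩
    simp [expansion, asym, lead_nil, scl_dir_scl_one_self]
  · obtain ⟨C, hC, hc⟩ := exists_norm_asym_sub_le hx (distinct_of_nodup h) (p.1 + 1)
    refine ⟨C, hC, fun s v => ?_⟩
    rw [← norm_neg]
    refine (congrArg norm ?_).trans_le (hc s v)
    rw [show m + wt (p :: L) + 1 = p.1 + 1 + wt ([] : List (ℕ × ι)) + wt L + m + 1 by
      simp; ring]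
    simp only [expansion, List.cons_append, List.length_cons, List.length_nil]
    ring

theorem norm_sub_le_of_deriv_le_exp {g g' : ℝ → ℂ} {a b c C : ℝ} (hab : a ≤ b)
    (hg : ∀ t, HasDerivAt g (g' t) t)
    (hb : ∀ t, a ≤ t → t ≤ b → ‖g' t‖ ≤ C * Real.exp ((t + c) / 2)) (hC : 0 ≤ C) :
    ‖g b - g a‖ ≤ 2 * C * Real.exp ((b + c) / 2) := by
  have hB : ∀ t : ℝ, HasDerivAt (fun t => 2 * C * Real.exp ((t + c) / 2) -
      2 * C * Real.exp ((a + c) / 2)) (C * Real.exp ((t + c) / 2)) t := fun t => by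
    have h1 := ((((hasDerivAt_id t).add_const c).div_const 2).exp).const_mul (2 * C)
    convert! h1.sub_const (2 * C * Real.exp ((a + c) / 2)) using 1
    simp
    ring
  have := image_norm_le_of_norm_deriv_right_le_deriv_boundary (f := fun t => g t - g a) (f' := g')
    (a := a) (b := b)
    (fun t _ => ((hg t).sub_const (g a)).continuousAt.continuousWithinAt)
    (fun t _ => ((hg t).sub_const (g a)).hasDerivWithinAt) (by simp) hB
    (fun t ht => hb t ht.1 ht.2.le) (right_mem_Icc.2 hab)
  have h0 : 0 ≤ 2 * C * Real.exp ((a + c) / 2) := by positivity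
  linarith

/-- Connect (s, v) to (S, s + v - S) by first lowering v and then raising s. On this path s ≥ 0 and
the sum of the coordinates never exceeds its initial value, so each leg costs at most twice its
constant times e^{(s+v)/2}. Letting S → ∞ compares φ with its limit ψ. -/
theorem norm_le_of_partial_derivs {φ φs φv : ℝ → ℝ → ℂ} {ψ : ℝ → ℂ} {A B C : ℝ}
    (hs : ∀ s v, HasDerivAt (fun s => φ s v) (φs s v) s)
    (hv : ∀ s v, HasDerivAt (fun v => φ s v) (φv s v) v)
    (hA : 0 ≤ A) (hB : 0 ≤ B)
    (hbs : ∀ s v, 0 ≤ s → s + v ≤ 0 → ‖φs s v‖ ≤ A * Real.exp ((s + v) / 2))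
    (hbv : ∀ s v, 0 ≤ s → s + v ≤ 0 → ‖φv s v‖ ≤ B * Real.exp ((s + v) / 2))
    (hψ : ∀ u ≤ 0, Tendsto (fun s => φ s (u - s)) atTop (𝓝 (ψ u)))
    (hbψ : ∀ u ≤ 0, ‖ψ u‖ ≤ C * Real.exp (u / 2)) (s v : ℝ) (h0 : 0 ≤ s) (h1 : s + v ≤ 0) :
    ‖φ s v‖ ≤ (2 * A + 2 * B + C) * Real.exp ((s + v) / 2) := by
  have key : ∀ᶠ S in atTop, ‖φ s v - φ S (s + v - S)‖ ≤
      (2 * A + 2 * B) * Real.exp ((s + v) / 2) := by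
    filter_upwards [eventually_ge_atTop s] with S hS
    have e1 := norm_sub_le_of_deriv_le_exp (a := s + v - S) (b := v) (c := s) (by linarith)
      (hv s) (fun t ht ht' => by
        rw [add_comm t s]
        exact hbv s t h0 (by linarith)) hB
    have e2 := norm_sub_le_of_deriv_le_exp (g := fun s' => φ s' (s + v - S)) (a := s) (b := S)
      (c := s + v - S) hS
      (fun t => hs t _) (fun t ht ht' => hbs t _ (by linarith) (by linarith)) hA
    rw [add_comm v s] at e1
    rw [show S + (s + v - S) = s + v by ring] at e2
    calc _ = ‖(φ s v - φ s (s + v - S)) - (φ S (s + v - S) - φ s (s + v - S))‖ := by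
          congr 1; ring
      _ ≤ _ := (norm_sub_le _ _).trans (by linarith)
  have h2 : ‖φ s v - ψ (s + v)‖ ≤ (2 * A + 2 * B) * Real.exp ((s + v) / 2) :=
    le_of_tendsto ((tendsto_const_nhds.sub (hψ _ h1)).norm) key
  have h3 := hbψ _ h1
  calc ‖φ s v‖ = ‖(φ s v - ψ (s + v)) + ψ (s + v)‖ := by rw [sub_add_cancel]
    _ ≤ _ := (norm_add_le _ _).trans (by linarith)

theorem scl_comm (δ δ' : ι → ℝ) (s v : ℝ) (x : ι → ℂ) :
    scl δ s (scl δ' v x) = scl δ' v (scl δ s x) := by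
  funext a
  simp only [scl]
  ring

theorem wt_map {α β : Type*} (L : List (ℕ × α)) (f : α → β) :
    wt (L.map fun p => (p.1, f p.2)) = wt L := by
  simp [wt, Function.comp_def]

theorem tendsto_block_scl {x : ι → ℂ} (hx : x ∈ Dom ι) {i : ι} {L : List (ℕ × ι)}
    {m : ℕ} (h : ∀ p ∈ L, p.2 ≠ i) (u : ℝ) :
    Tendsto (fun s => block ⊤ (L ++ [(m, i)]) (scl (dir i) s (scl 1 (u - s) x))) atTop
      (𝓝 ((-1) ^ L.length * flow [(m + wt L, x i * (Real.exp (-u) : ℝ))] 0)) := by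
  have hs : Slit (L.map fun p => (p.1, x p.2 * (Real.exp (-u) : ℝ))) := fun q hq => by
    obtain ⟨p, -, rfl⟩ := List.mem_map.1 hq
    exact neg_mul_real_mem_slitPlane (hx.1 p.2) (Real.exp_pos _)
  have h1 := tendsto_flow_scale hs (m := m)
    (neg_mul_real_mem_slitPlane (hx.1 i) (Real.exp_pos (-u))) 0
  rw [List.length_map, wt_map L fun a => x a * (Real.exp (-u) : ℝ)] at h1
  refine h1.congr fun s => ?_
  rw [block_append_scl_dir h (by simp), scaleList, List.map_map]
  simp only [den_top, div_one, scl_one_apply]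
  congr 2
  · refine List.map_congr_left fun p _ => ?_
    simp only [Function.comp, mul_assoc, ← Complex.ofReal_mul, ← Real.exp_add]
    congr 5
    ring
  · simp only [mul_assoc, ← Complex.ofReal_mul, ← Real.exp_add]
    congr 5
    ring

/-- The innermost coordinate stays at x_i e^{-u} while the others tend to ∞. The block tends to a
signed depth one polylogarithm and the expansion to minus the matching Bernoulli function. By depth
one inversion their difference is a polylogarithm of the inverse, hence small for u → -∞. -/
theorem tendsto_remainder_scl {x : ι → ℂ} (hx : x ∈ Dom ι) {i : ι} {L : List (ℕ × ι)}
    {m : ℕ} (h : ((L ++ [(m, i)]).map Prod.snd).Nodup) {u : ℝ} (hu : u ≤ 0) :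
    Tendsto (fun s => remainder (L ++ [(m, i)]) (scl (dir i) s (scl 1 (u - s) x))) atTop
      (𝓝 ((-1) ^ L.length * ((-1) ^ (m + wt L) * flow [(m + wt L, (x i)⁻¹)] (-u)))) := by
  have hne : ∀ p ∈ L, p.2 ≠ i := fun p hp hpi => by
    rw [List.map_append, List.nodup_append] at h
    exact h.2.2 p.2 (List.mem_map_of_mem hp) i (by simp) hpi
  have hxu : -(x i * (Real.exp (-u) : ℝ)) ∈ slitPlane :=
    neg_mul_real_mem_slitPlane (hx.1 i) (Real.exp_pos _)
  obtain ⟨C, hC, hc⟩ := exists_norm_expansion_add_le hx h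
  have h1 : Tendsto (fun s => expansion (L ++ [(m, i)]) (scl (dir i) s (scl 1 (u - s) x)) +
      (-1) ^ L.length * beta (m + wt L + 1) (x i * (Real.exp (-u) : ℝ))) atTop (𝓝 0) := by
    have hlim : Tendsto (fun s : ℝ => C * Real.exp (-u) * Real.exp (-(s / 2))) atTop (𝓝 0) := by
      have := (Real.tendsto_exp_neg_atTop_nhds_zero.comp
        (tendsto_id.atTop_div_const (two_pos (α := ℝ)))).const_mul (C * Real.exp (-u))
      simpa using this
    refine squeeze_zero_norm' ?_ hlim
    filter_upwards [eventually_ge_atTop 0] with s hs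
    have := hc s (u - s)
    rw [add_sub_cancel] at this
    refine this.trans ?_
    rw [mul_assoc, ← Real.exp_add, ← Real.exp_add]
    refine mul_le_mul_of_nonneg_left (Real.exp_le_exp.2 ?_) hC
    rw [abs_of_nonpos hu, abs_of_nonpos (by linarith)]
    linarith
  have h2 := (tendsto_block_scl hx (m := m) hne u).sub h1
  have h3 := flow_inversion (m + wt L) hxu
  have h4 : (x i * (Real.exp (-u) : ℝ))⁻¹ = (x i)⁻¹ * (Real.exp (-(-u)) : ℝ) := by
    rw [mul_inv, ← Complex.ofReal_inv, ← Real.exp_neg]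
  rw [h4, flow_singleton_scale _ (x i)⁻¹, zero_add] at h3
  have h5 := h2.add_const
    ((-1) ^ L.length * beta (m + wt L + 1) (x i * (Real.exp (-u) : ℝ)))
  rw [sub_zero, ← mul_add, h3] at h5
  refine h5.congr fun s => ?_
  rw [remainder]
  ring

theorem exists_norm_one_add_geom_le {x : ℂ} (hx : -x ∈ slitPlane) :
    ∃ A : ℝ, 0 ≤ A ∧ ∀ v : ℝ, ‖1 + geom (x * (Real.exp (-v) : ℝ))‖ ≤ A * Real.exp v := by
  obtain ⟨A, hA, h⟩ := exists_norm_geom_le (neg_inv_mem_slitPlane hx)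
  refine ⟨A, hA, fun v => ?_⟩
  have h1 := geom_inv (neg_mul_real_mem_slitPlane hx (Real.exp_pos (-v)))
  have h2 : (x * (Real.exp (-v) : ℝ))⁻¹ = x⁻¹ * (Real.exp v : ℝ) := by
    rw [mul_inv, ← Complex.ofReal_inv, ← Real.exp_neg, neg_neg]
  rw [← norm_neg, ← h1, h2]
  exact (h _ (Real.exp_pos v)).2

theorem exists_norm_expansion_le {x : ι → ℂ} (hx : x ∈ Dom ι) {i : ι} {L : List (ℕ × ι)}
    {m : ℕ} (h : ((L ++ [(m, i)]).map Prod.snd).Nodup) : ∃ C, 0 ≤ C ∧ ∀ s v : ℝ,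
      0 ≤ s → s + v ≤ 0 →
      ‖expansion (L ++ [(m, i)]) (scl (dir i) s (scl 1 v x))‖ ≤ C * Real.exp (-(s + v) / 2) := by
  obtain ⟨C, hC, hc⟩ := exists_norm_expansion_add_le hx h
  obtain ⟨B, hB, hb⟩ := exists_norm_beta_le (hx.1 i) (m + wt L + 1)
  refine ⟨C + B, by positivity, fun s v hs hsv => ?_⟩
  have h1 := hc s v
  have h2 := hb (s + v)
  rw [← Real.exp_add, abs_of_nonpos hsv, abs_of_nonpos (by linarith)] at h1
  rw [abs_of_nonpos hsv] at h2
  have e1 : Real.exp (-s + (-v + -(s + v)) / 4) ≤ Real.exp (-(s + v) / 2) :=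
    Real.exp_le_exp.2 (by linarith)
  have e2 : Real.exp (-(s + v) / 4) ≤ Real.exp (-(s + v) / 2) :=
    Real.exp_le_exp.2 (by linarith)
  have h3 := norm_sub_le (expansion (L ++ [(m, i)]) (scl (dir i) s (scl 1 v x)) +
    (-1) ^ L.length * beta (m + wt L + 1) (x i * (Real.exp (-(s + v)) : ℝ)))
    ((-1) ^ L.length * beta (m + wt L + 1) (x i * (Real.exp (-(s + v)) : ℝ)))
  rw [add_sub_cancel_right, norm_mul, norm_pow, norm_neg, norm_one, one_pow, one_mul] at h3
  rw [add_mul]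
  exact h3.trans (add_le_add (h1.trans (mul_le_mul_of_nonneg_left e1 hC))
    (h2.trans (mul_le_mul_of_nonneg_left e2 hB)))

theorem asym_scl_dir_of_ne {i j : ι} {L t : List (ℕ × ι)} (hj : j ≠ i) (hL : ∀ p ∈ L, p.2 ≠ i)
    (ht : i ∉ t.map Prod.snd) (k : ℕ) (s : ℝ) (x : ι → ℂ) :
    asym j L t k (scl (dir i) s x) = asym j L t k x := by
  induction L generalizing j t with
  | nil => exact lead_scl_dir_of_ne hj ht k s x
  | cons p L ih =>
    obtain ⟨hp, hL'⟩ := List.forall_mem_cons.1 hL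
    simp only [asym]
    rw [lead_scl_dir_of_ne hj ht, block_scl_dir_of_ne hL (by simpa using hj.symm),
      ih hp hL' (by simpa using ⟨hj.symm, by simpa using ht⟩)]

theorem remainder_scl_dir_of_ne {i : ι} {L : List (ℕ × ι)} (hL : ∀ p ∈ L, p.2 ≠ i) (s : ℝ)
    (x : ι → ℂ) : remainder L (scl (dir i) s x) = remainder L x := by
  rcases L with _ | ⟨p, L⟩
  · simp
  · obtain ⟨hp, hL'⟩ := List.forall_mem_cons.1 hL
    simp only [remainder, expansion]
    rw [block_scl_dir_of_ne hL (by simp), asym_scl_dir_of_ne hp hL' (by simp)]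

/-- The remainder decays for large arguments, uniformly with respect to the last index. -/
theorem exists_norm_remainder_append_le {x : ι → ℂ} (hx : x ∈ Dom ι) (w : ℕ) :
    ∀ {i : ι} {L : List (ℕ × ι)} {m : ℕ}, wt (L ++ [(m, i)]) ≤ w →
      ((L ++ [(m, i)]).map Prod.snd).Nodup →
      ∃ C, 0 ≤ C ∧ ∀ s v : ℝ, 0 ≤ s → s + v ≤ 0 →
        ‖remainder (L ++ [(m, i)]) (scl (dir i) s (scl 1 v x))‖ ≤ C * Real.exp ((s + v) / 2) := by
  induction w with
  | zero => intro i L m h; simp at h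
  | succ w ih =>
    intro i L m hw hn
    have hmem : ∀ s v, scl (dir i) s (scl 1 v x) ∈ Dom ι := fun s v =>
      scl_mem_dom (scl_mem_dom hx _ _) _ _
    obtain ⟨K, hK, hk⟩ := exists_isTame_flow (L := [(m + wt L, (x i)⁻¹)])
      (by simpa [Slit] using neg_inv_mem_slitPlane (hx.1 i)) (by simp)
    have hKb : ∀ u ≤ 0, ‖(-1 : ℂ) ^ L.length * ((-1) ^ (m + wt L) *
        flow [(m + wt L, (x i)⁻¹)] (-u))‖ ≤ K * Real.exp (u / 2) := fun u hu => by
      rw [norm_mul, norm_mul, norm_pow, norm_pow, norm_neg, norm_one, one_pow, one_pow, one_mul,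
        one_mul]
      refine (hk.bound (-u)).trans (mul_le_mul_of_nonneg_left (Real.exp_le_exp.2 ?_) hK)
      linarith
    rcases L with _ | ⟨p, L⟩
    -- In depth one the remainder is exactly the polylogarithm of the inverse.
    · refine ⟨K, hK, fun s v hs hsv => ?_⟩
      have h1 : ∀ s v, remainder ([] ++ [(m, i)]) (scl (dir i) s (scl 1 v x)) =
          (-1) ^ m * flow [(m, (x i)⁻¹)] (-(s + v)) := fun s v => by
        have h4 : (x i * (Real.exp (-(s + v)) : ℝ))⁻¹ =
            (x i)⁻¹ * (Real.exp (-(-(s + v))) : ℝ) := by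
          rw [mul_inv, ← Complex.ofReal_inv, ← Real.exp_neg]
        have h3 := flow_inversion m (neg_mul_real_mem_slitPlane (hx.1 i) (Real.exp_pos (-(s + v))))
        rw [h4, flow_singleton_scale _ (x i)⁻¹, zero_add] at h3
        rw [← h3]
        simp [remainder, expansion, asym, lead_nil, scl_dir_scl_one_self, block]
      rw [h1]
      simpa using hKb (s + v) hsv
    -- the derivative in the direction of all coordinates
    have hone : ∃ D : (ι → ℂ) → ℂ, IsD 1 (remainder (p :: L ++ [(m, i)])) D ∧ ∃ C, 0 ≤ C ∧
        ∀ s v : ℝ, 0 ≤ s → s + v ≤ 0 → ‖-D (scl 1 v (scl (dir i) s x))‖ ≤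
          C * Real.exp ((s + v) / 2) := by
      simp only [← scl_comm (dir i) 1, norm_neg]
      obtain ⟨a, j⟩ := p
      rcases a with _ | a
      · refine ⟨_, isD_one_remainder_zero hn, ?_⟩
        have hij : j ≠ i := by
          have := (distinct_of_nodup hn)
          exact this.last.1.symm
        have hn' : ((L ++ [(m, i)]).map Prod.snd).Nodup := (List.nodup_cons.1 hn).2
        obtain ⟨C, hC, hc⟩ := ih (L := L) (m := m) (i := i) (by simp at hw ⊢; omega) hn'
        obtain ⟨A, hA, ha⟩ := exists_norm_geom_le (hx.1 j)
        obtain ⟨B, hB, hb⟩ := exists_norm_one_add_geom_le (hx.1 j)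
        obtain ⟨E, hE, he⟩ := exists_norm_expansion_le hx hn'
        refine ⟨A * C + B * E, by positivity, fun s v hs hsv => ?_⟩
        rw [scl_dir_of_ne hij, scl_one_apply]
        refine (norm_add_le _ _).trans ?_
        rw [add_mul (A * C), norm_mul, norm_mul]
        refine add_le_add ?_ ?_
        · rw [mul_assoc]
          exact mul_le_mul (ha _ (Real.exp_pos _)).1 (hc s v hs hsv) (norm_nonneg _) hA
        -- Here 1 + geom(x_j) is of size e^v and outweighs the growth e^{-(s+v)/2} of the expansion,
        -- because v ≤ s + v.
        · refine (mul_le_mul (hb v) (he s v hs hsv) (norm_nonneg _) (by positivity)).trans ?_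
          rw [mul_mul_mul_comm, ← Real.exp_add]
          exact mul_le_mul_of_nonneg_left (Real.exp_le_exp.2 (by linarith)) (by positivity)
      · exact ⟨_, isD_one_remainder_succ a j _, ih (L := (a, j) :: L) (m := m) (i := i)
          (by simp at hw ⊢; omega) (by simpa using hn)⟩
    have hdir : ∃ D : (ι → ℂ) → ℂ, IsD (dir i) (remainder (p :: L ++ [(m, i)])) D ∧ ∃ C, 0 ≤ C ∧
        ∀ s v : ℝ, 0 ≤ s → s + v ≤ 0 → ‖-D (scl (dir i) s (scl 1 v x))‖ ≤
          C * Real.exp ((s + v) / 2) := by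
      simp only [norm_neg]
      rcases m with _ | m
      · obtain ⟨L', ⟨a, j⟩, hL'⟩ : ∃ L' q, p :: L = L' ++ [q] := by
          rcases List.eq_nil_or_concat (p :: L) with h | ⟨L', q, h⟩
          · simp at h
          · exact ⟨L', q, by rw [h, List.concat_eq_append]⟩
        rw [hL', List.append_assoc, List.singleton_append] at hn hw ⊢
        refine ⟨_, isD_dir_remainder_zero hn, ?_⟩
        have hn1 : ((L' ++ [(a, j)]).map Prod.snd).Nodup := hn.sublist (by simp)
        have hn2 : ((L' ++ [(a, i)]).map Prod.snd).Nodup := hn.sublist (by simp)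
        have hne : ∀ q ∈ L' ++ [(a, j)], q.2 ≠ i := fun q hq hqi => by
          have hn3 : (((L' ++ [(a, j)]) ++ [(0, i)]).map Prod.snd).Nodup := by simpa using hn
          rw [List.map_append, List.nodup_append] at hn3
          exact hn3.2.2 q.2 (List.mem_map_of_mem hq) i (by simp) hqi
        have hji : j ≠ i := hne (a, j) (by simp)
        obtain ⟨C, hC, hc⟩ := ih (L := L') (m := a) (i := j) (by simp at hw ⊢; omega) hn1
        obtain ⟨C', hC', hc'⟩ := ih (L := L') (m := a) (i := i) (by simp at hw ⊢; omega) hn2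
        obtain ⟨A, hA, ha⟩ := exists_norm_geom_le (hx.2 i j hji.symm)
        refine ⟨A * (C + C') + C', by positivity, fun s v hs hsv => ?_⟩
        -- This remainder does not involve x_i, so the induction hypothesis at s = 0 gives e^{v/2},
        -- which is at most e^{(s+v)/2}.
        have hinv : remainder (L' ++ [(a, j)]) (scl (dir i) s (scl 1 v x)) =
            remainder (L' ++ [(a, j)]) (scl 1 v x) := remainder_scl_dir_of_ne hne s _
        have e1 : ‖remainder (L' ++ [(a, j)]) (scl (dir i) s (scl 1 v x))‖ ≤
            C * Real.exp ((s + v) / 2) := by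
          rw [hinv]
          have := hc 0 v le_rfl (by linarith)
          rw [scl_zero] at this
          exact this.trans (mul_le_mul_of_nonneg_left (Real.exp_le_exp.2 (by linarith)) hC)
        have e2 := hc' s v hs hsv
        have e3 : ‖geom (scl (dir i) s (scl 1 v x) i / scl (dir i) s (scl 1 v x) j)‖ ≤ A := by
          rw [scl_dir_self, scl_dir_of_ne hji, mul_div_right_comm, scl_one_apply, scl_one_apply,
            mul_div_mul_exp]
          exact (ha _ (Real.exp_pos _)).1
        refine (norm_sub_le _ _).trans ?_
        rw [add_mul]
        refine add_le_add ?_ e2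
        rw [norm_mul, mul_assoc]
        refine mul_le_mul e3 ((norm_sub_le _ _).trans ?_) (norm_nonneg _) hA
        rw [add_mul]
        exact add_le_add e1 e2
      · have hn' : ((p :: L ++ [(m, i)]).map Prod.snd).Nodup := by simpa using hn
        exact ⟨_, isD_dir_remainder_succ hn', ih (L := p :: L) (m := m) (i := i)
          (by simp at hw ⊢; omega) hn'⟩
    obtain ⟨D, hD, B, hB, hb⟩ := hone
    obtain ⟨D', hD', A, hA, ha⟩ := hdir
    refine ⟨2 * A + 2 * B + K, by positivity, ?_⟩
    refine norm_le_of_partial_derivs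
      (φ := fun s v => remainder (p :: L ++ [(m, i)]) (scl (dir i) s (scl 1 v x)))
      (fun s v => hD'.hasDerivAt (scl_mem_dom hx 1 v) s) (fun s v => ?_) hA hB ha hb
      (fun u hu => tendsto_remainder_scl hx hn hu) hKb
    simp only [scl_comm (dir i) 1]
    exact hD.hasDerivAt (scl_mem_dom hx (dir i) s) v

theorem exists_norm_remainder_le {x : ι → ℂ} (hx : x ∈ Dom ι) {L : List (ℕ × ι)}
    (h : (L.map Prod.snd).Nodup) : ∃ C, 0 ≤ C ∧ ∀ v ≤ 0,
      ‖remainder L (scl 1 v x)‖ ≤ C * Real.exp (v / 2) := by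
  rcases List.eq_nil_or_concat L with rfl | ⟨L, ⟨m, i⟩, rfl⟩
  · exact ⟨0, le_rfl, by simp⟩
  · rw [List.concat_eq_append] at *
    obtain ⟨C, hC, hc⟩ := exists_norm_remainder_append_le hx _ le_rfl h
    refine ⟨C, hC, fun v hv => ?_⟩
    simpa using hc 0 v le_rfl (by simpa using hv)

end MPL

/-! ### Comparison of the remainder with the polylogarithm of the inverses. -/

namespace MPL

variable {ι : Type*}

/-! ### The inversion relation -/

/-- Up to the sign, the polylogarithm at the inverse arguments. -/
noncomputable def inverted (L : List (ℕ × ι)) (x : ι → ℂ) : ℂ :=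
  (-1) ^ (L.map Prod.fst).sum * flow (L.map fun p => (p.1, (x p.2)⁻¹)) 0

@[simp] theorem inverted_nil (x : ι → ℂ) : inverted [] x = 1 := by simp [inverted]

theorem inverted_scl_one (L : List (ℕ × ι)) (s : ℝ) (x : ι → ℂ) :
    inverted L (scl 1 s x) =
      (-1) ^ (L.map Prod.fst).sum * flow (L.map fun p => (p.1, (x p.2)⁻¹)) (-s) := by
  have := flow_scaleList (-s) (L.map fun p => (p.1, (x p.2)⁻¹)) 0
  rw [zero_add] at this
  rw [← this, inverted, scaleList, List.map_map]
  simp only [scl_one_apply, mul_inv, ← Complex.ofReal_inv, ← Real.exp_neg]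
  rfl

theorem slit_map_inv {x : ι → ℂ} (hx : x ∈ Dom ι) (L : List (ℕ × ι)) :
    Slit (L.map fun p => (p.1, (x p.2)⁻¹)) := by
  intro q hq
  obtain ⟨p, -, rfl⟩ := List.mem_map.1 hq
  exact neg_inv_mem_slitPlane (hx.1 p.2)

/-- Inverting the coordinates reverses the scaling, and the resulting sign is absorbed by the sign
in `inverted`, whose exponent drops by one. -/
theorem isD_one_inverted_succ (m : ℕ) (j : ι) (L : List (ℕ × ι)) :
    IsD 1 (inverted ((m + 1, j) :: L)) (inverted ((m, j) :: L)) := fun x hx => by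
  simp only [inverted_scl_one]
  have h1 := hasDerivAt_flow_succ (m := m) (slit_map_inv hx ((m + 1, j) :: L)) (-0)
  convert! (h1.scomp (0 : ℝ) (hasDerivAt_neg (0 : ℝ))).const_mul
    ((-1) ^ (((m + 1, j) :: L).map Prod.fst).sum) using 1
  simp [inverted, pow_add, pow_succ]

/-- The sign from the reversed scaling cancels the one in geom(1/x) = -(1 + geom x). This case does
not change the sign exponent of `inverted`. -/
theorem isD_one_inverted_zero (j : ι) (L : List (ℕ × ι)) :
    IsD 1 (inverted ((0, j) :: L)) (fun x => (1 + geom (x j)) * inverted L x) := fun x hx => by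
  simp only [inverted_scl_one]
  have h1 := hasDerivAt_flow_zero (slit_map_inv hx ((0, j) :: L)) (-0)
  convert! (h1.scomp (0 : ℝ) (hasDerivAt_neg (0 : ℝ))).const_mul
    ((-1) ^ (((0, j) :: L).map Prod.fst).sum) using 1
  simp [inverted, geom_inv (hx.1 j)]
  ring

theorem exists_norm_inverted_le {x : ι → ℂ} (hx : x ∈ Dom ι) {L : List (ℕ × ι)} (hL : L ≠ []) :
    ∃ C, 0 ≤ C ∧ ∀ v : ℝ, ‖inverted L (scl 1 v x)‖ ≤ C * Real.exp v := by
  obtain ⟨C, hC, h⟩ := exists_isTame_flow (slit_map_inv hx L) (by simpa using hL)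
  refine ⟨C, hC, fun v => ?_⟩
  rw [inverted_scl_one]
  simpa using h.bound (-v)

theorem exists_norm_expansion_scl_one_le {x : ι → ℂ} (hx : x ∈ Dom ι) (L : List (ℕ × ι)) :
    ∃ C, 0 ≤ C ∧ ∀ v : ℝ, ‖expansion L (scl 1 v x)‖ ≤ C * Real.exp (|v| / 4) := by
  rcases L with _ | ⟨⟨m, j⟩, L⟩
  · exact ⟨1, one_pos.le, fun v => by simpa [expansion] using Real.one_le_exp (by positivity)⟩
  · simpa [expansion] using exists_norm_asym_le hx j L [] (m + 1)

/-- The products of an asymptotic expansion and an inverted polylogarithm of depth smaller than the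
length of `J`. -/
def invProducts (J : List ι) (w : ℕ) : Set ((ι → ℂ) → ℂ) :=
  {g | ∃ l₁ l₂ : List (ℕ × ι), (l₂.map Prod.snd ++ l₁.map Prod.snd).Sublist J ∧ l₂ ≠ [] ∧
    l₂.length < J.length ∧ wt l₁ + wt l₂ = w ∧ g = fun x => expansion l₁ x * inverted l₂ x}

/-- Functions decaying at infinity. -/
def Decays (f : (ι → ℂ) → ℂ) : Prop :=
  ∀ x ∈ Dom ι, Tendsto (fun v => f (scl 1 v x)) atBot (𝓝 0)

theorem decays_of_le {f : (ι → ℂ) → ℂ}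
    (h : ∀ x ∈ Dom ι, ∃ C, 0 ≤ C ∧ ∀ v ≤ 0, ‖f (scl 1 v x)‖ ≤ C * Real.exp (v / 2)) :
    Decays f := by
  intro x hx
  obtain ⟨C, hC, h⟩ := h x hx
  have hlim : Tendsto (fun v : ℝ => C * Real.exp (v / 2)) atBot (𝓝 0) := by
    have := (Real.tendsto_exp_atBot.comp
      (tendsto_id.atBot_div_const (two_pos (α := ℝ)))).const_mul C
    simpa using this
  refine squeeze_zero_norm' ?_ hlim
  filter_upwards [eventually_le_atBot 0] with v hv using h v hv

theorem Decays.sub {f g : (ι → ℂ) → ℂ} (hf : Decays f) (hg : Decays g) :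
    Decays (fun x => f x - g x) := fun x hx => by
  simpa using (hf x hx).sub (hg x hx)

theorem decays_inverted {L : List (ℕ × ι)} (hL : L ≠ []) : Decays (inverted L) :=
  decays_of_le fun x hx => by
    obtain ⟨C, hC, h⟩ := exists_norm_inverted_le hx hL
    exact ⟨C, hC, fun v hv => (h v).trans
      (mul_le_mul_of_nonneg_left (Real.exp_le_exp.2 (by linarith)) hC)⟩

theorem decays_remainder {L : List (ℕ × ι)} (hL : (L.map Prod.snd).Nodup) :
    Decays (remainder L) :=
  decays_of_le fun _ hx => exists_norm_remainder_le hx hL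

theorem decays_of_mem_span {J : List ι} {w : ℕ} {Q : (ι → ℂ) → ℂ}
    (hQ : Q ∈ Submodule.span ℤ (invProducts J w)) : Decays Q := by
  induction hQ using Submodule.span_induction with
  | mem f hf =>
    obtain ⟨l₁, l₂, -, h2, -, -, rfl⟩ := hf
    refine decays_of_le fun x hx => ?_
    obtain ⟨C, hC, h⟩ := exists_norm_inverted_le hx h2
    obtain ⟨B, hB, hb⟩ := exists_norm_expansion_scl_one_le hx l₁
    refine ⟨B * C, by positivity, fun v hv => ?_⟩
    rw [norm_mul]
    refine (mul_le_mul (hb v) (h v) (norm_nonneg _) (by positivity)).trans ?_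
    rw [mul_mul_mul_comm, ← Real.exp_add, abs_of_nonpos hv]
    exact mul_le_mul_of_nonneg_left (Real.exp_le_exp.2 (by linarith)) (by positivity)
  | zero => exact fun x _ => tendsto_const_nhds
  | add f g _ _ hf hg => exact fun x hx => by simpa using (hf x hx).add (hg x hx)
  | smul c f _ hf => exact fun x hx => by simpa using (hf x hx).const_mul (c : ℂ)

/-- Integration by parts: the inverted factor is integrated by raising its first exponent, the
expansion is differentiated and loses weight, until it is the constant 1. The derivative of an
expansion is, up to sign, again an expansion, so all coefficients are ±1. -/
theorem exists_primitive_product {J : List ι} (hJ : J.Nodup) (n : ℕ) :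
    ∀ (l₁ l : List (ℕ × ι)) (m : ℕ) (j : ι) (w : ℕ) (h : (ι → ℂ) → ℂ), wt l₁ ≤ n →
    (j :: l.map Prod.snd ++ l₁.map Prod.snd).Sublist J → l.length + 1 < J.length →
    wt l₁ + wt ((m, j) :: l) = w → IsD 1 (inverted ((m, j) :: l)) h →
    ∃ Q ∈ Submodule.span ℤ (invProducts J w), IsD 1 Q (fun x => expansion l₁ x * h x) := by
  induction n with
  | zero =>
    intro l₁ l m j w h hn hs hl hw hh
    have : l₁ = [] := by
      rcases l₁ with _ | ⟨p, l₁⟩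
      · rfl
      · simp at hn
    subst this
    refine ⟨_, Submodule.subset_span ⟨[], (m, j) :: l, by simpa using hs, by simp, by simpa using hl,
      hw, rfl⟩, ?_⟩
    simpa [expansion] using hh
  | succ n ih =>
    intro l₁ l m j w h hn hs hl hw hh
    have hmem : (fun x => expansion l₁ x * inverted ((m, j) :: l) x) ∈
        Submodule.span ℤ (invProducts J w) :=
      Submodule.subset_span ⟨l₁, (m, j) :: l, by simpa using hs, by simp, by simpa using hl, hw, rfl⟩
    rcases l₁ with _ | ⟨⟨_ | a, i⟩, l₁⟩
    · exact ⟨_, hmem, by simpa [expansion] using hh⟩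
    · obtain ⟨Q, hQ, hD⟩ := ih l₁ l (m + 1) j w _ (by simp at hn; omega)
        ((List.Sublist.append_left (by simp) _).trans hs) hl (by simp at hw ⊢; omega)
        (isD_one_inverted_succ m j l)
      have hnd : (((0, i) :: l₁).map Prod.snd).Nodup :=
        hJ.sublist ((List.sublist_append_right _ _).trans hs)
      refine ⟨_, add_mem hmem hQ, ?_⟩
      refine (((isD_one_expansion_zero hnd).mul hh).add hD).congr_right fun x _ => ?_
      ring
    · obtain ⟨Q, hQ, hD⟩ := ih ((a, i) :: l₁) l (m + 1) j w _ (by simp at hn ⊢; omega)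
        (by simpa using hs) hl (by simp at hw ⊢; omega)
        (isD_one_inverted_succ m j l)
      refine ⟨_, sub_mem hmem hQ, ?_⟩
      refine (((isD_one_expansion_succ a i l₁).mul hh).sub hD).congr_right fun x _ => ?_
      ring

theorem IsD.zsmul {δ : ι → ℝ} {f g : (ι → ℂ) → ℂ} (h : IsD δ f g) (c : ℤ) :
    IsD δ (c • f) (fun x => (c : ℂ) * g x) :=
  (h.const_mul c).congr_left fun x _ => by simp

/-- Linear extension of the previous lemma. The multiplier `u` will be 1 or 1 + geom(x_j); the
hypothesis asks that `u` times an inverted polylogarithm be the derivative of one. -/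
theorem exists_primitive_of_mem_span {J J' : List ι} (hJ : J'.Nodup) {w : ℕ}
    {Q₀ : (ι → ℂ) → ℂ} (h₀ : Q₀ ∈ Submodule.span ℤ (invProducts J w)) (u : (ι → ℂ) → ℂ)
    (h : ∀ l₁ l₂ : List (ℕ × ι), (l₂.map Prod.snd ++ l₁.map Prod.snd).Sublist J → l₂ ≠ [] →
      l₂.length < J.length → wt l₁ + wt l₂ = w →
      ∃ l m j, (j :: l.map Prod.snd ++ l₁.map Prod.snd).Sublist J' ∧ l.length + 1 < J'.length ∧
        wt l₁ + wt ((m, j) :: l) = w + 1 ∧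
        IsD 1 (inverted ((m, j) :: l)) (fun x => u x * inverted l₂ x)) :
    ∃ Q ∈ Submodule.span ℤ (invProducts J' (w + 1)), IsD 1 Q (fun x => u x * Q₀ x) := by
  induction h₀ using Submodule.span_induction with
  | mem f hf =>
    obtain ⟨l₁, l₂, h1, h2, h3, h4, rfl⟩ := hf
    obtain ⟨l, m, j, h5, h6, h7, h8⟩ := h l₁ l₂ h1 h2 h3 h4
    obtain ⟨Q, hQ, hD⟩ := exists_primitive_product hJ _ l₁ l m j _ _ le_rfl h5 h6 h7 h8
    exact ⟨Q, hQ, hD.congr_right fun x _ => by ring⟩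
  | zero => exact ⟨0, zero_mem _, (isD_zero 1).congr_right fun x _ => by simp⟩
  | add f g _ _ hf hg =>
    obtain ⟨Q, hQ, hD⟩ := hf
    obtain ⟨Q', hQ', hD'⟩ := hg
    exact ⟨_, add_mem hQ hQ', (hD.add hD').congr_right fun x _ => by simp; ring⟩
  | smul c f _ hf =>
    obtain ⟨Q, hQ, hD⟩ := hf
    exact ⟨_, Submodule.smul_mem _ c hQ, (hD.zsmul c).congr_right fun x _ => by simp; ring⟩

/-- The derivative is arranged so that the difference for the tail, known by induction, is isolated.
The other terms are an expansion times 1 + geom(x_j), and an inverted polylogarithm: both have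
primitives by `exists_primitive_product`. -/
theorem isD_one_remainder_sub_inverted_zero {j : ι} {L : List (ℕ × ι)}
    (h : (((0, j) :: L).map Prod.snd).Nodup) :
    IsD 1 (fun x => remainder ((0, j) :: L) x - inverted ((0, j) :: L) x) (fun x =>
      (1 + geom (x j)) * (remainder L x - inverted L x) - 1 * (remainder L x - inverted L x) +
        ((1 + geom (x j)) * expansion L x - inverted L x)) :=
  ((isD_one_remainder_zero h).sub (isD_one_inverted_zero j L)).congr_right fun x _ => by ring

theorem eqOn_of_isD_of_decays {f g h : (ι → ℂ) → ℂ} (hf : IsD 1 f h) (hg : IsD 1 g h)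
    (hdf : Decays f) (hdg : Decays g) : ∀ x ∈ Dom ι, f x = g x := fun x hx =>
  sub_eq_zero.1 (((hf.sub hg).congr_right fun x _ => by simp).eq_zero_of_tendsto hx
    ((hdf.sub hdg) x hx))

/-- The difference of a polylogarithm, its inversion and its expansion is an integer combination
of products of lower depth. -/
theorem exists_remainder_sub_inverted_eq (L : List (ℕ × ι)) (h : (L.map Prod.snd).Nodup)
    (hL : L ≠ []) : ∃ Q ∈ Submodule.span ℤ (invProducts (L.map Prod.snd) (wt L)),
      ∀ x ∈ Dom ι, remainder L x - inverted L x = Q x := by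
  induction L with
  | nil => exact absurd rfl hL
  | cons p L ih =>
    obtain ⟨m, j⟩ := p
    have hdec : ∀ m, Decays (fun x => remainder ((m, j) :: L) x - inverted ((m, j) :: L) x) :=
      fun m => (decays_remainder (by simpa using h)).sub (decays_inverted (by simp))
    clear hL
    induction m with
    | succ m ihm =>
      obtain ⟨Q₀, hQ₀, h₀⟩ := ihm (by simpa using h)
      have hJ : ((m + 1, j) :: L).map Prod.snd = ((m, j) :: L).map Prod.snd := rfl
      rw [hJ] at h ⊢
      obtain ⟨Q, hQ, hD⟩ := exists_primitive_of_mem_span h hQ₀ (fun _ => 1)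
        (fun l₁ l₂ a1 a2 a3 a4 => by
          rcases l₂ with _ | ⟨⟨m', j'⟩, l⟩
          · exact absurd rfl a2
          · refine ⟨l, m' + 1, j', by simpa using a1, by simpa using a3, by simp at a4 ⊢; omega, ?_⟩
            simpa using isD_one_inverted_succ m' j' l)
      rw [show wt ((m, j) :: L) + 1 = wt ((m + 1, j) :: L) by simp; ring] at hQ
      refine ⟨Q, hQ, eqOn_of_isD_of_decays
        ((isD_one_remainder_succ m j L).sub (isD_one_inverted_succ m j L))
        (hD.congr_right fun x hx => ?_) (hdec _) (decays_of_mem_span hQ)⟩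
      rw [h₀ x hx, one_mul]
    | zero =>
      have hD₀ := isD_one_remainder_sub_inverted_zero h
      rw [show wt ((0, j) :: L) = wt L + 1 by simp; ring]
      -- For depth one all terms of the derivative cancel, so the difference, which decays, is zero.
      rcases L with _ | ⟨⟨a, i⟩, L⟩
      · refine ⟨0, zero_mem _, eqOn_of_isD_of_decays (hD₀.congr_right fun x _ => ?_) (isD_zero 1)
          (hdec 0) fun x _ => tendsto_const_nhds⟩
        simp [expansion]
      · obtain ⟨Q₀, hQ₀, h₀⟩ := ih (List.nodup_cons.1 h).2 (by simp)
        obtain ⟨Q₁, hQ₁, hD₁⟩ := exists_primitive_of_mem_span h hQ₀ (fun x => 1 + geom (x j))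
          (fun l₁ l₂ a1 a2 a3 a4 => ⟨l₂, 0, j, by simpa using a1, by simpa using a3,
            by simp at a4 ⊢; omega, isD_one_inverted_zero j l₂⟩)
        obtain ⟨Q₂, hQ₂, hD₂⟩ := exists_primitive_of_mem_span h hQ₀ (fun _ => 1)
          (fun l₁ l₂ a1 a2 a3 a4 => by
            rcases l₂ with _ | ⟨⟨m', j'⟩, l⟩
            · exact absurd rfl a2
            · refine ⟨l, m' + 1, j', (by simpa using a1 : List.Sublist _ _).trans
                (List.sublist_cons_self _ _), by simp at a3 ⊢; omega, by simp at a4 ⊢; omega, ?_⟩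
              simpa using isD_one_inverted_succ m' j' l)
        -- `Q₃` integrates (1 + geom(x_j)) times the expansion of the tail, and `Q₄` integrates the
        -- inverted polylogarithm of the tail, whose depth is already smaller than that of the full
        -- list.
        obtain ⟨Q₃, hQ₃, hD₃⟩ := exists_primitive_product h _ ((a, i) :: L) [] 0 j
          (wt ((a, i) :: L) + 1) _ le_rfl (by simp) (by simp) (by simp) (isD_one_inverted_zero j [])
        obtain ⟨Q₄, hQ₄, hD₄⟩ := exists_primitive_product h _ [] L (a + 1) i
          (wt ((a, i) :: L) + 1) _ le_rfl (by simp) (by simp) (by simp; ring)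
          (isD_one_inverted_succ a i L)
        have hQ := add_mem (sub_mem hQ₁ hQ₂) (sub_mem hQ₃ hQ₄)
        refine ⟨_, hQ, eqOn_of_isD_of_decays hD₀
          (((hD₁.sub hD₂).add (hD₃.sub hD₄)).congr_right fun x hx => ?_)
          (hdec 0) (decays_of_mem_span hQ)⟩
        rw [← h₀ x hx]
        rw [show expansion ([] : List (ℕ × ι)) x = 1 from rfl, inverted_nil]
        ring

end MPL

/-! ### From integrals with a common numerator to ordered products of blocks. -/

namespace MPL

variable {ι : Type*}

theorem eqOn_of_isD_dir {i : ι} {f g h : (ι → ℂ) → ℂ} (hf : IsD (dir i) f h)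
    (hg : IsD (dir i) g h)
    (tf : ∀ x ∈ Dom ι, Tendsto (fun s => f (scl (dir i) s x)) atTop (𝓝 0))
    (tg : ∀ x ∈ Dom ι, Tendsto (fun s => g (scl (dir i) s x)) atTop (𝓝 0)) :
    ∀ x ∈ Dom ι, f x = g x := fun x hx =>
  sub_eq_zero.1 (((hf.sub hg).congr_right fun x _ => by simp).eq_zero_of_tendsto hx
    (by simpa using (tf x hx).sub (tg x hx)))

theorem tendsto_dir_revBlock {i : ι} {L : List (ℕ × ι)} (h : ∀ p ∈ L, p.2 ≠ i) (hL : L ≠ []) :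
    ∀ x ∈ Dom ι, Tendsto (fun s => revBlock i L (scl (dir i) s x)) atTop (𝓝 0) := by
  intro x hx
  obtain ⟨A, hA, ha⟩ := exists_isTame_flow (slit_map_div hx h) (by simpa using hL)
  have hlim : Tendsto (fun s : ℝ => A * Real.exp (-s)) atTop (𝓝 0) := by
    simpa using Real.tendsto_exp_neg_atTop_nhds_zero.const_mul A
  refine squeeze_zero_norm (fun s => ?_) hlim
  rw [revBlock_scl_dir h]
  exact ha.bound s

/-! ### Sequences of blocks -/

/-- The product of the blocks. -/
noncomputable def evalSeq (bs : List (WithTop ι × List (ℕ × ι))) (x : ι → ℂ) : ℂ :=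
  (bs.map fun p => block p.1 p.2 x).prod

/-- The total depth. -/
def depthSeq (bs : List (WithTop ι × List (ℕ × ι))) : ℕ := (bs.map fun p => p.2.length).sum

/-- The total weight. -/
def wtSeq (bs : List (WithTop ι × List (ℕ × ι))) : ℕ := (bs.map fun p => wt p.2).sum

@[simp] theorem evalSeq_nil (x : ι → ℂ) : evalSeq [] x = 1 := rfl

@[simp] theorem evalSeq_cons (p : WithTop ι × List (ℕ × ι))
    (bs : List (WithTop ι × List (ℕ × ι))) (x : ι → ℂ) :
    evalSeq (p :: bs) x = block p.1 p.2 x * evalSeq bs x := by simp [evalSeq]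

@[simp] theorem evalSeq_append (bs bs' : List (WithTop ι × List (ℕ × ι))) (x : ι → ℂ) :
    evalSeq (bs ++ bs') x = evalSeq bs x * evalSeq bs' x := by simp [evalSeq]

section LinearOrder

variable [LinearOrder ι]

/-- The blocks `(e, L)` of the sequence are non-empty, separated, and lie between `a` and `b`. -/
def ValidSeq : WithTop ι → List (WithTop ι × List (ℕ × ι)) → WithTop ι → Prop
  | a, [], b => a ≤ b
  | a, p :: bs, b => p.2 ≠ [] ∧ (p.2.map Prod.snd).Pairwise (· > ·) ∧
      (∀ q ∈ p.2, a ≤ q.2 ∧ (q.2 : WithTop ι) < p.1) ∧ ValidSeq p.1 bs b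

theorem ValidSeq.le {a b : WithTop ι} {bs : List (WithTop ι × List (ℕ × ι))}
    (h : ValidSeq a bs b) : a ≤ b := by
  induction bs generalizing a with
  | nil => exact h
  | cons p bs ih =>
    obtain ⟨q, hq⟩ := List.exists_mem_of_ne_nil _ h.1
    have := h.2.2.1 q hq
    exact this.1.trans (this.2.le.trans (ih h.2.2.2))

theorem ValidSeq.mono {a a' b b' : WithTop ι} {bs : List (WithTop ι × List (ℕ × ι))}
    (h : ValidSeq a bs b) (ha : a' ≤ a) (hb : b ≤ b') : ValidSeq a' bs b' := by
  induction bs generalizing a a' with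
  | nil => exact ha.trans (le_trans h hb)
  | cons p bs ih =>
    exact ⟨h.1, h.2.1, fun q hq => ⟨ha.trans (h.2.2.1 q hq).1, (h.2.2.1 q hq).2⟩,
      ih h.2.2.2 le_rfl⟩

theorem ValidSeq.append {a b c : WithTop ι} {bs bs' : List (WithTop ι × List (ℕ × ι))}
    (h : ValidSeq a bs b) (h' : ValidSeq b bs' c) : ValidSeq a (bs ++ bs') c := by
  induction bs generalizing a with
  | nil => exact h'.mono h le_rfl
  | cons p bs ih => exact ⟨h.1, h.2.1, h.2.2.1, ih h.2.2.2⟩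

theorem evalSeq_scl_dir {i : ι} {a b : WithTop ι} {bs : List (WithTop ι × List (ℕ × ι))}
    (h : ValidSeq a bs b) (hi : i < a) (s : ℝ) (x : ι → ℂ) :
    evalSeq bs (scl (dir i) s x) = evalSeq bs x := by
  induction bs generalizing a with
  | nil => rfl
  | cons p bs ih =>
    obtain ⟨h1, -, h2, h3⟩ := h
    obtain ⟨q, hq⟩ := List.exists_mem_of_ne_nil _ h1
    have he : (i : WithTop ι) < p.1 := hi.trans_le ((h2 q hq).1.trans (h2 q hq).2.le)
    rw [evalSeq_cons, evalSeq_cons, ih h3 he, block_scl_dir_of_ne (fun r hr hri => ?_) he.ne]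
    have := hi.trans_le (h2 r hr).1
    rw [hri] at this
    exact lt_irrefl _ this

/-! ### Reordering of the arguments -/

/-- Products of blocks between `i` and `b` such that the first block starts with `x_i`, and such that
all other indices are at least `c`. -/
def leadingProducts (i : ι) (c b : WithTop ι) (r w : ℕ) : Set ((ι → ℂ) → ℂ) :=
  {g | ∃ (e : ι) (m : ℕ) (L : List (ℕ × ι)) (bs : List (WithTop ι × List (ℕ × ι))),
    (L.map Prod.snd).Pairwise (· > ·) ∧ (∀ q ∈ L, c ≤ q.2 ∧ q.2 < e) ∧ c ≤ e ∧ ValidSeq e bs b ∧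
    L.length + 1 + depthSeq bs ≤ r ∧ m + 1 + wt L + wtSeq bs = w ∧
    g = fun x => block (e : WithTop ι) (L ++ [(m, i)]) x * evalSeq bs x}

theorem tendsto_dir_of_mem_span {i : ι} {c b : WithTop ι} (hi : i < c) {r w : ℕ}
    {Q : (ι → ℂ) → ℂ} (hQ : Q ∈ Submodule.span ℤ (leadingProducts i c b r w)) :
    ∀ x ∈ Dom ι, Tendsto (fun s => Q (scl (dir i) s x)) atTop (𝓝 0) := by
  induction hQ using Submodule.span_induction with
  | mem f hf =>
    obtain ⟨e, m, L, bs, h1, h2, h3, h4, -, -, rfl⟩ := hf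
    intro x hx
    have hie : (i : WithTop ι) < e := hi.trans_le h3
    obtain ⟨C, hC, h⟩ := exists_norm_block_last_le hx (i := i) (j := e) (L := L)
      (fun p hp hpi => by
        have := hi.trans_le (h2 p hp).1
        rw [hpi] at this
        exact lt_irrefl _ this)
      (fun p hp => (WithTop.coe_lt_coe.2 (h2 p hp).2).ne) (WithTop.coe_lt_coe.1 hie).ne m
    have hlim : Tendsto (fun s : ℝ => C * Real.exp (-s)) atTop (𝓝 0) := by
      simpa using Real.tendsto_exp_neg_atTop_nhds_zero.const_mul C
    have h0 : Tendsto (fun s => block (e : WithTop ι) (L ++ [(m, i)]) (scl (dir i) s x)) atTop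
        (𝓝 0) := squeeze_zero_norm (fun s => by simpa using h s 0) hlim
    simpa [evalSeq_scl_dir h4 hie] using h0.mul_const (evalSeq bs x)
  | zero => exact fun x _ => tendsto_const_nhds
  | add f g _ _ hf hg => exact fun x hx => by simpa using (hf x hx).add (hg x hx)
  | smul c f _ hf => exact fun x hx => by simpa using (hf x hx).const_mul (c : ℂ)

theorem exists_isD_dir_of_mem_span {i : ι} {c c' b : WithTop ι} {r r' w : ℕ} {Q₀ : (ι → ℂ) → ℂ}
    (u : (ι → ℂ) → ℂ) (h₀ : Q₀ ∈ Submodule.span ℤ (leadingProducts i c b r w))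
    (h : ∀ f ∈ leadingProducts i c b r w,
      ∃ Q ∈ Submodule.span ℤ (leadingProducts i c' b r' (w + 1)),
        IsD (dir i) Q (fun x => u x * f x)) :
    ∃ Q ∈ Submodule.span ℤ (leadingProducts i c' b r' (w + 1)),
      IsD (dir i) Q (fun x => u x * Q₀ x) := by
  induction h₀ using Submodule.span_induction with
  | mem f hf => exact h f hf
  | zero => exact ⟨0, zero_mem _, (isD_zero _).congr_right fun x _ => by simp⟩
  | add f g _ _ hf hg =>
    obtain ⟨Q, hQ, hD⟩ := hf
    obtain ⟨Q', hQ', hD'⟩ := hg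
    exact ⟨_, add_mem hQ hQ', (hD.add hD').congr_right fun x _ => by simp; ring⟩
  | smul c f _ hf =>
    obtain ⟨Q, hQ, hD⟩ := hf
    exact ⟨_, Submodule.smul_mem _ c hQ, (hD.zsmul c).congr_right fun x _ => by simp; ring⟩

theorem isD_dir_evalSeq {i : ι} {a b : WithTop ι} {bs : List (WithTop ι × List (ℕ × ι))}
    (h : ValidSeq a bs b) (hi : i < a) : IsD (dir i) (evalSeq bs) 0 :=
  isD_of_invariant fun x s => evalSeq_scl_dir h hi s x

theorem exists_isD_dir_succ {i : ι} {c b : WithTop ι} (hi : i < c) {r w : ℕ} {f : (ι → ℂ) → ℂ}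
    (hf : f ∈ leadingProducts i c b r w) :
    ∃ Q ∈ Submodule.span ℤ (leadingProducts i c b r (w + 1)),
        IsD (dir i) Q (fun x => 1 * f x) := by
  obtain ⟨e, m, L, bs, h1, h2, h3, h4, h5, h6, rfl⟩ := hf
  have hie : (i : WithTop ι) < e := hi.trans_le h3
  have hD := (isD_dir_block_succ (i := i) (e := (e : WithTop ι)) (L := L)
    (fun p hp hpi => by
      have := hi.trans_le (h2 p hp).1
      rw [hpi] at this
      exact lt_irrefl _ this)
    (fun p hp => (WithTop.coe_lt_coe.2 (h2 p hp).2).ne) hie.ne m).mul (isD_dir_evalSeq h4 hie)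
  exact ⟨_, Submodule.subset_span ⟨e, m + 1, L, bs, h1, h2, h3, h4, h5, by omega, rfl⟩,
    hD.congr_right fun x _ => by simp⟩

/-- The derivative of block_e(L, (m,j), (0,i)) contains -geom(x_i/x_j) block_e(L, (m,i)) and two
unwanted terms. One is the derivative of block_j((0,i)) · block_e(L, (m,j)), the other is minus that
of block_e(L, (m+1,i)). Subtracting accordingly gives the primitive. -/
theorem exists_isD_dir_geom {i j : ι} {c b : WithTop ι} (hi : i < j) (hj : j < c) {r w : ℕ}
    {f : (ι → ℂ) → ℂ} (hf : f ∈ leadingProducts i c b r w) :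
    ∃ Q ∈ Submodule.span ℤ (leadingProducts i j b (r + 1) (w + 1)),
        IsD (dir i) Q (fun x => geom (x i / x j) * f x) := by
  obtain ⟨e, m, L, bs, h1, h2, h3, h4, h5, h6, rfl⟩ := hf
  have hic : (i : WithTop ι) < c := (WithTop.coe_lt_coe.2 hi).trans hj
  have hje : (j : WithTop ι) < e := hj.trans_le h3
  have hie : (i : WithTop ι) < e := hic.trans_le h3
  have hjL : ∀ p ∈ L, j < p.2 := fun p hp => WithTop.coe_lt_coe.1 (hj.trans_le (h2 p hp).1)
  have hiL : ∀ p ∈ L, p.2 ≠ i := fun p hp => (hi.trans (hjL p hp)).ne'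
  have hLe : ∀ p ∈ L, (p.2 : WithTop ι) ≠ e := fun p hp => (WithTop.coe_lt_coe.2 (h2 p hp).2).ne
  have hbs := isD_dir_evalSeq h4 hie
  have hpw : ((L ++ [(m, j)]).map Prod.snd).Pairwise (· > ·) := by
    rw [List.map_append, List.pairwise_append]
    exact ⟨h1, by simp, by simpa using fun a b hab => hjL (b, a) hab⟩
  have hmid : ∀ q ∈ L ++ [(m, j)], (j : WithTop ι) ≤ q.2 ∧ q.2 < e := by
    simp only [List.mem_append, List.mem_singleton]
    rintro q (hq | rfl)
    · exact ⟨WithTop.coe_le_coe.2 (hjL q hq).le, (h2 q hq).2⟩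
    · exact ⟨le_rfl, WithTop.coe_lt_coe.1 hje⟩
  have hv : ValidSeq (j : WithTop ι) (((e : WithTop ι), L ++ [(m, j)]) :: bs) b :=
    ⟨by simp, hpw, fun q hq => ⟨(hmid q hq).1, WithTop.coe_lt_coe.2 (hmid q hq).2⟩, h4⟩
  have m1 : (fun x => block (j : WithTop ι) ([] ++ [(0, i)]) x *
      evalSeq (((e : WithTop ι), L ++ [(m, j)]) :: bs) x) ∈
        leadingProducts i j b (r + 1) (w + 1) :=
    ⟨j, 0, [], _, by simp, by simp, le_rfl, hv, by simp [depthSeq] at h5 ⊢; omega,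
      by simp [wtSeq] at h6 ⊢; omega, rfl⟩
  have m2 : (fun x => block (e : WithTop ι) ((L ++ [(m, j)]) ++ [(0, i)]) x * evalSeq bs x) ∈
        leadingProducts i j b (r + 1) (w + 1) :=
    ⟨e, 0, _, bs, hpw, hmid, hje.le, h4, by simp; omega, by simp; omega, rfl⟩
  have m3 : (fun x => block (e : WithTop ι) (L ++ [(m + 1, i)]) x * evalSeq bs x) ∈
        leadingProducts i j b (r + 1) (w + 1) :=
    ⟨e, m + 1, L, bs, h1, fun q hq => ⟨WithTop.coe_le_coe.2 (hjL q hq).le, (h2 q hq).2⟩, hje.le,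
      h4, by omega, by omega, rfl⟩
  have d1 := (isD_dir_block_singleton_zero (i := i) (e := (j : WithTop ι))
    (WithTop.coe_lt_coe.2 hi).ne).mul (isD_dir_evalSeq hv (WithTop.coe_lt_coe.2 hi))
  have d2 := (isD_dir_block_zero (L := L) (e := (e : WithTop ι)) hiL hLe hie.ne hi.ne' hje.ne m).mul
    hbs
  have d3 := (isD_dir_block_succ (L := L) (e := (e : WithTop ι)) hiL hLe hie.ne m).mul hbs
  refine ⟨_, sub_mem (sub_mem (Submodule.subset_span m1) (Submodule.subset_span m2))
    (Submodule.subset_span m3), ?_⟩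
  rw [List.append_assoc]
  refine ((d1.sub d2).sub d3).congr_right fun x _ => ?_
  simp only [evalSeq_cons, den_coe, Pi.zero_apply]
  ring

/-- Iterated integrals with arguments `x_i / x_j` are integer combinations of products of blocks. -/
theorem exists_revBlock_eq {i : ι} {b : WithTop ι} (T : List (ℕ × ι)) :
    ∀ (m : ℕ) (j : ι), (i :: j :: T.map Prod.snd).Pairwise (· < ·) →
      (∀ p ∈ (m, j) :: T, (p.2 : WithTop ι) ≤ b) →
      ∃ Q ∈ Submodule.span ℤ (leadingProducts i j b (T.length + 1) (wt ((m, j) :: T))),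
        ∀ x ∈ Dom ι, revBlock i ((m, j) :: T) x = Q x := by
  induction T with
  | nil =>
    intro m j hp hb
    refine ⟨_, Submodule.subset_span ⟨j, m, [], [], by simp, by simp, le_rfl, ?_, by simp [depthSeq],
      by simp [wtSeq], rfl⟩, fun x _ => ?_⟩
    · exact hb (m, j) (by simp)
    · simp [block, revBlock]
  | cons q T ih =>
    intro m j hp hb
    have hij : i < j := by simp at hp; exact hp.1.1
    have hne : ∀ m, ∀ p ∈ (m, j) :: q :: T, p.2 ≠ i := fun m p hp' => by
      have := (List.pairwise_cons.1 hp).1 p.2 (by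
        rcases List.mem_cons.1 hp' with rfl | h
        · simp
        · exact List.mem_cons_of_mem _ (List.mem_map_of_mem h))
      exact this.ne'
    have hT : ∀ p ∈ q :: T, p.2 ≠ i := fun p hp => hne 0 p (List.mem_cons_of_mem _ hp)
    induction m with
    | zero =>
      obtain ⟨Q₀, hQ₀, h₀⟩ := ih q.1 q.2 (hp.sublist (by simp))
        (fun p hp => hb p (List.mem_cons_of_mem _ hp))
      have hjq : j < q.2 := by simp at hp; exact hp.2.1.1
      obtain ⟨Q, hQ, hD⟩ := exists_isD_dir_of_mem_span (c' := (j : WithTop ι))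
        (fun x => geom (x i / x j)) hQ₀ fun f hf =>
          exists_isD_dir_geom hij (WithTop.coe_lt_coe.2 hjq) hf
      rw [show wt ((0, j) :: q :: T) = wt (q :: T) + 1 by simp; ring]
      -- Both sides have the same derivative in x_i and vanish as x_i tends to 0.
      refine ⟨Q, hQ, eqOn_of_isD_dir (isD_dir_revBlock_zero hT hij.ne') (hD.congr_right fun x hx => ?_)
        (tendsto_dir_revBlock (hne 0) (by simp))
        (tendsto_dir_of_mem_span (WithTop.coe_lt_coe.2 hij) hQ)⟩
      rw [h₀ x hx]
    | succ m ihm =>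
      obtain ⟨Q₀, hQ₀, h₀⟩ := ihm (by simpa using hb)
      obtain ⟨Q, hQ, hD⟩ := exists_isD_dir_of_mem_span (c' := (j : WithTop ι))
        (fun _ => 1) hQ₀ fun f hf => exists_isD_dir_succ (WithTop.coe_lt_coe.2 hij) hf
      rw [show wt ((m + 1, j) :: q :: T) = wt ((m, j) :: q :: T) + 1 by simp; ring]
      refine ⟨Q, hQ, eqOn_of_isD_dir (isD_dir_revBlock_succ hT hij.ne' m)
        (hD.congr_right fun x hx => ?_)
        (tendsto_dir_revBlock (hne _) (by simp))
        (tendsto_dir_of_mem_span (WithTop.coe_lt_coe.2 hij) hQ)⟩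
      rw [h₀ x hx, one_mul]

end LinearOrder

end MPL

namespace MPL

/-! ### Depth and weight bookkeeping, and the parity theorem for blocks. -/

section PolyMod

variable {ι : Type*} [LinearOrder ι] [Fintype ι]

/-! ### The module spanned by products of Bernoulli functions and blocks -/

/-- Products of Bernoulli functions and blocks between `a` and `b`. -/
def polyProducts (a b : WithTop ι) (D w : ℕ) : Set (Dom ι → ℂ) :=
  {g | ∃ (k : ι → ℕ) (bs : List (WithTop ι × List (ℕ × ι))),
    (∀ i, k i ≠ 0 → a ≤ i ∧ (i : WithTop ι) < b) ∧ ValidSeq a bs b ∧ depthSeq bs ≤ D ∧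
    ∑ i, k i + wtSeq bs = w ∧ g = fun x : Dom ι => (∏ i, beta (k i) (x.1 i)) * evalSeq bs x}

/-- The span of the products. -/
def polyMod (a b : WithTop ι) (D w : ℕ) : Submodule ℤ (Dom ι → ℂ) :=
  Submodule.span ℤ (polyProducts a b D w)

theorem polyMod_mono {a a' b b' : WithTop ι} {D D' : ℕ} (ha : a' ≤ a) (hb : b ≤ b') (hD : D ≤ D')
    (w : ℕ) : polyMod a b D w ≤ polyMod a' b' D' w := by
  refine Submodule.span_mono ?_
  rintro _ ⟨k, bs, h1, h2, h3, h4, rfl⟩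
  exact ⟨k, bs, fun i hi => ⟨ha.trans (h1 i hi).1, (h1 i hi).2.trans_le hb⟩, h2.mono ha hb,
    h3.trans hD, h4, rfl⟩

/-- The factors use disjoint ranges of indices, so at each index at most one Bernoulli function is
nontrivial and no product β_k β_{k'} at the same argument arises; the blocks are simply
concatenated. -/
theorem mul_mem_polyMod {a b c : WithTop ι} {D D' w w' : ℕ} {f g : Dom ι → ℂ}
    (hf : f ∈ polyMod a b D w) (hg : g ∈ polyMod b c D' w') :
    f * g ∈ polyMod a c (D + D') (w + w') := by
  have h := Submodule.mul_mem_mul hf hg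
  rw [polyMod, polyMod, Submodule.span_mul_span] at h
  refine Submodule.span_mono ?_ h
  rintro _ ⟨_, ⟨k, bs, h1, h2, h3, h4, rfl⟩, _, ⟨k', bs', h1', h2', h3', h4', rfl⟩, rfl⟩
  refine ⟨k + k', bs ++ bs', fun i hi => ?_, h2.append h2', ?_, ?_, ?_⟩
  · by_cases hk : k i = 0
    · have := h1' i (by simpa [hk] using hi)
      exact ⟨h2.le.trans this.1, this.2⟩
    · exact ⟨(h1 i hk).1, (h1 i hk).2.trans_le h2'.le⟩
  · simp only [depthSeq, List.map_append, List.sum_append] at *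
    omega
  · simp only [wtSeq, List.map_append, List.sum_append, Pi.add_apply, Finset.sum_add_distrib] at *
    omega
  · funext x
    have hb : ∀ i, beta ((k + k') i) (x.1 i) = beta (k i) (x.1 i) * beta (k' i) (x.1 i) := by
      intro i
      by_cases hk : k i = 0
      · simp [hk, beta_zero]
      · have hk' : k' i = 0 := by
          by_contra hk'
          exact absurd ((h1 i hk).2.trans_le (h1' i hk').1) (lt_irrefl _)
        simp [hk', beta_zero]
    simp only [hb, Finset.prod_mul_distrib, evalSeq_append, Pi.mul_apply]
    ring

theorem evalSeq_mem_polyMod {a b : WithTop ι} {bs : List (WithTop ι × List (ℕ × ι))}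
    (h : ValidSeq a bs b) :
    (fun x : Dom ι => evalSeq bs x) ∈ polyMod a b (depthSeq bs) (wtSeq bs) :=
  Submodule.subset_span ⟨0, bs, by simp, h, le_rfl, by simp, by simp [beta_zero]⟩

theorem block_mem_polyMod {a b e : WithTop ι} {L : List (ℕ × ι)} (h0 : L ≠ [])
    (hL : (L.map Prod.snd).Pairwise (· > ·)) (h : ∀ q ∈ L, a ≤ q.2 ∧ (q.2 : WithTop ι) < e)
    (hb : e ≤ b) : (fun x : Dom ι => block e L x) ∈ polyMod a b L.length (wt L) := by
  have hv : ValidSeq a [(e, L)] b := ⟨h0, hL, h, hb⟩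
  simpa [evalSeq, depthSeq, wtSeq] using evalSeq_mem_polyMod hv

theorem beta_mul_mem_polyMod {i : ι} {b : WithTop ι} {D w : ℕ} (k : ℕ) (hi : i < b)
    {bs : List (WithTop ι × List (ℕ × ι))} (h : ValidSeq i bs b) (hD : depthSeq bs ≤ D)
    (hw : wtSeq bs = w) :
    (fun x : Dom ι => beta k (x.1 i) * evalSeq bs x) ∈ polyMod (i : WithTop ι) b D (k + w) := by
  classical
  refine Submodule.subset_span ⟨Pi.single i k, bs, fun a ha => ?_, h, hD, ?_, ?_⟩
  · have : a = i := by
      by_contra hne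
      exact ha (Pi.single_eq_of_ne hne _)
    subst this
    exact ⟨le_rfl, hi⟩
  · rw [Finset.sum_pi_single', if_pos (Finset.mem_univ _), hw]
  · funext x
    rw [Finset.prod_eq_single i (fun a _ ha => by rw [Pi.single_eq_of_ne ha, beta_zero])
      (fun h => absurd (Finset.mem_univ i) h), Pi.single_eq_same]

/-- After `exists_revBlock_eq` the smallest index is i, so the Bernoulli function at x_i fits in the
same range [i, b). -/
theorem beta_mul_revBlock_mem {i : ι} {b : WithTop ι} {L : List (ℕ × ι)} (h0 : L ≠ [])
    (hL : (i :: L.map Prod.snd).Pairwise (· < ·)) (hb : ∀ p ∈ L, (p.2 : WithTop ι) ≤ b) (k : ℕ) :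
    (fun x : Dom ι => beta k (x.1 i) * revBlock i L x) ∈
      polyMod (i : WithTop ι) b L.length (k + wt L) := by
  obtain ⟨⟨m, j⟩, T, rfl⟩ := List.exists_cons_of_ne_nil h0
  obtain ⟨Q, hQ, h⟩ := exists_revBlock_eq T m j hL hb
  have hij : i < j := by simp at hL; exact hL.1.1
  have hib : (i : WithTop ι) < b :=
    (WithTop.coe_lt_coe.2 hij).trans_le (hb (m, j) (by simp))
  have h1 : (fun x : Dom ι => beta k (x.1 i) * revBlock i ((m, j) :: T) x) =
      fun x : Dom ι => beta k (x.1 i) * Q x := funext fun x => by rw [h x x.2]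
  rw [h1]
  clear h h1
  induction hQ using Submodule.span_induction with
  | mem f hf =>
    obtain ⟨e, m', L, bs, h1, h2, h3, h4, h5, h6, rfl⟩ := hf
    have hv : ValidSeq (i : WithTop ι) (((e : WithTop ι), L ++ [(m', i)]) :: bs) b := by
      have hiL : ∀ q ∈ L, i < q.2 := fun q hq => hij.trans_le (WithTop.coe_le_coe.1 (h2 q hq).1)
      refine ⟨by simp, ?_, ?_, h4⟩
      · rw [List.map_append, List.pairwise_append]
        exact ⟨h1, by simp, by simpa using fun a b hab => hiL (b, a) hab⟩
      · simp only [List.mem_append, List.mem_singleton]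
        rintro q (hq | rfl)
        · exact ⟨WithTop.coe_le_coe.2 (hiL q hq).le, WithTop.coe_lt_coe.2 (h2 q hq).2⟩
        · exact ⟨le_rfl, WithTop.coe_lt_coe.2 (hij.trans_le (WithTop.coe_le_coe.1 h3))⟩
    have := beta_mul_mem_polyMod (D := ((m, j) :: T).length) (w := wt ((m, j) :: T)) k hib hv
      (by simp [depthSeq] at h5 ⊢; omega) (by simp [wtSeq] at h6 ⊢; omega)
    simpa using this
  | zero => simp only [Pi.zero_apply, mul_zero]; exact zero_mem _
  | add f g _ _ hf hg => simp only [Pi.add_apply, mul_add]; exact add_mem hf hg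
  | smul c f _ hf =>
    simp only [Pi.smul_apply, mul_smul_comm]
    exact Submodule.smul_mem _ c hf

theorem int_mul_mem {E : Type*} {M : Submodule ℤ (E → ℂ)} {f : E → ℂ} (hf : f ∈ M) (c : ℤ) :
    (fun x => (c : ℂ) * f x) ∈ M := by
  convert! Submodule.smul_mem _ c hf using 1
  funext x
  simp

theorem lead_mem_polyMod {i : ι} {b : WithTop ι} {t : List (ℕ × ι)}
    (ht : (i :: t.map Prod.snd).Pairwise (· < ·)) (hb : ∀ p ∈ t, (p.2 : WithTop ι) ≤ b)
    (hi : i < b) (k : ℕ) :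
    (fun x : Dom ι => lead i t k x) ∈ polyMod (i : WithTop ι) b t.length (k + wt t) := by
  have hv : ValidSeq (i : WithTop ι) [] b := hi.le
  have h1 : (fun x : Dom ι => (-1) ^ t.length * beta (k + wt t) (x.1 i)) ∈
      polyMod (i : WithTop ι) b t.length (k + wt t) := by
    have := int_mul_mem (beta_mul_mem_polyMod (D := t.length) (w := 0) (k + wt t) hi hv
      (by simp [depthSeq]) (by simp [wtSeq])) ((-1) ^ t.length)
    simpa using this
  refine add_mem h1 ?_
  have hwf := wf_decTerms t k
  generalize decTerms t k = T at hwf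
  induction T with
  | nil => exact zero_mem _
  | cons q T ih =>
    obtain ⟨c, k', L⟩ := q
    obtain ⟨⟨g1, g2, g3⟩, hT⟩ := List.forall_mem_cons.1 hwf
    have hL := beta_mul_revBlock_mem (b := b) g1 (ht.sublist (g2.cons_cons i)) (fun p hp => by
      obtain ⟨q, hq, hqp⟩ := List.mem_map.1 (g2.subset (List.mem_map_of_mem hp))
      rw [← hqp]
      exact hb q hq) k'
    have hlen : L.length ≤ t.length := by simpa using g2.length_le
    simp only at g3
    rw [g3] at hL
    have := add_mem (int_mul_mem (polyMod_mono le_rfl le_rfl hlen _ hL) c) (ih hT)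
    convert! this using 1
    funext x
    simp [mul_assoc]

/-- In each summand the block uses indices below j and the factor `lead` uses j and larger ones, so
`mul_mem_polyMod` applies with the cut at j. -/
theorem asym_mem_polyMod {a b : WithTop ι} {j : ι} {L t : List (ℕ × ι)}
    (hL : ((L.map Prod.snd)).Pairwise (· > ·)) (hLj : ∀ q ∈ L, a ≤ q.2 ∧ q.2 < j) (ha : a ≤ j)
    (ht : (j :: t.map Prod.snd).Pairwise (· < ·)) (hb : ∀ p ∈ t, (p.2 : WithTop ι) ≤ b)
    (hj : j < b) (k : ℕ) :
    (fun x : Dom ι => asym j L t k x) ∈ polyMod a b (L.length + t.length) (k + wt t + wt L) := by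
  induction L generalizing j t with
  | nil =>
    simpa [asym] using polyMod_mono ha le_rfl le_rfl _ (lead_mem_polyMod ht hb hj k)
  | cons p L ih =>
    have hp := hLj p (by simp)
    have h1 := mul_mem_polyMod (block_mem_polyMod (a := a) (b := (j : WithTop ι)) (e := j)
      (L := p :: L) (by simp) hL
      (fun q hq => ⟨(hLj q hq).1, WithTop.coe_lt_coe.2 (hLj q hq).2⟩) le_rfl)
      (lead_mem_polyMod ht hb hj k)
    have h2 := ih (j := p.2) (t := (p.1, j) :: t) (List.pairwise_cons.1 hL).2
      (fun q hq => ⟨(hLj q (List.mem_cons_of_mem _ hq)).1,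
        (List.pairwise_cons.1 hL).1 q.2 (List.mem_map_of_mem hq)⟩) hp.1
      (List.pairwise_cons.2 ⟨fun c hc => by
        rcases List.mem_cons.1 hc with rfl | hc
        · exact hp.2
        · exact hp.2.trans ((List.pairwise_cons.1 ht).1 c hc), ht⟩)
      (List.forall_mem_cons.2 ⟨hj.le, hb⟩) ((WithTop.coe_lt_coe.2 hp.2).trans hj)
    have e1 : wt (p :: L) + (k + wt t) = k + wt t + wt (p :: L) := by ring
    have e2 : k + wt ((p.1, j) :: t) + wt L = k + wt t + wt (p :: L) := by simp; ring
    have e3 : L.length + ((p.1, j) :: t).length = (p :: L).length + t.length := by simp; ring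
    rw [e1] at h1
    rw [e2, e3] at h2
    exact add_mem h1 h2

/-- Every summand singles out one index as the base of `lead`, and that index does not count towards
the depth. This is the origin of the drop by one. -/
theorem expansion_mem_polyMod {a b : WithTop ι} {L : List (ℕ × ι)} (h0 : L ≠ [])
    (hL : ((L.map Prod.snd)).Pairwise (· > ·))
    (h : ∀ q ∈ L, a ≤ q.2 ∧ (q.2 : WithTop ι) < b) :
    (fun x : Dom ι => expansion L x) ∈ polyMod a b (L.length - 1) (wt L) := by
  obtain ⟨⟨m, j⟩, L, rfl⟩ := List.exists_cons_of_ne_nil h0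
  have := neg_mem (asym_mem_polyMod (a := a) (b := b) (j := j) (L := L) (t := [])
    (List.pairwise_cons.1 hL).2 (fun q hq => ⟨(h q (List.mem_cons_of_mem _ hq)).1,
      (List.pairwise_cons.1 hL).1 q.2 (List.mem_map_of_mem hq)⟩) (h (m, j) (by simp)).1
    (by simp) (by simp) (h (m, j) (by simp)).2 (m + 1))
  have e : m + 1 + wt ([] : List (ℕ × ι)) + wt L = wt ((m, j) :: L) := by simp
  rw [e] at this
  exact this

/-- The parity theorem in terms of blocks. -/
theorem block_sub_inverted_mem (n : ℕ) : ∀ (a : WithTop ι) (L : List (ℕ × ι)), L.length ≤ n →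
    L ≠ [] → (L.map Prod.snd).Pairwise (· > ·) → (∀ q ∈ L, a ≤ q.2) →
    (fun x : Dom ι => block ⊤ L x - inverted L x) ∈ polyMod a ⊤ (L.length - 1) (wt L) := by
  induction n with
  | zero =>
    intro a L hn h0
    exact absurd (List.length_eq_zero_iff.1 (Nat.le_zero.1 hn)) h0
  | succ n ih =>
    intro a L hn h0 hL ha
    obtain ⟨Q, hQ, h⟩ := exists_remainder_sub_inverted_eq L (hL.imp ne_of_gt) h0
    have h1 : (fun x : Dom ι => block ⊤ L x - inverted L x) =
        fun x : Dom ι => expansion L x + Q x := funext fun x => by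
      rw [← h x x.2, remainder]; ring
    rw [h1]
    refine add_mem (expansion_mem_polyMod h0 hL fun q hq => ⟨ha q hq, WithTop.coe_lt_top _⟩) ?_
    clear h h1
    induction hQ using Submodule.span_induction with
    | mem f hf =>
      obtain ⟨l₁, l₂, g1, g2, g3, g4, rfl⟩ := hf
      rw [List.length_map] at g3
      have hlen : l₂.length + l₁.length ≤ L.length := by simpa using g1.length_le
      have hpos := List.length_pos_iff.2 g2
      have hpw := hL.sublist g1
      rw [List.pairwise_append] at hpw
      have hmem : ∀ q, q ∈ l₂.map Prod.snd ++ l₁.map Prod.snd → a ≤ (q : WithTop ι) :=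
        fun q hq => by
          obtain ⟨p, hp, rfl⟩ := List.mem_map.1 (g1.subset hq)
          exact ha p hp
      -- Since `l₂` is shorter than `L`, the theorem holds for it: its inversion is its block up to
      -- lower depth, hence of depth at most its length.
      have hinv : ∀ a' : WithTop ι, (∀ q ∈ l₂, a' ≤ q.2) →
          (fun x : Dom ι => inverted l₂ x) ∈ polyMod a' ⊤ l₂.length (wt l₂) := fun a' ha' => by
        have k1 := ih a' l₂ (by omega) g2 hpw.1 ha'
        have k2 := block_mem_polyMod (a := a') (b := ⊤) (e := ⊤) g2 hpw.1
          (fun q hq => ⟨ha' q hq, WithTop.coe_lt_top _⟩) le_rfl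
        have k3 := sub_mem k2 (polyMod_mono le_rfl le_rfl (Nat.sub_le _ 1) _ k1)
        convert! k3 using 1
        funext x
        simp
      rcases l₁ with _ | ⟨p, l₁⟩
      · have := hinv a fun q hq => hmem _ (List.mem_append_left _ (List.mem_map_of_mem hq))
        rw [show wt L = wt l₂ by rw [← g4]; simp]
        simpa [expansion] using polyMod_mono le_rfl le_rfl (by omega) _ this
      -- The indices of the expansion lie below those of `l₂`, and the ranges are separated at the
      -- smallest index q.2 of `l₂`. The expansion has depth one less than its length, which
      -- compensates for the full depth allowed to the inversion.
      · obtain ⟨l, q, rfl⟩ : ∃ l q, l₂ = l ++ [q] := by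
          rcases List.eq_nil_or_concat l₂ with h | ⟨l, q, h⟩
          · exact absurd h g2
          · exact ⟨l, q, by rw [h, List.concat_eq_append]⟩
        have k1 := hinv (q.2 : WithTop ι) fun r hr => by
          rcases List.mem_append.1 hr with hr | hr
          · have := hpw.1
            rw [List.map_append, List.pairwise_append] at this
            exact WithTop.coe_le_coe.2 (this.2.2 r.2 (List.mem_map_of_mem hr) q.2 (by simp)).le
          · rw [List.mem_singleton.1 hr]
        have k2 := expansion_mem_polyMod (a := a) (b := (q.2 : WithTop ι)) (L := p :: l₁) (by simp)
          hpw.2.1 fun r hr => ⟨hmem _ (List.mem_append_right _ (List.mem_map_of_mem hr)),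
            WithTop.coe_lt_coe.2 (hpw.2.2 q.2 (by simp) r.2 (List.mem_map_of_mem hr))⟩
        have k3 := mul_mem_polyMod k2 k1
        rw [g4] at k3
        refine polyMod_mono le_rfl le_rfl ?_ _ k3
        simp at hlen ⊢
        omega
    | zero => exact zero_mem _
    | add f g _ _ hf hg => exact add_mem hf hg
    | smul c f _ hf => exact Submodule.smul_mem _ c hf

end PolyMod

end MPL

/-! ### Analytic continuation along the segment, and the power series at the origin. -/

namespace MPL

/-! ### Holomorphic dependence on parameters -/

/-- A family of functions on `[0, ∞)` that depends holomorphically on a parameter, and is locally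
uniformly bounded by multiples of `b`. -/
structure HolTame (U : Set ℂ) (b : ℝ → ℝ) (H : ℂ → ℝ → ℂ) : Prop where
  diff : ∀ u, 0 ≤ u → DifferentiableOn ℂ (fun t => H t u) U
  cont : ∀ t ∈ U, ContinuousOn (H t) (Ici 0)
  bound : ∀ t₀ ∈ U, ∃ C, 0 ≤ C ∧ ∀ᶠ t in 𝓝 t₀, ∀ u, 0 ≤ u → ‖H t u‖ ≤ C * b u

theorem tailInt_congr {h h' : ℝ → ℂ} {v : ℝ} (hh : ∀ u, v < u → h u = h' u) :
    tailInt h v = tailInt h' v :=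
  setIntegral_congr_fun measurableSet_Ioi fun u hu => hh u hu

/-- Along the continuation an entry may lie in (0, 1), and then 1 - x e^{-u} vanishes for some u <
0. Only u ≥ 0 can be controlled; freezing the function for u < 0 makes the results for the whole
line available. -/
theorem isTame_comp_max {C : ℝ} {h : ℝ → ℂ} (hc : ContinuousOn h (Ici 0)) (hC : 0 ≤ C)
    (hb : ∀ u, 0 ≤ u → ‖h u‖ ≤ C * Real.exp (-u)) : IsTame C (fun u => h (max u 0)) where
  cont := hc.comp_continuous (by fun_prop) fun u => le_max_right u 0
  bound u := (hb _ (le_max_right u 0)).trans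
    (mul_le_mul_of_nonneg_left (Real.exp_le_exp.2 (neg_le_neg (le_max_left u 0))) hC)

theorem tailInt_comp_max (h : ℝ → ℂ) {v : ℝ} (hv : 0 ≤ v) :
    tailInt (fun u => h (max u 0)) v = tailInt h v :=
  tailInt_congr fun u hu => by rw [max_eq_left (hv.trans hu.le)]

/-- The derivative is the pointwise limit of the difference quotients with increments 1/(n+1). -/
theorem aestronglyMeasurable_deriv {H : ℂ → ℝ → ℂ} {μ : Measure ℝ} {t₀ : ℂ}
    (hm : ∀ᶠ t in 𝓝 t₀, AEStronglyMeasurable (H t) μ)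
    (hd : ∀ᵐ u ∂μ, DifferentiableAt ℂ (fun t => H t u) t₀) :
    AEStronglyMeasurable (fun u => deriv (fun t => H t u) t₀) μ := by
  have hseq : Tendsto (fun n : ℕ => ((1 / ((n : ℝ) + 1) : ℝ) : ℂ)) atTop (𝓝[≠] 0) := by
    refine tendsto_nhdsWithin_iff.2 ⟨?_, Eventually.of_forall fun n => ?_⟩
    · have := (Complex.continuous_ofReal.tendsto 0).comp tendsto_one_div_add_atTop_nhds_zero_nat
      simpa [Function.comp_def] using this
    · exact Complex.ofReal_ne_zero.2 (by positivity)
  have hseq' : Tendsto (fun n : ℕ => t₀ + ((1 / ((n : ℝ) + 1) : ℝ) : ℂ)) atTop (𝓝 t₀) := by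
    simpa using (tendsto_nhdsWithin_iff.1 hseq).1.const_add t₀
  obtain ⟨N, hN⟩ := eventually_atTop.1 (hseq'.eventually hm)
  refine aestronglyMeasurable_of_tendsto_ae (u := atTop) (f := fun (n : ℕ) u =>
    ((1 / (((n + N : ℕ) : ℝ) + 1) : ℝ) : ℂ)⁻¹ •
      (H (t₀ + ((1 / (((n + N : ℕ) : ℝ) + 1) : ℝ) : ℂ)) u - H t₀ u)) (fun n => ?_) ?_
  · exact ((hN (n + N) (Nat.le_add_left _ _)).sub hm.self_of_nhds).const_smul
      ((1 / (((n + N : ℕ) : ℝ) + 1) : ℝ) : ℂ)⁻¹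
  · filter_upwards [hd] with u hu
    exact (hasDerivAt_iff_tendsto_slope_zero.1 hu.hasDerivAt).comp
      (hseq.comp (tendsto_add_atTop_nat N))

theorem HolTame.tailInt {U : Set ℂ} (hU : IsOpen U) {H : ℂ → ℝ → ℂ}
    (hH : HolTame U (fun u => Real.exp (-u)) H) :
    HolTame U (fun u => Real.exp (-u)) fun t => tailInt (H t) where
  diff v hv t₀ ht₀ := by
    obtain ⟨C, hC, hb⟩ := hH.bound t₀ ht₀
    obtain ⟨ε, hε, hball⟩ := Metric.mem_nhds_iff.1 (hb.and (hU.mem_nhds ht₀))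
    -- Discs of radius ε/2 centred in the ball of radius ε/2 stay where `H` is bounded, so Cauchy's
    -- estimate dominates the derivative by C e^{-u} / (ε/2).
    have hε2 : 0 < ε / 2 := half_pos hε
    have hsub : ∀ t ∈ Metric.ball t₀ (ε / 2), Metric.closedBall t (ε / 2) ⊆ Metric.ball t₀ ε :=
      fun t ht => Metric.closedBall_subset_ball' (by
        have := Metric.mem_ball.1 ht
        linarith)
    have hm : ∀ t ∈ Metric.ball t₀ ε,
        AEStronglyMeasurable (H t) (volume.restrict (Ioi v)) := fun t ht =>
      ((hH.cont t (hball ht).2).mono fun u hu => hv.trans (le_of_lt hu)).aestronglyMeasurable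
        measurableSet_Ioi
    have hd : ∀ u, 0 ≤ u → ∀ t ∈ Metric.ball t₀ ε, DifferentiableAt ℂ (fun t => H t u) t :=
      fun u hu t ht => (hH.diff u hu).differentiableAt (hU.mem_nhds (hball ht).2)
    have hpos : ∀ᵐ u ∂volume.restrict (Ioi v), 0 ≤ u :=
      (ae_restrict_mem measurableSet_Ioi).mono fun u hu => hv.trans (le_of_lt hu)
    have hint := integrableOn_const_mul_exp_neg C v
    refine (hasDerivAt_integral_of_dominated_loc_of_deriv_le (μ := volume.restrict (Ioi v))
      (F := H) (F' := fun t u => deriv (fun t => H t u) t)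
      (bound := fun u => C * Real.exp (-u) / (ε / 2)) (Metric.ball_mem_nhds t₀ hε2)
      ?_ ?_ ?_ ?_ ?_ ?_).2.differentiableAt.differentiableWithinAt
    · filter_upwards [Metric.ball_mem_nhds t₀ hε] with t ht using hm t ht
    · refine hint.mono' (hm t₀ (Metric.mem_ball_self hε)) ?_
      filter_upwards [hpos] with u hu using (hball (Metric.mem_ball_self hε)).1 u hu
    · refine aestronglyMeasurable_deriv ?_ ?_
      · filter_upwards [Metric.ball_mem_nhds t₀ hε] with t ht using hm t ht
      · filter_upwards [hpos] with u hu using hd u hu t₀ (Metric.mem_ball_self hε)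
    · filter_upwards [hpos] with u hu t ht
      refine Complex.norm_deriv_le_of_forall_mem_sphere_norm_le hε2 ?_ fun z hz => ?_
      · refine DifferentiableOn.diffContOnCl fun z hz => ?_
        exact (hd u hu z (hsub t ht
          (Metric.closure_ball_subset_closedBall hz))).differentiableWithinAt
      · exact (hball (hsub t ht (Metric.sphere_subset_closedBall hz))).1 u hu
    · exact hint.div_const _
    · filter_upwards [hpos] with u hu t ht
      exact (hd u hu t (hsub t ht (Metric.mem_closedBall_self hε2.le))).hasDerivAt
  cont t ht := by
    obtain ⟨C, hC, hb⟩ := hH.bound t ht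
    have h1 := (isTame_comp_max (hH.cont t ht) hC hb.self_of_nhds).tailInt.cont
    exact h1.continuousOn.congr fun v hv => (tailInt_comp_max (H t) hv).symm
  bound t₀ ht₀ := by
    obtain ⟨C, hC, hb⟩ := hH.bound t₀ ht₀
    exact ⟨C, hC, hb.mono fun t ht v hv => norm_tailInt_le fun u hu => ht u (hv.trans hu.le)⟩

theorem HolTame.iterate_tailInt {U : Set ℂ} (hU : IsOpen U) {H : ℂ → ℝ → ℂ}
    (hH : HolTame U (fun u => Real.exp (-u)) H) (n : ℕ) :
    HolTame U (fun u => Real.exp (-u)) fun t => MPL.tailInt^[n] (H t) := by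
  induction n with
  | zero => exact hH
  | succ n ih => simpa only [Function.iterate_succ_apply'] using ih.tailInt hU

theorem one_sub_mul_ne_zero {x : ℂ} (hx : 1 - x ∈ slitPlane) {r : ℝ} (h0 : 0 ≤ r) (h1 : r ≤ 1) :
    1 - x * r ≠ 0 := by
  intro h
  rcases h0.eq_or_lt with rfl | hr
  · simp at h
  · have hx' : x = ((1 / r : ℝ) : ℂ) := by
      rw [Complex.ofReal_div, Complex.ofReal_one, eq_div_iff (Complex.ofReal_ne_zero.2 hr.ne')]
      exact (sub_eq_zero.1 h).symm
    have h2 : 1 - x = ((1 - 1 / r : ℝ) : ℂ) := by rw [hx']; push_cast; ring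
    rw [h2, Complex.ofReal_mem_slitPlane] at hx
    have := (one_le_div hr).2 h1
    linarith

theorem exists_norm_geom_mul_le {x₀ : ℂ} (hx : 1 - x₀ ∈ slitPlane) :
    ∃ C, 0 ≤ C ∧ ∀ᶠ x in 𝓝 x₀, ∀ r : ℝ, 0 ≤ r → r ≤ 1 → ‖geom (x * r)‖ ≤ C * r := by
  have hopen : IsOpen {x : ℂ | 1 - x ∈ slitPlane} :=
    Complex.isOpen_slitPlane.preimage (by fun_prop)
  obtain ⟨ε, hε, hball⟩ := Metric.nhds_basis_closedBall.mem_iff.1 (hopen.mem_nhds hx)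
  have hK : IsCompact (Metric.closedBall x₀ ε ×ˢ Icc (0 : ℝ) 1) :=
    (isCompact_closedBall x₀ ε).prod isCompact_Icc
  have hcont : ContinuousOn (fun p : ℂ × ℝ => p.1 / (1 - p.1 * p.2))
      (Metric.closedBall x₀ ε ×ˢ Icc (0 : ℝ) 1) :=
    ContinuousOn.div (by fun_prop) (by fun_prop) fun p hp =>
      one_sub_mul_ne_zero (hball hp.1) hp.2.1 hp.2.2
  obtain ⟨C, hC⟩ := hK.exists_bound_of_continuousOn hcont
  refine ⟨C, (norm_nonneg _).trans (hC (x₀, 0) ⟨Metric.mem_closedBall_self hε.le, by simp⟩), ?_⟩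
  filter_upwards [Metric.closedBall_mem_nhds x₀ hε] with x hx r h0 h1
  have := hC (x, r) ⟨hx, h0, h1⟩
  rw [geom, mul_div_right_comm, norm_mul, Complex.norm_real, Real.norm_of_nonneg h0]
  exact mul_le_mul_of_nonneg_right this h0

theorem holTame_geom_mul {U : Set ℂ} (hU : IsOpen U) {x : ℂ → ℂ} (hx : DifferentiableOn ℂ x U)
    (hs : ∀ t ∈ U, 1 - x t ∈ slitPlane) {H : ℂ → ℝ → ℂ} (hH : HolTame U (fun _ => 1) H) :
    HolTame U (fun u => Real.exp (-u)) fun t u => geom (x t * (Real.exp (-u) : ℝ)) * H t u := by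
  have hne : ∀ t ∈ U, ∀ u : ℝ, 0 ≤ u → 1 - x t * (Real.exp (-u) : ℝ) ≠ 0 := fun t ht u hu =>
    one_sub_mul_ne_zero (hs t ht) (Real.exp_pos _).le (Real.exp_le_one_iff.2 (by linarith))
  refine ⟨fun u hu => ?_, fun t ht => ?_, fun t₀ ht₀ => ?_⟩
  · refine DifferentiableOn.mul ?_ (hH.diff u hu)
    unfold geom
    exact (hx.mul_const _).div ((differentiableOn_const _).sub (hx.mul_const _))
      fun t ht => hne t ht u hu
  · refine ContinuousOn.mul ?_ (hH.cont t ht)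
    unfold geom
    exact ContinuousOn.div (by fun_prop) (by fun_prop) fun u hu => hne t ht u hu
  · obtain ⟨C, hC, hb⟩ := hH.bound t₀ ht₀
    obtain ⟨A, hA, ha⟩ := exists_norm_geom_mul_le (hs t₀ ht₀)
    have hxc : Tendsto x (𝓝 t₀) (𝓝 (x t₀)) := (hx.continuousOn.continuousAt (hU.mem_nhds ht₀))
    refine ⟨A * C, by positivity, ?_⟩
    filter_upwards [hb, hxc.eventually ha] with t h1 h2 u hu
    rw [norm_mul, mul_right_comm]
    refine mul_le_mul (h2 _ (Real.exp_pos _).le (Real.exp_le_one_iff.2 (by linarith))) ?_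
      (norm_nonneg _) (by positivity)
    simpa using h1 u hu

theorem HolTame.weaken {U : Set ℂ} {H : ℂ → ℝ → ℂ}
    (hH : HolTame U (fun u => Real.exp (-u)) H) : HolTame U (fun _ => 1) H where
  diff := hH.diff
  cont := hH.cont
  bound t₀ ht₀ := by
    obtain ⟨C, hC, hb⟩ := hH.bound t₀ ht₀
    refine ⟨C, hC, hb.mono fun t ht u hu => (ht u hu).trans (mul_le_mul_of_nonneg_left ?_ hC)⟩
    exact Real.exp_le_one_iff.2 (by linarith)

theorem holTame_flow {α : Type*} {U : Set ℂ} (hU : IsOpen U) (x : α → ℂ → ℂ) (L : List (ℕ × α))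
    (hx : ∀ p ∈ L, DifferentiableOn ℂ (x p.2) U) (hs : ∀ p ∈ L, ∀ t ∈ U, 1 - x p.2 t ∈ slitPlane) :
    HolTame U (fun _ => 1) fun t => flow (L.map fun p => (p.1, x p.2 t)) := by
  induction L with
  | nil =>
    refine ⟨fun u _ => differentiableOn_const _, fun t _ => continuousOn_const, fun t _ =>
      ⟨1, one_pos.le, Eventually.of_forall fun t u _ => by simp⟩⟩
  | cons p L ih =>
    obtain ⟨hx1, hx2⟩ := List.forall_mem_cons.1 hx
    obtain ⟨hs1, hs2⟩ := List.forall_mem_cons.1 hs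
    exact ((holTame_geom_mul hU hx1 hs1 (ih hx2 hs2)).iterate_tailInt hU (p.1 + 1)).weaken

/-! ### The series -/

theorem hasSum_iterate_tailInt {α : Type*} [Countable α] {c : α → ℂ} {e : α → ℕ} {h : ℝ → ℂ}
    (he : ∀ a, 0 < e a) (hs : Summable fun a => ‖c a‖)
    (hh : ∀ u, 0 ≤ u → HasSum (fun a => c a * (Real.exp (-(e a * u)) : ℝ)) (h u)) (n : ℕ) :
    (Summable fun a => ‖c a / (e a : ℂ) ^ n‖) ∧ ∀ u, 0 ≤ u →
      HasSum (fun a => c a / (e a : ℂ) ^ n * (Real.exp (-(e a * u)) : ℝ)) (tailInt^[n] h u) := by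
  have he' : ∀ a, (1 : ℝ) ≤ e a := fun a => by exact_mod_cast he a
  induction n with
  | zero => simpa using ⟨hs, by simpa using hh⟩
  | succ n ih =>
    have hle : ∀ a, ‖c a / (e a : ℂ) ^ n‖ / e a ≤ ‖c a / (e a : ℂ) ^ n‖ := fun a =>
      div_le_self (norm_nonneg _) (he' a)
    have heq : ∀ a, c a / (e a : ℂ) ^ (n + 1) = c a / (e a : ℂ) ^ n / e a := fun a => by
      rw [div_div, ← pow_succ]
    simp only [heq, Function.iterate_succ_apply']
    refine ⟨ih.1.of_nonneg_of_le (fun a => norm_nonneg _) fun a => ?_, fun u hu => ?_⟩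
    · rw [norm_div, Complex.norm_natCast]
      exact hle a
    · refine hasSum_tailInt he ?_ fun s hs => ih.2 s (hu.trans hs.le)
      refine ih.1.of_nonneg_of_le (fun a => by positivity) fun a => ?_
      refine (mul_le_of_le_one_right (by positivity) ?_).trans (hle a)
      exact Real.exp_le_one_iff.2 (neg_nonpos.2 (mul_nonneg (by positivity) hu))

/-- The arguments of `flow`. -/
def flowList {d : ℕ} (n : Fin d → ℕ+) (x : Fin d → ℂ) : List (ℕ × ℂ) :=
  (List.ofFn fun i => ((n i : ℕ) - 1, x i)).reverse

theorem flowList_succ {d : ℕ} (n : Fin (d + 1) → ℕ+) (x : Fin (d + 1) → ℂ) :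
    flowList n x = ((n (Fin.last d) : ℕ) - 1, x (Fin.last d)) ::
      flowList (fun i => n i.castSucc) (fun i => x i.castSucc) := by
  rw [flowList, List.ofFn_succ', List.concat_eq_append, List.reverse_append]
  rfl

/-- The largest index. -/
def topIndex : {d : ℕ} → (Fin d → ℕ+) → ℕ
  | 0, _ => 0
  | _ + 1, k => k (Fin.last _)

theorem topIndex_lt {d : ℕ} {k : Fin (d + 1) → ℕ+} (hk : StrictMono k) :
    topIndex (fun i => k i.castSucc) < k (Fin.last d) := by
  cases d with
  | zero => exact (k (Fin.last 0)).pos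
  | succ d => exact hk (Fin.castSucc_lt_last _)

theorem le_topIndex {d : ℕ} {k : Fin d → ℕ+} (hk : StrictMono k) (i : Fin d) :
    (k i : ℕ) ≤ topIndex k := by
  cases d with
  | zero => exact i.elim0
  | succ d => exact hk.monotone (Fin.le_last i)

/-- Extension of a sequence by a last entry. -/
def snocSeq {d : ℕ} (k : Fin d → ℕ+) (l : ℕ+) : Fin (d + 1) → ℕ+ := Fin.snoc (α := fun _ => ℕ+) k l

@[simp] theorem snocSeq_last {d : ℕ} (k : Fin d → ℕ+) (l : ℕ+) : snocSeq k l (Fin.last d) = l :=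
  Fin.snoc_last (α := fun _ => ℕ+) _ _

@[simp] theorem snocSeq_castSucc {d : ℕ} (k : Fin d → ℕ+) (l : ℕ+) (i : Fin d) :
    snocSeq k l i.castSucc = k i :=
  Fin.snoc_castSucc (α := fun _ => ℕ+) _ _ _

theorem strictMono_snocSeq {d : ℕ} {k : Fin d → ℕ+} (hk : StrictMono k) {l : ℕ+}
    (hl : topIndex k < l) : StrictMono (snocSeq k l) := by
  intro i j hij
  induction j using Fin.lastCases with
  | last =>
    induction i using Fin.lastCases with
    | last => exact absurd hij (lt_irrefl _)
    | cast i =>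
      rw [snocSeq_castSucc, snocSeq_last]
      exact (le_topIndex hk i).trans_lt hl
  | cast j =>
    induction i using Fin.lastCases with
    | last => exact absurd hij (not_lt.2 (Fin.le_last _))
    | cast i =>
      rw [snocSeq_castSucc, snocSeq_castSucc]
      exact hk hij

/-- An increasing sequence is determined by the last gap and the remaining entries. -/
def gapEquiv (d : ℕ) : {k : Fin (d + 1) → ℕ+ // StrictMono k} ≃
    ℕ × {k : Fin d → ℕ+ // StrictMono k} where
  toFun k := ((k.1 (Fin.last d) : ℕ) - topIndex (fun i => k.1 i.castSucc) - 1,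
    ⟨fun i => k.1 i.castSucc, k.2.comp (Fin.strictMono_castSucc)⟩)
  invFun p := ⟨snocSeq p.2.1 (Nat.succPNat (topIndex p.2.1 + p.1)),
    strictMono_snocSeq p.2.2 (by simp)⟩
  left_inv k := by
    have h := topIndex_lt k.2
    refine Subtype.ext (funext fun i => ?_)
    induction i using Fin.lastCases with
    | last =>
      refine PNat.eq ?_
      simp only [snocSeq_last, Nat.succPNat_coe]
      omega
    | cast i => simp only [snocSeq_castSucc]
  right_inv p := by
    obtain ⟨g, k, hk⟩ := p
    simp only [snocSeq_last, snocSeq_castSucc, Nat.succPNat_coe]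
    have h : (topIndex fun i => k i) = topIndex k := rfl
    congr 1
    omega

/-- The coefficients of the series of `flow`. -/
noncomputable def flowCoeff : {d : ℕ} → (Fin d → ℕ+) → (Fin d → ℂ) → (Fin d → ℕ+) → ℂ
  | 0, _, _, _ => 1
  | d + 1, n, x, k =>
    -- The exponent is the gap between the last two summation indices: each `geom` factor sums over
    -- a gap, while the iterated tail integrals divide by powers of the largest index.
    x (Fin.last d) ^ ((k (Fin.last d) : ℕ) - topIndex (fun i => k i.castSucc)) *
      flowCoeff (fun i => n i.castSucc) (fun i => x i.castSucc) (fun i => k i.castSucc) /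
      ((k (Fin.last d) : ℕ) : ℂ) ^ (n (Fin.last d) : ℕ)

theorem hasSum_flow {d : ℕ} (n : Fin d → ℕ+) (x : Fin d → ℂ) (hx : ∀ i, ‖x i‖ < 1) :
    (Summable fun k : {k : Fin d → ℕ+ // StrictMono k} => ‖flowCoeff n x k‖) ∧
    ∀ u, 0 ≤ u → HasSum (fun k : {k : Fin d → ℕ+ // StrictMono k} =>
      flowCoeff n x k * (Real.exp (-(topIndex k.1 * u)) : ℝ)) (flow (flowList n x) u) := by
  induction d with
  | zero =>
    let _ : Unique {k : Fin 0 → ℕ+ // StrictMono k} :=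
      { default := ⟨Fin.elim0, fun i => i.elim0⟩, uniq := fun k => Subtype.ext (Subsingleton.elim _ _) }
    refine ⟨(hasSum_unique _).summable, fun u _ => ?_⟩
    simp [flowList, flowCoeff, topIndex]
  | succ d ih =>
    obtain ⟨ih1, ih2⟩ := ih (fun i => n i.castSucc) (fun i => x i.castSucc) fun i => hx _
    have hl := hx (Fin.last d)
    set y := x (Fin.last d)
    have hg : Summable fun g : ℕ => ‖y ^ (g + 1)‖ := by
      simp only [norm_pow]
      exact (summable_nat_add_iff 1).2 (summable_geometric_of_lt_one (norm_nonneg y) hl)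
    have hexp : ∀ (e : ℕ) (u : ℝ), 0 ≤ u → Real.exp (-(e * u)) ≤ 1 := fun e u hu =>
      Real.exp_le_one_iff.2 (neg_nonpos.2 (mul_nonneg (by positivity) hu))
    -- the series of the integrand
    have key := hasSum_iterate_tailInt
      (α := ℕ × {k : Fin d → ℕ+ // StrictMono k})
      (c := fun p => y ^ (p.1 + 1) *
        flowCoeff (fun i => n i.castSucc) (fun i => x i.castSucc) p.2.1)
      (e := fun p => topIndex p.2.1 + p.1 + 1)
      (h := fun u => geom (y * (Real.exp (-u) : ℝ)) *
        flow (flowList (fun i => n i.castSucc) (fun i => x i.castSucc)) u)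
      (fun p => Nat.succ_pos _) ?_ ?_ (n (Fin.last d))
    · have hcoef : ∀ k : {k : Fin (d + 1) → ℕ+ // StrictMono k}, flowCoeff n x k.1 =
          y ^ ((gapEquiv d k).1 + 1) * flowCoeff (fun i => n i.castSucc) (fun i => x i.castSucc)
            (gapEquiv d k).2.1 / ((topIndex (gapEquiv d k).2.1 + (gapEquiv d k).1 + 1 : ℕ) : ℂ) ^
              (n (Fin.last d) : ℕ) := fun k => by
        have h := topIndex_lt k.2
        simp only [flowCoeff, gapEquiv, Equiv.coe_fn_mk]
        congr 3 <;> omega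
      have htop : ∀ k : {k : Fin (d + 1) → ℕ+ // StrictMono k}, topIndex k.1 =
          topIndex (gapEquiv d k).2.1 + (gapEquiv d k).1 + 1 := fun k => by
        have h := topIndex_lt k.2
        change (k.1 (Fin.last d) : ℕ) = topIndex (fun i => k.1 i.castSucc) +
          ((k.1 (Fin.last d) : ℕ) - topIndex (fun i => k.1 i.castSucc) - 1) + 1
        omega
      simp only [hcoef, htop]
      refine ⟨(gapEquiv d).summable_iff.2 key.1, fun u hu => ?_⟩
      have := (gapEquiv d).hasSum_iff.2 (key.2 u hu)
      rw [flowList_succ]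
      convert! this using 1
      rw [flow, Nat.sub_add_cancel (n (Fin.last d)).pos]
    · simp only [norm_mul]
      simpa only [norm_mul] using hg.mul_norm ih1
    · intro u hu
      have h1 : ‖y * (Real.exp (-u) : ℝ)‖ < 1 := by
        rw [norm_mul, Complex.norm_real, Real.norm_of_nonneg (Real.exp_pos _).le]
        exact (mul_le_of_le_one_right (norm_nonneg y)
          (Real.exp_le_one_iff.2 (by linarith))).trans_lt hl
      have hs1 : Summable fun g : ℕ => ‖(y * (Real.exp (-u) : ℝ)) ^ (g + 1)‖ := by
        simp only [norm_pow]
        exact (summable_nat_add_iff 1).2 (summable_geometric_of_lt_one (norm_nonneg _) h1)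
      have hs2 : Summable fun k : {k : Fin d → ℕ+ // StrictMono k} =>
          ‖flowCoeff (fun i => n i.castSucc) (fun i => x i.castSucc) k.1 *
            (Real.exp (-(topIndex k.1 * u)) : ℝ)‖ := by
        refine ih1.of_nonneg_of_le (fun _ => norm_nonneg _) fun k => ?_
        rw [norm_mul, Complex.norm_real, Real.norm_of_nonneg (Real.exp_pos _).le]
        exact mul_le_of_le_one_right (norm_nonneg _) (hexp _ u hu)
      have hs := summable_mul_of_summable_norm hs1 hs2
      have h4 := (hasSum_geom h1).mul (ih2 u hu) hs
      refine h4.congr_fun fun p => ?_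
      rw [mul_pow, ← Complex.ofReal_pow, ← Real.exp_nat_mul, mul_mul_mul_comm,
        ← Complex.ofReal_mul, ← Real.exp_add]
      congr 3
      push_cast
      ring

/-- Summation by parts in the exponents: gaps as powers of suffix products amount to the indices
themselves as powers of the z_i. The factor c makes the induction work, since dropping the last
variable multiplies the remaining suffix products by it. -/
theorem flowCoeff_eq {d : ℕ} (n : Fin d → ℕ+) (z : Fin d → ℂ) (c : ℂ) {k : Fin d → ℕ+}
    (hk : StrictMono k) :
    flowCoeff n (fun i => (∏ j ∈ Finset.Ici i, z j) * c) k = seriesTerm n z k * c ^ topIndex k := by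
  induction d generalizing c with
  | zero => simp [flowCoeff, seriesTerm, topIndex]
  | succ d ih =>
    have h := topIndex_lt hk
    have h0 : ∀ i : Fin (d + 1), Finset.Icc i (Fin.last d) = Finset.Ici i := fun i => by
      ext j
      simp [Fin.le_last]
    have h1 : ∀ i : Fin d, (∏ j ∈ Finset.Ici i.castSucc, z j) * c =
        (∏ j ∈ Finset.Ici i, z j.castSucc) * (z (Fin.last d) * c) := fun i => by
      rw [← h0, ← Finset.prod_Ico_mul_eq_prod_Icc (Fin.le_last _), ← Fin.map_castSuccEmb_Ici,
        Finset.prod_map, mul_assoc]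
      rfl
    have h2 : ∏ j ∈ Finset.Ici (Fin.last d), z j = z (Fin.last d) := by
      rw [← h0, Finset.Icc_self, Finset.prod_singleton]
    have h3 := pow_sub_mul_pow (z (Fin.last d) * c) h.le
    have h4 : seriesTerm n z k = seriesTerm (fun i => n i.castSucc) (fun i => z i.castSucc)
        (fun i => k i.castSucc) * (z (Fin.last d) ^ (k (Fin.last d) : ℕ) /
          ((k (Fin.last d) : ℕ) : ℂ) ^ (n (Fin.last d) : ℕ)) := Fin.prod_univ_castSucc _
    simp only [flowCoeff, h1, h2]
    rw [ih (fun i => n i.castSucc) (fun i => z i.castSucc) _ (k := fun i => k i.castSucc)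
      (hk.comp Fin.strictMono_castSucc), h4, mul_left_comm, h3, mul_pow]
    change _ = _ * c ^ (k (Fin.last d) : ℕ)
    ring

/-- The value of a multiple polylogarithm as an iterated integral. -/
theorem isValue_flow {d : ℕ} (n : Fin d → ℕ+) (z : Fin d → ℂ)
    (hz : ∀ i, -(∏ j ∈ Finset.Ici i, z j) ∈ slitPlane) :
    IsValue n z (flow (flowList n fun i => ∏ j ∈ Finset.Ici i, z j) 0) := by
  set X : Fin d → ℂ → ℂ := fun i t => ∏ j ∈ Finset.Ici i, t * z j with hX
  have hXd : ∀ i, Differentiable ℂ (X i) := fun i => by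
    simp only [hX]
    fun_prop
  have hXt : ∀ i t, X i t = t ^ (Finset.Ici i).card * ∏ j ∈ Finset.Ici i, z j := fun i t => by
    simp only [hX, Finset.prod_mul_distrib, Finset.prod_const]
  have hlist : ∀ t, ((List.ofFn fun i => ((n i : ℕ) - 1, i)).reverse.map
      fun p => (p.1, X p.2 t)) = flowList n fun i => X i t := fun t => by
    rw [flowList, List.map_reverse, List.map_ofFn]
    rfl
  set U : Set ℂ := {t | ∀ i, 1 - X i t ∈ slitPlane} with hU
  have hUo : IsOpen U := by
    rw [hU, Set.ofPred_forall]
    exact isOpen_iInter_of_finite fun i => Complex.isOpen_slitPlane.preimage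
      (continuous_const.sub (hXd i).continuous)
  have hol := holTame_flow hUo X (List.ofFn fun i => ((n i : ℕ) - 1, i)).reverse
    (fun p _ => (hXd p.2).differentiableOn) (fun p _ t ht => ht p.2)
  simp only [hlist] at hol
  refine ⟨fun t => flow (flowList n fun i => X i t) 0, ?_, ?_, ?_⟩
  · refine ((hol.diff 0 le_rfl).analyticOnNhd hUo).mono ?_
    rintro _ ⟨a, b, ha, hb, hab, rfl⟩
    intro i
    have : a • (0 : ℂ) + b • 1 = (b : ℂ) := by simp
    rw [this, hXt, mul_comm]
    -- At b > 0 each suffix product is a positive multiple of its value at 1 and avoids [0, ∞); at 0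
    -- it vanishes. Either way it avoids [1, ∞).
    rcases hb.eq_or_lt with rfl | hb
    · have hc : (Finset.Ici i).card ≠ 0 := Finset.card_ne_zero.2 ⟨i, by simp⟩
      rw [Complex.ofReal_zero, zero_pow hc, mul_zero, sub_zero]
      exact Complex.one_mem_slitPlane
    · rw [← Complex.ofReal_pow]
      exact one_sub_mem_slitPlane (neg_mul_real_mem_slitPlane (hz i) (pow_pos hb _))
  · have hsmall : ∀ i, ∀ᶠ t in 𝓝 (0 : ℂ), ‖X i t‖ < 1 := fun i => by
      have hc : (Finset.Ici i).card ≠ 0 := Finset.card_ne_zero.2 ⟨i, by simp⟩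
      have : Tendsto (fun t => ‖X i t‖) (𝓝 0) (𝓝 ‖X i 0‖) :=
        ((hXd i).continuous.tendsto 0).norm
      refine this.eventually_lt_const ?_
      rw [hXt, zero_pow hc, zero_mul, norm_zero]
      exact one_pos
    filter_upwards [eventually_all.2 hsmall] with t ht
    have := (hasSum_flow n (fun i => X i t) ht).2 0 le_rfl
    refine this.congr_fun fun k => ?_
    have h1 := flowCoeff_eq n (fun i => t * z i) 1 k.2
    simp only [mul_one, one_pow] at h1
    simp [hX, h1]
  · simp [hX]

end MPL

/-! ### Translation of blocks in the suffix products into generators. -/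

namespace MPL

/-! ### Generators from lists -/

/-- The polylogarithm with the indices and the arguments given by a list. -/
noncomputable def listLi {N : ℕ} (z : Fin N → ℂ) (l : List (ℕ+ × Fin N × Fin N)) : ℂ :=
  Li (fun a : Fin l.length => l[a].1) (fun a => consecProd z l[a].2.1 l[a].2.2)

/-- The polylogarithm with the indices and the arguments given by a list is defined. -/
def ListDefined {N : ℕ} (z : Fin N → ℂ) (l : List (ℕ+ × Fin N × Fin N)) : Prop :=
  IsDefinedAt (fun a : Fin l.length => l[a].1) (fun a => consecProd z l[a].2.1 l[a].2.2)

theorem li_eq_listLi {N k : ℕ} (z : Fin N → ℂ) {l : List (ℕ+ × Fin N × Fin N)}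
    {g : Fin k → ℕ+ × Fin N × Fin N} (h : k = l.length) (hg : ∀ a, g a = l[Fin.cast h a]) :
    Li (fun a => (g a).1) (fun a => consecProd z (g a).2.1 (g a).2.2) = listLi z l ∧
      (IsDefinedAt (fun a => (g a).1) (fun a => consecProd z (g a).2.1 (g a).2.2) ↔
        ListDefined z l) := by
  subst h
  obtain rfl : g = fun a => l[a] := funext hg
  exact ⟨rfl, Iff.rfl⟩

/-- The composition of the length of a flattened list into the lengths of its parts. -/
def flattenComposition {α : Type*} (bs : List (List α)) (h : ∀ l ∈ bs, l ≠ []) :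
    Composition bs.flatten.length where
  blocks := bs.map List.length
  blocks_pos := fun {i} hi => by
    obtain ⟨l, hl, rfl⟩ := List.mem_map.1 hi
    exact List.length_pos_iff.2 (h l hl)
  blocks_sum := by rw [List.length_flatten]

theorem flattenComposition_length {α : Type*} (bs : List (List α)) (h : ∀ l ∈ bs, l ≠ []) :
    (flattenComposition bs h).length = bs.length := List.length_map _

theorem flattenComposition_blocksFun {α : Type*} (bs : List (List α)) (h : ∀ l ∈ bs, l ≠ [])
    (p : Fin (flattenComposition bs h).length) :
    (flattenComposition bs h).blocksFun p =
      (bs[Fin.cast (flattenComposition_length bs h) p]).length := by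
  exact List.getElem_map _

theorem flattenComposition_embedding {α : Type*} (bs : List (List α)) (h : ∀ l ∈ bs, l ≠ [])
    (p : Fin (flattenComposition bs h).length)
    (a : Fin ((flattenComposition bs h).blocksFun p)) :
    bs.flatten[(flattenComposition bs h).embedding p a] =
      (bs[Fin.cast (flattenComposition_length bs h) p])[Fin.cast
        (flattenComposition_blocksFun bs h p) a] := by
  have h1 := List.drop_take_succ_flatten_eq_getElem bs p
    (by simpa [flattenComposition_length] using p.2)
  have h2 : (flattenComposition bs h).embedding p a =
      (((bs.map List.length).take p).sum + a : ℕ) := rfl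
  simp only [Fin.getElem_fin, Fin.val_cast]
  simp only [← h1, List.getElem_drop, List.getElem_take, h2]

/-- The generator given by a list of blocks. -/
def listGenerator {N D w : ℕ} (k : Fin N → ℕ) (bs : List (List (ℕ+ × Fin N × Fin N)))
    (h : ∀ l ∈ bs, l ≠ []) (hD : bs.flatten.length ≤ D) (hle : ∀ t ∈ bs.flatten, t.2.1 ≤ t.2.2)
    (hlt : bs.flatten.Pairwise fun t t' => t.2.2 < t'.2.1)
    (hw : ∑ i, k i + (bs.flatten.map fun t => (t.1 : ℕ)).sum = w) : Generator N D w where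
  k := k
  r := bs.flatten.length
  r_le := hD
  n a := bs.flatten[a].1
  lo a := bs.flatten[a].2.1
  hi a := bs.flatten[a].2.2
  lo_le_hi a := hle _ (List.getElem_mem _)
  hi_lt_lo a b hab := List.pairwise_iff_getElem.1 hlt a b a.2 b.2 hab
  blocks := flattenComposition bs h
  weight := by
    rw [← hw]
    congr 1
    exact Fin.sum_univ_fun_getElem bs.flatten fun t => (t.1 : ℕ)

theorem listGenerator_li {N D w : ℕ} (k : Fin N → ℕ) (bs : List (List (ℕ+ × Fin N × Fin N)))
    (h : ∀ l ∈ bs, l ≠ []) (hD : bs.flatten.length ≤ D) (hle : ∀ t ∈ bs.flatten, t.2.1 ≤ t.2.2)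
    (hlt : bs.flatten.Pairwise fun t t' => t.2.2 < t'.2.1)
    (hw : ∑ i, k i + (bs.flatten.map fun t => (t.1 : ℕ)).sum = w) (z : Fin N → ℂ)
    (p : Fin (flattenComposition bs h).length) :
    Li ((listGenerator k bs h hD hle hlt hw).index p) ((listGenerator k bs h hD hle hlt hw).arg z p) =
        listLi z bs[Fin.cast (flattenComposition_length bs h) p] ∧
      (IsDefinedAt ((listGenerator k bs h hD hle hlt hw).index p)
          ((listGenerator k bs h hD hle hlt hw).arg z p) ↔
        ListDefined z bs[Fin.cast (flattenComposition_length bs h) p]) :=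
  li_eq_listLi z (flattenComposition_blocksFun bs h p) (flattenComposition_embedding bs h p)

theorem listGenerator_isDefined {N D w : ℕ} (k : Fin N → ℕ)
    (bs : List (List (ℕ+ × Fin N × Fin N)))
    (h : ∀ l ∈ bs, l ≠ []) (hD : bs.flatten.length ≤ D) (hle : ∀ t ∈ bs.flatten, t.2.1 ≤ t.2.2)
    (hlt : bs.flatten.Pairwise fun t t' => t.2.2 < t'.2.1)
    (hw : ∑ i, k i + (bs.flatten.map fun t => (t.1 : ℕ)).sum = w)
    (hd : ∀ z ∈ domain N, ∀ l ∈ bs, ListDefined z l) :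
    (listGenerator k bs h hD hle hlt hw).IsDefined := fun z hz p =>
  (listGenerator_li k bs h hD hle hlt hw z p).2.2 (hd z hz _ (List.getElem_mem _))

theorem listGenerator_eval {N D w : ℕ} (k : Fin N → ℕ)
    (bs : List (List (ℕ+ × Fin N × Fin N)))
    (h : ∀ l ∈ bs, l ≠ []) (hD : bs.flatten.length ≤ D) (hle : ∀ t ∈ bs.flatten, t.2.1 ≤ t.2.2)
    (hlt : bs.flatten.Pairwise fun t t' => t.2.2 < t'.2.1)
    (hw : ∑ i, k i + (bs.flatten.map fun t => (t.1 : ℕ)).sum = w) (z : Fin N → ℂ) :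
    (listGenerator k bs h hD hle hlt hw).eval z =
      (∏ i, beta (k i) (∏ j ∈ Finset.Ici i, z j)) * (bs.map (listLi z)).prod := by
  have h1 : (∏ p, Li ((listGenerator k bs h hD hle hlt hw).index p)
      ((listGenerator k bs h hD hle hlt hw).arg z p)) = (bs.map (listLi z)).prod := by
    rw [← Fin.prod_univ_fun_getElem]
    exact Fintype.prod_equiv (finCongr (flattenComposition_length bs h)) _ _
      fun p => (listGenerator_li k bs h hD hle hlt hw z p).1
  exact congrArg _ h1

/-! ### The suffix products -/

/-- The products `z_i ⋯ z_d`. -/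
noncomputable def suffix {d : ℕ} (z : Fin d → ℂ) (i : Fin d) : ℂ := ∏ j ∈ Finset.Ici i, z j

/-- The index before `e`. -/
def predIndex {d : ℕ} (i : Fin d) (e : WithTop (Fin d)) : Fin d :=
  -- The top element plays the role of the index d, so its predecessor is d - 1; i only witnesses d
  -- > 0 there.
  ⟨e.recTopCoe d (fun j => (j : ℕ)) - 1, by
    induction e using WithTop.recTopCoe with
    | top => exact Nat.sub_lt (Fin.pos i) one_pos
    | coe j => exact (Nat.sub_le _ _).trans_lt j.2⟩

theorem predIndex_lt {d : ℕ} {i : Fin d} {e : WithTop (Fin d)} (h : i < e) :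
    (predIndex i e : WithTop (Fin d)) < e := by
  induction e using WithTop.recTopCoe with
  | top => exact WithTop.coe_lt_top _
  | coe j =>
    have h' : (i : ℕ) < j := Fin.lt_def.1 (WithTop.coe_lt_coe.1 h)
    refine WithTop.coe_lt_coe.2 (Fin.lt_def.2 ?_)
    change (j : ℕ) - 1 < j
    omega

theorem le_predIndex {d : ℕ} {i : Fin d} {e : WithTop (Fin d)} (h : i < e) :
    i ≤ predIndex i e := by
  induction e using WithTop.recTopCoe with
  | top => exact Fin.le_def.2 (Nat.le_sub_one_of_lt i.2)
  | coe j =>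
    have h' : (i : ℕ) < j := Fin.lt_def.1 (WithTop.coe_lt_coe.1 h)
    exact Fin.le_def.2 (Nat.le_sub_one_of_lt h')

theorem consecProd_mul_den {d : ℕ} (z : Fin d → ℂ) {i : Fin d} {e : WithTop (Fin d)} (h : i < e) :
    consecProd z i (predIndex i e) * den e (suffix z) = suffix z i := by
  induction e using WithTop.recTopCoe with
  | top =>
    rw [den_top, mul_one, consecProd, suffix]
    congr 1
    ext j
    simp only [Finset.mem_Icc, Finset.mem_Ici, and_iff_left_iff_imp]
    intro _
    exact Fin.le_def.2 (Nat.le_sub_one_of_lt j.2)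
  | coe e =>
    have h' : (i : ℕ) < e := Fin.lt_def.1 (WithTop.coe_lt_coe.1 h)
    rw [den_coe, consecProd, suffix, suffix, ← Finset.prod_union]
    · congr 1
      ext j
      simp only [Finset.mem_union, Finset.mem_Icc, Finset.mem_Ici, Fin.le_def, predIndex,
        WithTop.recTopCoe_coe]
      omega
    · rw [Finset.disjoint_left]
      intro j hj hj'
      simp only [Finset.mem_Icc, Finset.mem_Ici, Fin.le_def, predIndex,
        WithTop.recTopCoe_coe] at hj hj'
      omega

theorem suffix_mem_dom {d : ℕ} {z : Fin d → ℂ} (hz : z ∈ domain d) : suffix z ∈ Dom (Fin d) := by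
  have hc : ∀ i j, i ≤ j → -(consecProd z i j) ∈ slitPlane := fun i j hij =>
    neg_mem_slitPlane_iff.2 fun r hr => hz i j hij r hr
  have h1 : ∀ i, -(suffix z i) ∈ slitPlane := fun i => by
    have := consecProd_mul_den z (WithTop.coe_lt_top i)
    rw [den_top, mul_one] at this
    rw [← this]
    exact hc _ _ (le_predIndex (WithTop.coe_lt_top i))
  have h2 : ∀ a b, a < b → -(suffix z a / suffix z b) ∈ slitPlane := fun a b hab => by
    have hab' := WithTop.coe_lt_coe.2 hab
    have := consecProd_mul_den z hab'
    rw [den_coe] at this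
    rw [← this, mul_div_cancel_right₀ _ (ne_zero_of_neg_mem_slitPlane (h1 b))]
    exact hc _ _ (le_predIndex hab')
  refine ⟨h1, fun a b hab => ?_⟩
  rcases lt_or_gt_of_ne hab with h | h
  · exact h2 a b h
  · rw [← inv_div]
    exact neg_inv_mem_slitPlane (h2 b a h)

/-! ### Blocks as polylogarithms -/

/-- The first index of the list, or `e`. -/
def nextIndex {d : ℕ} (e : WithTop (Fin d)) : List (ℕ × Fin d) → WithTop (Fin d)
  | [] => e
  | p :: _ => p.2

/-- The indices and the arguments of the polylogarithm that is the value of a block. -/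
def triples {d : ℕ} (e : WithTop (Fin d)) : List (ℕ × Fin d) → List (ℕ+ × Fin d × Fin d)
  | [] => []
  | p :: R => (p.1.succPNat, p.2, predIndex p.2 (nextIndex e R)) :: triples e R

theorem length_triples {d : ℕ} (e : WithTop (Fin d)) (R : List (ℕ × Fin d)) :
    (triples e R).length = R.length := by
  induction R with
  | nil => rfl
  | cons p R ih => simp [triples, ih]

theorem sum_triples {d : ℕ} (e : WithTop (Fin d)) (R : List (ℕ × Fin d)) :
    ((triples e R).map fun t => (t.1 : ℕ)).sum = wt R := by
  induction R with
  | nil => rfl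
  | cons p R ih => simp [triples, ih]

/-- The list of indices is increasing and bounded by `e`. -/
def IncBelow {d : ℕ} (e : WithTop (Fin d)) (R : List (ℕ × Fin d)) : Prop :=
  (R.map Prod.snd).Pairwise (· < ·) ∧ ∀ q ∈ R, (q.2 : WithTop (Fin d)) < e

theorem IncBelow.tail {d : ℕ} {e : WithTop (Fin d)} {p : ℕ × Fin d} {R : List (ℕ × Fin d)}
    (h : IncBelow e (p :: R)) : IncBelow e R ∧ (p.2 : WithTop (Fin d)) < nextIndex e R := by
  refine ⟨⟨(List.pairwise_cons.1 h.1).2, fun q hq => h.2 q (List.mem_cons_of_mem _ hq)⟩, ?_⟩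
  rcases R with _ | ⟨q, R⟩
  · exact h.2 p (by simp)
  · exact WithTop.coe_lt_coe.2 ((List.pairwise_cons.1 h.1).1 q.2 (by simp))

theorem mem_triples {d : ℕ} {e : WithTop (Fin d)} {R : List (ℕ × Fin d)} (h : IncBelow e R) :
    ∀ t ∈ triples e R, nextIndex e R ≤ t.2.1 ∧ t.2.1 ≤ t.2.2 ∧ (t.2.2 : WithTop (Fin d)) < e := by
  induction R with
  | nil => simp [triples]
  | cons p R ih =>
    obtain ⟨h1, h2⟩ := h.tail
    have hne : nextIndex e R ≤ e := by
      rcases R with _ | ⟨q, R⟩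
      · exact le_rfl
      · exact (h1.2 q (by simp)).le
    refine List.forall_mem_cons.2 ⟨⟨le_rfl, le_predIndex h2, (predIndex_lt h2).trans_le hne⟩,
      fun t ht => ?_⟩
    obtain ⟨a1, a2, a3⟩ := ih h1 t ht
    exact ⟨h2.le.trans a1, a2, a3⟩

theorem pairwise_triples {d : ℕ} {e : WithTop (Fin d)} {R : List (ℕ × Fin d)}
    (h : IncBelow e R) : (triples e R).Pairwise fun t t' => t.2.2 < t'.2.1 := by
  induction R with
  | nil => exact List.Pairwise.nil
  | cons p R ih =>
    obtain ⟨h1, h2⟩ := h.tail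
    exact List.pairwise_cons.2 ⟨fun t ht =>
      WithTop.coe_lt_coe.1 ((predIndex_lt h2).trans_le (mem_triples h1 t ht).1), ih h1⟩

/-- Consecutive arguments are the quotients x_{i_1}/x_{i_2}, …, x_{i_r}/x_e, so their product
telescopes. -/
theorem prod_triples {d : ℕ} {z : Fin d → ℂ} (hz : z ∈ domain d) {e : WithTop (Fin d)}
    {R : List (ℕ × Fin d)} (h : IncBelow e R) :
    ∏ j : Fin (triples e R).length,
        consecProd z (triples e R)[j].2.1 (triples e R)[j].2.2 =
      den (nextIndex e R) (suffix z) / den e (suffix z) := by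
  have hd := suffix_mem_dom hz
  induction R with
  | nil => exact (div_self (den_ne_zero hd e)).symm
  | cons p R ih =>
    obtain ⟨h1, h2⟩ := h.tail
    refine (Fin.prod_univ_succ (n := (triples e R).length) _).trans ?_
    refine (congrArg _ (ih h1)).trans ?_
    have := consecProd_mul_den z h2
    change consecProd z p.2 (predIndex p.2 (nextIndex e R)) * _ = suffix z p.2 / _
    rw [← this]
    ring

theorem flowList_triples {d : ℕ} {z : Fin d → ℂ} (hz : z ∈ domain d) {e : WithTop (Fin d)}
    {R : List (ℕ × Fin d)} (h : IncBelow e R) :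
    (List.ofFn fun a : Fin (triples e R).length => (((triples e R)[a].1 : ℕ) - 1,
        ∏ j ∈ Finset.Ici a, consecProd z (triples e R)[j].2.1 (triples e R)[j].2.2)) =
      R.map fun p => (p.1, suffix z p.2 / den e (suffix z)) := by
  induction R with
  | nil => rfl
  | cons p R ih =>
    refine (List.ofFn_succ (n := (triples e R).length)).trans ?_
    rw [List.map_cons, ← ih h.tail.1]
    congr 1
    · refine Prod.ext (by simp [triples]) ?_
      have := prod_triples hz h
      change (∏ j ∈ Finset.Ici (0 : Fin ((triples e R).length + 1)),
        consecProd z (triples e (p :: R))[j].2.1 (triples e (p :: R))[j].2.2) = _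
      rw [show Finset.Ici (0 : Fin ((triples e R).length + 1)) = Finset.univ by
        ext; simp]
      exact this
    · refine congrArg List.ofFn (funext fun a => Prod.ext rfl ?_)
      exact Fin.prod_Ici_succ (fun j : Fin ((triples e R).length + 1) =>
        consecProd z (triples e (p :: R))[j].2.1 (triples e (p :: R))[j].2.2) a

theorem isValue_triples {d : ℕ} {z : Fin d → ℂ} (hz : z ∈ domain d) {e : WithTop (Fin d)}
    {L : List (ℕ × Fin d)} (h : IncBelow e L.reverse) :
    IsValue (fun a : Fin (triples e L.reverse).length => (triples e L.reverse)[a].1)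
      (fun a => consecProd z (triples e L.reverse)[a].2.1 (triples e L.reverse)[a].2.2)
      (block e L (suffix z)) := by
  have h1 := flowList_triples hz h
  have h2 := isValue_flow (fun a : Fin (triples e L.reverse).length => (triples e L.reverse)[a].1)
    (fun a => consecProd z (triples e L.reverse)[a].2.1 (triples e L.reverse)[a].2.2) fun i => by
      have h3 : ((((triples e L.reverse)[i].1 : ℕ) - 1, ∏ j ∈ Finset.Ici i,
          consecProd z (triples e L.reverse)[j].2.1 (triples e L.reverse)[j].2.2)) ∈
            L.reverse.map fun p => (p.1, suffix z p.2 / den e (suffix z)) := by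
        rw [← h1]
        exact (List.mem_ofFn' _ _).2 ⟨i, rfl⟩
      obtain ⟨p, hp, hpe⟩ := List.mem_map.1 h3
      have h4 : _ = ∏ j ∈ Finset.Ici i, consecProd z (triples e L.reverse)[j].2.1
        (triples e L.reverse)[j].2.2 := congrArg Prod.snd hpe
      rw [← h4]
      exact neg_div_den_mem (suffix_mem_dom hz) (h.2 p hp).ne
  rw [flowList, h1, List.map_reverse, List.reverse_reverse] at h2
  exact h2

/-! ### The parity theorem -/

/-- The blocks as lists of indices and arguments. -/
def seqTriples {d : ℕ} (bs : List (WithTop (Fin d) × List (ℕ × Fin d))) :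
    List (List (ℕ+ × Fin d × Fin d)) := bs.map fun p => triples p.1 p.2.reverse

theorem incBelow_reverse {d : ℕ} {e : WithTop (Fin d)} {L : List (ℕ × Fin d)}
    (h : (L.map Prod.snd).Pairwise (· > ·)) (he : ∀ q ∈ L, (q.2 : WithTop (Fin d)) < e) :
    IncBelow e L.reverse := by
  refine ⟨?_, fun q hq => he q (List.mem_reverse.1 hq)⟩
  rw [List.map_reverse, List.pairwise_reverse]
  exact h

theorem mem_seqTriples {d : ℕ} {a b : WithTop (Fin d)}
    {bs : List (WithTop (Fin d) × List (ℕ × Fin d))} (h : ValidSeq a bs b) :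
    (∀ t ∈ (seqTriples bs).flatten, a ≤ t.2.1 ∧ t.2.1 ≤ t.2.2) ∧
      (seqTriples bs).flatten.Pairwise fun t t' => t.2.2 < t'.2.1 := by
  induction bs generalizing a with
  | nil => simp [seqTriples]
  | cons p bs ih =>
    obtain ⟨h1, h2, h3, h4⟩ := h
    obtain ⟨i1, i2⟩ := ih h4
    have hinc := incBelow_reverse h2 fun q hq => (h3 q hq).2
    have hm := mem_triples hinc
    have hle : a ≤ nextIndex p.1 p.2.reverse := by
      rcases hR : p.2.reverse with _ | ⟨q, R⟩
      · exact absurd (List.reverse_eq_nil_iff.1 hR) h1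
      · exact (h3 q (List.mem_reverse.1 (by rw [hR]; simp))).1
    have hap : a ≤ p.1 := by
      obtain ⟨q, hq⟩ := List.exists_mem_of_ne_nil _ h1
      exact (h3 q hq).1.trans (h3 q hq).2.le
    have hcons : (seqTriples (p :: bs)).flatten =
        triples p.1 p.2.reverse ++ (seqTriples bs).flatten := by simp [seqTriples]
    rw [hcons, List.pairwise_append]
    refine ⟨fun t ht => ?_, pairwise_triples hinc, i2, fun t ht t' ht' =>
      WithTop.coe_lt_coe.1 ((hm t ht).2.2.trans_le (i1 t' ht').1)⟩
    rcases List.mem_append.1 ht with ht | ht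
    · exact ⟨hle.trans (hm t ht).1, (hm t ht).2.1⟩
    · exact ⟨hap.trans (i1 t ht).1, (i1 t ht).2⟩

theorem length_flatten_seqTriples {d : ℕ} (bs : List (WithTop (Fin d) × List (ℕ × Fin d))) :
    (seqTriples bs).flatten.length = depthSeq bs := by
  simp [seqTriples, depthSeq, List.length_flatten, Function.comp_def, length_triples]

theorem wt_reverse {α : Type*} (L : List (ℕ × α)) : wt L.reverse = wt L := by simp [wt]

theorem sum_flatten_seqTriples {d : ℕ} (bs : List (WithTop (Fin d) × List (ℕ × Fin d))) :
    ((seqTriples bs).flatten.map fun t => (t.1 : ℕ)).sum = wtSeq bs := by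
  induction bs with
  | nil => rfl
  | cons p bs ih =>
    have hcons : (seqTriples (p :: bs)).flatten =
        triples p.1 p.2.reverse ++ (seqTriples bs).flatten := by simp [seqTriples]
    rw [hcons, List.map_append, List.sum_append, sum_triples, ih, wt_reverse]
    simp [wtSeq]

theorem isValue_of_mem_validSeq {d : ℕ} {a b : WithTop (Fin d)}
    {bs : List (WithTop (Fin d) × List (ℕ × Fin d))} (h : ValidSeq a bs b) {z : Fin d → ℂ}
    (hz : z ∈ domain d) : ∀ p ∈ bs,
      ListDefined z (triples p.1 p.2.reverse) ∧
      listLi z (triples p.1 p.2.reverse) = block p.1 p.2 (suffix z) := by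
  induction bs generalizing a with
  | nil => simp
  | cons q bs ih =>
    obtain ⟨h1, h2, h3, h4⟩ := h
    have hv := isValue_triples hz (incBelow_reverse h2 fun q hq => (h3 q hq).2)
    refine List.forall_mem_cons.2 ⟨⟨⟨_, hv⟩, hv.li_eq⟩, ih h4⟩

/-- The suffix products, as a map between the domains. -/
noncomputable def suffixMap (d : ℕ) (z : domain d) : Dom (Fin d) :=
  ⟨suffix z.1, suffix_mem_dom z.2⟩

theorem ne_nil_of_mem_seqTriples {d : ℕ} {a b : WithTop (Fin d)}
    {bs : List (WithTop (Fin d) × List (ℕ × Fin d))} (h : ValidSeq a bs b) :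
    ∀ l ∈ seqTriples bs, l ≠ [] := by
  induction bs generalizing a with
  | nil => simp [seqTriples]
  | cons q bs ih =>
    obtain ⟨h1, _, _, h4⟩ := h
    refine List.forall_mem_cons.2 ⟨fun h0 => h1 ?_, ih h4⟩
    have := congrArg List.length h0
    rw [length_triples] at this
    simpa using this

theorem comp_suffixMap_mem {d D w : ℕ} {a b : WithTop (Fin d)} {f : Dom (Fin d) → ℂ}
    (hf : f ∈ polyMod a b D w) : f ∘ suffixMap d ∈ polylogModule d D w := by
  induction hf using Submodule.span_induction with
  | mem f hf =>
    obtain ⟨k, bs, h1, h2, h3, h4, rfl⟩ := hf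
    obtain ⟨m1, m2⟩ := mem_seqTriples h2
    have hne := ne_nil_of_mem_seqTriples h2
    have hd : ∀ z ∈ domain d, ∀ l ∈ seqTriples bs, ListDefined z l := fun z hz l hl => by
      obtain ⟨p, hp, rfl⟩ := List.mem_map.1 hl
      exact (isValue_of_mem_validSeq h2 hz p hp).1
    have hD := (length_flatten_seqTriples bs).trans_le h3
    have hw : ∑ i, k i + ((seqTriples bs).flatten.map fun t => (t.1 : ℕ)).sum = w := by
      rw [sum_flatten_seqTriples, h4]
    refine Submodule.subset_span ⟨listGenerator k (seqTriples bs) hne hD (fun t ht => (m1 t ht).2)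
      m2 hw, listGenerator_isDefined _ _ _ _ _ _ _ hd, funext fun z => ?_⟩
    rw [listGenerator_eval, seqTriples, List.map_map]
    refine congrArg _ (congrArg List.prod (List.map_congr_left fun p hp => ?_))
    exact ((isValue_of_mem_validSeq h2 z.2 p hp).2).symm
  | zero => exact zero_mem _
  | add f g _ _ hf hg => exact add_mem hf hg
  | smul c f _ hf => exact Submodule.smul_mem _ c hf

/-- The indices of a multiple polylogarithm as a block. -/
def indexBlock {d : ℕ} (n : Fin d → ℕ+) : List (ℕ × Fin d) :=
  (List.ofFn fun i => ((n i : ℕ) - 1, i)).reverse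

theorem map_indexBlock {d : ℕ} (n : Fin d → ℕ+) (f : Fin d → ℂ) :
    (indexBlock n).map (fun p => (p.1, f p.2)) = flowList n f := by
  rw [indexBlock, flowList, List.map_reverse, List.map_ofFn]
  rfl

theorem wt_indexBlock {d : ℕ} (n : Fin d → ℕ+) : wt (indexBlock n) = ∑ i, (n i : ℕ) := by
  rw [indexBlock, wt_reverse, wt, List.map_ofFn, List.sum_ofFn]
  exact Finset.sum_congr rfl fun i _ => Nat.sub_add_cancel (n i).pos

theorem sum_fst_indexBlock {d : ℕ} (n : Fin d → ℕ+) :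
    ((indexBlock n).map Prod.fst).sum = (∑ i, (n i : ℕ)) - d := by
  have h1 : ((indexBlock n).map Prod.fst).sum = ∑ i, ((n i : ℕ) - 1) := by
    rw [indexBlock, List.map_reverse, List.sum_reverse, List.map_ofFn, List.sum_ofFn]
    rfl
  have h2 : ∑ i, ((n i : ℕ) - 1) + d = ∑ i, (n i : ℕ) := by
    rw [← wt_indexBlock, indexBlock, wt_reverse, wt, List.map_ofFn, List.sum_ofFn]
    simp [Finset.sum_add_distrib]
  omega

theorem pairwise_indexBlock {d : ℕ} (n : Fin d → ℕ+) :
    ((indexBlock n).map Prod.snd).Pairwise (· > ·) := by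
  rw [indexBlock, List.map_reverse, List.pairwise_reverse, List.map_ofFn, List.pairwise_ofFn]
  exact fun i j h => h

theorem isValue_suffix {d : ℕ} (n : Fin d → ℕ+) {z : Fin d → ℂ} (hz : z ∈ domain d) :
    IsValue n z (block ⊤ (indexBlock n) (suffix z)) := by
  rw [block, map_indexBlock n fun i => suffix z i / den ⊤ (suffix z)]
  simp only [den_top, div_one]
  exact isValue_flow n z (suffix_mem_dom hz).1

theorem isValue_suffix_inv {d : ℕ} (n : Fin d → ℕ+) {z : Fin d → ℂ} (hz : z ∈ domain d) :
    IsValue n (fun i => (z i)⁻¹) (flow (flowList n fun i => (suffix z i)⁻¹) 0) := by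
  have h : ∀ i, ∏ j ∈ Finset.Ici i, (z j)⁻¹ = (suffix z i)⁻¹ := fun i => Finset.prod_inv_distrib _
  have := isValue_flow n (fun i => (z i)⁻¹) fun i => by
    rw [h]
    exact neg_inv_mem_slitPlane ((suffix_mem_dom hz).1 i)
  simpa only [h] using this

theorem pli_eq {d : ℕ} (n : Fin d → ℕ+) {z : Fin d → ℂ} (hz : z ∈ domain d) :
    PLi n z = block ⊤ (indexBlock n) (suffix z) - inverted (indexBlock n) (suffix z) := by
  rw [PLi, (isValue_suffix n hz).li_eq, (isValue_suffix_inv n hz).li_eq, inverted,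
    sum_fst_indexBlock, map_indexBlock n fun i => (suffix z i)⁻¹]

end MPL

end

theorem mainTheorem1 (d : ℕ) (hd : 1 ≤ d) (n : Fin d → ℕ+) :
    (∀ z ∈ MPL.domain d,
      MPL.IsDefinedAt n z ∧ MPL.IsDefinedAt n (fun i => (z i)⁻¹)) ∧
    (fun z : MPL.domain d => MPL.PLi n z) ∈
      MPL.polylogModule d (d - 1) (∑ i, (n i : ℕ)) := by
  refine ⟨fun z hz => ⟨⟨_, MPL.isValue_suffix n hz⟩, ⟨_, MPL.isValue_suffix_inv n hz⟩⟩, ?_⟩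
  have hlen : (MPL.indexBlock n).length = d := by simp [MPL.indexBlock]
  -- The smallest index, which exists since d ≥ 1, serves as lower bound, so the range condition is
  -- empty.
  have h := MPL.comp_suffixMap_mem (MPL.block_sub_inverted_mem _ ((⟨0, hd⟩ : Fin d) : WithTop (Fin d))
    (MPL.indexBlock n) le_rfl
    (List.ne_nil_of_length_pos (hlen.symm ▸ hd)) (MPL.pairwise_indexBlock n)
    fun _ _ => WithTop.coe_le_coe.2 (Fin.le_def.2 (Nat.zero_le _)))
  rw [hlen, MPL.wt_indexBlock] at h
  convert! h using 1
  exact funext fun z => MPL.pli_eq n z.2
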